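/- For an integer $M\ge 1$ put $h=\pi/M$ and let $\mathbb{T}_h=\{hj: j=-M,\dots,M-1\}$, $\mathbb{T}_h^*=\{-M,\dots,M-1\}$. For $f:\mathbb{T}_h\to\mathbb{C}$ let $\|f\|_{L^p_h}^p=h\sum_{x\in\mathbb{T}_h}|f(x)|^p$ for $1\le p<\infty$ and $\|f\|_{L^\infty_h}=\max_{x}|f(x)|$; let $\mathcal{F}_h[f](k)=h\sum_{x\in\mathbb{T}_h}f(x)e^{-ikx}$ for $k\in\mathbb{T}_h^*$, with inverse $\mathcal{F}_h^{-1}[g](x)=\frac1{2\pi}\sum_{k\in\mathbb{T}_h^*}g(k)e^{ikx}$, and $\|f\|_{H^s_h}^2=\frac1{2\pi}\sum_{k\in\mathbb{T}_h^*}(1+k^2)^{s}|\mathcal{F}_h[f](k)|^2$. For $a>0$ let $|\nabla_h|^a=(-\Delta_h)^{a/2}$ be the Fourier multiplier with symbol $\left|\frac2h\sin\frac{hk}{2}\right|^a$, and let $U_h(t)=e^{-it(-\Delta_h)^{\alpha/2}}$. For $T>0$ let $X_T=C([0,T];L^2_h)\cap L^6([0,T];L^\infty_h)$. For $\mu\in\{1,-1\}$,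 a solution on $[0,T]$ of the fractional discrete nonlinear Schrödinger equation (fDNLS) $i\dot u_h=(-\Delta_h)^{\alpha/2}u_h+\mu|u_h|^2u_h$ with datum $u_{h,0}:\mathbb{T}_h\to\mathbb{C}$ is a function $u_h\in X_T$ such that, for all $t\in[0,T]$, $$u_h(t)=U_h(t)u_{h,0}-i\mu\int_0^tU_h(t-\tau)\left(|u_h(\tau)|^2u_h(\tau)\right)d\tau .$$ **Proposition.** Let $\alpha\in(1,2]$. There is a constant $\kappa>0$, depending only on $\alpha$, such that for every $s>\frac13$ the following hold. 1. For every $\mu\in\{1,-1\}$, every $M\ge1$, every $u_{h,0}:\mathbb{T}_h\to\mathbb{C}$ and every $T>0$ with $T\|u_{h,0}\|_{H^s_h}^{3}\le\kappa$ (so, if $u_{h,0}\ne0$, up to and including the time $T_h=\kappa\|u_{h,0}\|_{H^s_h}^{-3}$, whose constant does not depend on $h$), there is a unique solution $u_h\in X_T$ of the fDNLS on $[0,T]$ with datum $u_{h,0}$. The discrete mass $M_h[u_h(t)]=\|u_h(t)\|_{L^2_h}^2$ and the discrete energy $H_h[u_h(t)]=\frac12\||\nabla_h|^{\alpha/2}u_h(t)\|_{L^2_h}^2+\frac\mu4\|u_h(t)\|_{L^4_h}^4$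 are conserved: for all $t\in[0,T]$ they equal their values at $u_{h,0}$. 2. There are constants $0<c\le\kappa$ and $C>0$, depending only on $\alpha$ and $s$ (hence not on $h$), such that for every $\mu\in\{1,-1\}$, every $M\ge1$, all data $u_{h,0},v_{h,0}:\mathbb{T}_h\to\mathbb{C}$ and every $T\in(0,1]$ with $T\|u_{h,0}\|_{H^s_h}^3\le c$ and $T\|v_{h,0}\|_{H^s_h}^3\le c$, the corresponding solutions $u_h,v_h$ on $[0,T]$ satisfy $$\sup_{t\in[0,T]}\|u_h(t)\|_{H^s_h}\le C\|u_{h,0}\|_{H^s_h},\qquad \|u_h\|_{L^6([0,T];L^\infty_h)}\le C\|u_{h,0}\|_{H^s_h},$$ $$\sup_{t\in[0,T]}\|u_h(t)-v_h(t)\|_{H^s_h}\le C\|u_{h,0}-v_{h,0}\|_{H^s_h},\qquad \|u_h-v_h\|_{L^6([0,T];L^\infty_h)}\le C\|u_{h,0}-v_{h,0}\|_{H^s_h}.$$ -/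

import Mathlib

noncomputable section

namespace FDNLS

/-- The mesh size `h = π / M`. -/
def mesh (M : ℕ) : ℝ := Real.pi / M

/-- The indices `j = -M, …, M - 1` of the points `x = h j` of the periodic lattice `𝕋_h`.
The same set of integers `k = -M, …, M - 1` is the dual lattice `𝕋_h^*`. -/
abbrev Lattice (M : ℕ) : Type := {j : ℤ // j ∈ Finset.Ico (-(M : ℤ)) (M : ℤ)}

/-- The lattice point `x = h j`. -/
def point (M : ℕ) (j : Lattice M) : ℝ := mesh M * ((j : ℤ) : ℝ)

/-- The `L^p_h` norm for finite `p`: `‖f‖ = (h ∑_x |f x|^p)^(1/p)`. -/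
def lpNorm (p : ℝ) (M : ℕ) (f : Lattice M → ℂ) : ℝ :=
  (mesh M * ∑ x : Lattice M, ‖f x‖ ^ p) ^ (1 / p)

/-- The `L^∞_h` norm: the maximum of `|f x|` over the finite lattice. -/
def linftyNorm (M : ℕ) (f : Lattice M → ℂ) : ℝ := ⨆ x : Lattice M, ‖f x‖

/-- The discrete Fourier transform `h ∑_x f(x) e^{-ikx}`. -/
def fourier (M : ℕ) (f : Lattice M → ℂ) (k : Lattice M) : ℂ :=
  (mesh M : ℂ) * ∑ x, f x * Complex.exp (-(Complex.I * (((k : ℤ) : ℝ) * point M x : ℝ)))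

/-- The inverse discrete Fourier transform `(2π)⁻¹ ∑_k g(k) e^{ikx}`. -/
def fourierInv (M : ℕ) (g : Lattice M → ℂ) (x : Lattice M) : ℂ :=
  ((2 * Real.pi : ℝ) : ℂ)⁻¹ * ∑ k, g k * Complex.exp (Complex.I * (((k : ℤ) : ℝ) * point M x : ℝ))

/-- The Fourier multiplier with symbol `m`. -/
def multiplier (M : ℕ) (m : Lattice M → ℂ) (f : Lattice M → ℂ) : Lattice M → ℂ :=
  fourierInv M (fun k => m k * fourier M f k)

/-- The symbol `|(2 / h) sin (h k / 2)|^a` of `|∇_h|^a = (-Δ_h)^{a/2}`. -/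
def symbol (a : ℝ) (M : ℕ) (k : Lattice M) : ℝ :=
  |2 / mesh M * Real.sin (mesh M * ((k : ℤ) : ℝ) / 2)| ^ a

/-- The operator `|∇_h|^a = (-Δ_h)^{a/2}`. -/
def absGrad (a : ℝ) (M : ℕ) (f : Lattice M → ℂ) : Lattice M → ℂ :=
  multiplier M (fun k => (symbol a M k : ℂ)) f

/-- The linear propagator `U_h(t) = e^{-it(-Δ_h)^{α/2}}`. -/
def propagator (α : ℝ) (M : ℕ) (t : ℝ) (f : Lattice M → ℂ) : Lattice M → ℂ :=
  multiplier M (fun k => Complex.exp (-(Complex.I * (t * symbol α M k : ℝ)))) f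

/-- The Japanese bracket `⟨ξ⟩ = (1 + |ξ|²)^{1/2}`. -/
def bracket (ξ : ℝ) : ℝ := Real.sqrt (1 + |ξ| ^ 2)

/-- The discrete Sobolev norm
`‖f‖_{H^s_h} = ((2π)⁻¹ ∑_k ⟨k⟩^{2s} |F_h f (k)|²)^{1/2}`. -/
def sobolevNorm (s : ℝ) (M : ℕ) (f : Lattice M → ℂ) : ℝ :=
  Real.sqrt ((2 * Real.pi)⁻¹ * ∑ k : Lattice M, bracket ((k : ℤ) : ℝ) ^ (2 * s) * ‖fourier M f k‖ ^ 2)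

/-- The nonlinearity `|f|² f`. -/
def cubic (M : ℕ) (f : Lattice M → ℂ) : Lattice M → ℂ := fun x => ((‖f x‖ ^ 2 : ℝ) : ℂ) * f x

/-- The norm of `L^6([0,T]; L^∞_h)`, with values in `[0, ∞]`. -/
def l6LinftyNorm (M : ℕ) (T : ℝ) (u : ℝ → Lattice M → ℂ) : ENNReal :=
  MeasureTheory.eLpNorm (fun t => linftyNorm M (u t)) 6
    (MeasureTheory.volume.restrict (Set.Icc 0 T))

/-- Membership in `X_T = C([0,T]; L²_h) ∩ L⁶([0,T]; L^∞_h)`. Only the values on `[0,T]` matter. -/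
def MemX (M : ℕ) (T : ℝ) (u : ℝ → Lattice M → ℂ) : Prop :=
  (∀ t₀ ∈ Set.Icc 0 T, Filter.Tendsto (fun t => lpNorm 2 M (u t - u t₀))
      (nhdsWithin t₀ (Set.Icc 0 T)) (nhds 0)) ∧
  MeasureTheory.MemLp (fun t => linftyNorm M (u t)) 6
    (MeasureTheory.volume.restrict (Set.Icc 0 T))

/-- `u ∈ X_T` solves the fractional discrete NLS with datum `u₀` on `[0,T]`, in integral form:
`u(t) = U_h(t) u₀ - iμ ∫_0^t U_h(t-τ)(|u(τ)|² u(τ)) dτ`. -/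
def IsSolution (α μ : ℝ) (M : ℕ) (T : ℝ) (u₀ : Lattice M → ℂ) (u : ℝ → Lattice M → ℂ) : Prop :=
  MemX M T u ∧
  ∀ t ∈ Set.Icc 0 T, ∀ x : Lattice M,
    u t x = propagator α M t u₀ x
      - Complex.I * (μ : ℂ) * ∫ τ in (0 : ℝ)..t, propagator α M (t - τ) (cubic M (u τ)) x

/-- The discrete mass `‖f‖²_{L²_h}`. -/
def mass (M : ℕ) (f : Lattice M → ℂ) : ℝ := lpNorm 2 M f ^ 2

/-- The discrete energy `½ ‖|∇_h|^{α/2} f‖²_{L²_h} + (μ/4) ‖f‖⁴_{L⁴_h}`. -/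
def energy (α μ : ℝ) (M : ℕ) (f : Lattice M → ℂ) : ℝ :=
  1 / 2 * lpNorm 2 M (absGrad (α / 2) M f) ^ 2 + μ / 4 * lpNorm 4 M f ^ 4

end FDNLS

end

/-! On a fixed lattice the equation is an ODE in a finite-dimensional space with a smooth vector
field. The field is -i times the gradient of the energy and its pairing with u is purely imaginary,
so energy and mass are conserved. The mass bounds the sup norm, hence nothing blows up, and
existence, uniqueness and both conservation laws hold for every T (`exists_solution`).

The substance is the uniformity in h of the bounds. It rests on a Strichartz estimate with loss,
‖U_h(t)f‖_{L⁶([0,1];L^∞)} ≤ C‖f‖_{H^s} for s > 1/3 (`strichartz`). The dispersion relation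
(sin(aξ)/a)^α, a = h/2, has an inflection point inside the frequency range, which destroys the decay
t^{-1/2} and leaves t^{-1/3}. On a dyadic block of frequencies ~N and for times up to about N^{1-α},
the kernel is an exponential sum whose phase increments stay below 2π. Van der Corput's second
derivative test, applied after excising a neighbourhood of the inflection point of optimal width,
bounds the cube of the kernel by N^{3-α}/|t| (`dispersive_estimate`). A TT* argument turns this into
an L⁶L^∞ bound on such short intervals, at the price of log N (`tt_star`). About N^{α-1} intervals
cover [0,1], so the sixth power of the norm costs N^{α-1}N^{3-α} log N = N² log N, that is a third
of a derivative and a logarithm. The strict inequality s > 1/3 pays for the logarithm and for the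
sum over blocks.

The nonlinearity needs a product estimate A(fg) ≤ K(A(f)B(g) + B(f)A(g)), with A the H^s norm and B
≥ ‖·‖_∞. For s ≤ 1/2, B is the sup norm and H^s is described by dyadic differences
(`sobolevNorm_mul_le_sup`). For s > 1/2, B is the Wiener norm, which H^s controls and the flow
preserves, so no dispersion is needed. `Admissible` isolates what the two cases share. Minkowski and
Hölder in time then give ∫A(|u|²u) ≲ T^{2/3}‖B(u)‖²_{L⁶} sup A(u), so everything closes once
T‖u₀‖³_{H^s} is small: the bounds by a continuity argument (`Admissible.a_priori`), the Lipschitz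
dependence by absorption (`Admissible.difference`). -/

noncomputable section
set_option linter.unusedSectionVars false
namespace FDNLS

/-! ### Discrete Fourier transform and linear flow -/

/-- The residue class modulo `2M` of a lattice index. -/
def res {M : ℕ} (k : Lattice M) : ZMod (2 * M) := ((k : ℤ) : ZMod (2 * M))

/-- Points and frequencies are both systems of representatives modulo 2M. Inversion and Plancherel
then reduce to the orthogonality of the characters of a cyclic group, and translations and
convolutions make sense. -/
lemma res_bijective (M : ℕ) [NeZero M] : Function.Bijective (res : Lattice M → ZMod (2 * M)) := by
  have hM : 0 < M := Nat.pos_of_ne_zero (NeZero.ne M)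
  constructor
  · rintro ⟨a, ha⟩ ⟨b, hb⟩ h
    simp only [res] at h
    rw [ZMod.intCast_eq_intCast_iff_dvd_sub] at h
    simp only [Finset.mem_Ico] at ha hb
    have h0 : b - a = 0 := by
      refine Int.eq_zero_of_abs_lt_dvd h ?_
      rw [abs_lt]; push_cast; constructor <;> linarith
    exact Subtype.ext (by simp only; linarith)
  · intro c
    obtain ⟨n, rfl⟩ := ZMod.intCast_surjective c
    have hp : (0 : ℤ) < 2 * M := by positivity
    have h1 := Int.emod_nonneg (n + M) hp.ne'
    have h2 := Int.emod_lt_of_pos (n + M) hp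
    refine ⟨⟨(n + M) % (2 * M) - M, ?_⟩, ?_⟩
    · simp only [Finset.mem_Ico]; constructor <;> linarith
    · simp only [res]
      rw [ZMod.intCast_eq_intCast_iff_dvd_sub]
      have := Int.emod_add_mul_ediv (n + M) (2 * M)
      refine ⟨(n + M) / (2 * M), ?_⟩
      push_cast
      linarith

/-- The lattice, identified with the cyclic group of order `2M`. -/
def resEquiv (M : ℕ) [NeZero M] : Lattice M ≃ ZMod (2 * M) :=
  Equiv.ofBijective res (res_bijective M)

@[simp] lemma resEquiv_apply {M : ℕ} [NeZero M] (k : Lattice M) : resEquiv M k = res k := rfl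

instance (M : ℕ) [NeZero M] : Nonempty (Lattice M) := ⟨(resEquiv M).symm 0⟩

lemma mesh_pos (M : ℕ) [NeZero M] : 0 < mesh M :=
  div_pos Real.pi_pos (by exact_mod_cast Nat.pos_of_ne_zero (NeZero.ne M))

lemma mesh_mul (M : ℕ) [NeZero M] : mesh M * M = Real.pi :=
  div_mul_cancel₀ _ (by exact_mod_cast NeZero.ne M)

variable {M : ℕ} [NeZero M]

/-- The additive character of `ℤ / 2M`. -/
abbrev chr (a : ZMod (2 * M)) : ℂ := ZMod.stdAddChar a

lemma norm_chr (a : ZMod (2 * M)) : ‖chr a‖ = 1 := AddChar.norm_apply _ a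

lemma chr_add (a b : ZMod (2 * M)) : chr (a + b) = chr a * chr b := AddChar.map_add_eq_mul _ a b

lemma conj_chr (a : ZMod (2 * M)) : (starRingEnd ℂ) (chr a) = chr (-a) := by
  exact (AddChar.map_neg_eq_conj _ a).symm

/-- Since h = π/M, the phase khj equals 2πkj/(2M), which only matters modulo 2M. -/
lemma exp_eq_chr_int (k j : ℤ) :
    Complex.exp (Complex.I * ((k : ℝ) * (mesh M * (j : ℝ)) : ℝ)) =
      chr ((k : ZMod (2 * M)) * (j : ZMod (2 * M))) := by
  rw [chr, ← Int.cast_mul, ZMod.stdAddChar_coe]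
  congr 1
  have : (M : ℂ) ≠ 0 := by exact_mod_cast NeZero.ne M
  simp only [mesh]
  push_cast
  field_simp

lemma exp_eq_chr (k x : Lattice M) :
    Complex.exp (Complex.I * (((k : ℤ) : ℝ) * point M x : ℝ)) = chr (res k * res x) :=
  exp_eq_chr_int _ _

lemma fourier_eq (f : Lattice M → ℂ) (k : Lattice M) :
    fourier M f k = (mesh M : ℂ) * ∑ x, f x * chr (-(res k * res x)) := by
  simp only [fourier]
  congr 1
  refine Finset.sum_congr rfl fun x _ => ?_
  rw [Complex.exp_neg, exp_eq_chr, chr, chr, AddChar.map_neg_eq_inv]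

lemma fourierInv_eq (g : Lattice M → ℂ) (x : Lattice M) :
    fourierInv M g x = ((2 * Real.pi : ℝ) : ℂ)⁻¹ * ∑ k, g k * chr (res k * res x) := by
  simp only [fourierInv, exp_eq_chr]

lemma sum_chr_mul (b : ZMod (2 * M)) :
    ∑ k : Lattice M, chr (res k * b) = if b = 0 then ((2 * M : ℕ) : ℂ) else 0 := by
  have h1 := (resEquiv M).sum_comp (fun c => chr (c * b))
  simp only [resEquiv_apply] at h1
  rw [h1]
  have := AddChar.sum_mulShift (R' := ℂ) b (ZMod.isPrimitive_stdAddChar (2 * M))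
  rw [ZMod.card] at this
  exact_mod_cast this

lemma two_pi_eq : ((2 * Real.pi : ℝ) : ℂ) = (mesh M : ℂ) * ((2 * M : ℕ) : ℂ) := by
  have := mesh_mul M
  push_cast
  rw [← this]; push_cast; ring

lemma mesh_ne_zero : (mesh M : ℂ) ≠ 0 := by exact_mod_cast (mesh_pos M).ne'

lemma two_M_ne_zero : ((2 * M : ℕ) : ℂ) ≠ 0 := by exact_mod_cast NeZero.ne (2 * M)

lemma fourierInv_fourier (f : Lattice M → ℂ) : fourierInv M (fourier M f) = f := by
  classical
  funext x
  simp only [fourierInv_eq, fourier_eq]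
  simp only [mul_assoc, ← Finset.mul_sum, Finset.sum_mul]
  rw [Finset.sum_comm]
  have : ∀ y, ∑ k : Lattice M, f y * (chr (-(res k * res y)) * chr (res k * res x)) =
      if y = x then f x * ((2 * M : ℕ) : ℂ) else 0 := by
    intro y
    rw [← Finset.mul_sum]
    have h2 : ∀ k : Lattice M, chr (-(res k * res y)) * chr (res k * res x) =
        chr (res k * (res x - res y)) := by
      intro k; rw [← chr_add]; congr 1; ring
    simp only [h2, sum_chr_mul]
    by_cases h : y = x
    · simp [h]
    · have : res x - res y ≠ 0 := fun h' => h ((res_bijective M).1 (sub_eq_zero.1 h').symm)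
      simp [h, this]
  simp only [this]
  rw [Finset.sum_ite_eq' Finset.univ x]
  simp only [Finset.mem_univ, if_true]
  rw [two_pi_eq (M := M)]
  have h1 := mesh_ne_zero (M := M)
  have h2 := two_M_ne_zero (M := M)
  field_simp

lemma fourier_fourierInv (g : Lattice M → ℂ) : fourier M (fourierInv M g) = g := by
  classical
  funext k
  simp only [fourierInv_eq, fourier_eq]
  simp only [mul_assoc, ← Finset.mul_sum, Finset.sum_mul]
  rw [Finset.sum_comm]
  have : ∀ y, ∑ x : Lattice M, g y * (chr (res y * res x) * chr (-(res k * res x))) =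
      if y = k then g k * ((2 * M : ℕ) : ℂ) else 0 := by
    intro y
    rw [← Finset.mul_sum]
    have h2 : ∀ x : Lattice M, chr (res y * res x) * chr (-(res k * res x)) =
        chr (res x * (res y - res k)) := by
      intro x; rw [← chr_add]; congr 1; ring
    simp only [h2, sum_chr_mul]
    by_cases h : y = k
    · simp [h]
    · have : res y - res k ≠ 0 := fun h' => h ((res_bijective M).1 (sub_eq_zero.1 h'))
      simp [h, this]
  simp only [this]
  rw [Finset.sum_ite_eq' Finset.univ k]
  simp only [Finset.mem_univ, if_true]
  rw [two_pi_eq (M := M)]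
  have h1 := mesh_ne_zero (M := M)
  have h2 := two_M_ne_zero (M := M)
  field_simp

/-- The inner product of `L²_h`, complex linear in the first variable. -/
def ip (f g : Lattice M → ℂ) : ℂ := (mesh M : ℂ) * ∑ x, f x * (starRingEnd ℂ) (g x)

lemma ip_eq_fourier (f g : Lattice M → ℂ) :
    ip f g = ((2 * Real.pi : ℝ) : ℂ)⁻¹ *
      ∑ k, fourier M f k * (starRingEnd ℂ) (fourier M g k) := by
  have h1 : ∀ x, f x = ((2 * Real.pi : ℝ) : ℂ)⁻¹ * ∑ k, fourier M f k * chr (res k * res x) := by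
    intro x; rw [← fourierInv_eq, fourierInv_fourier]
  simp only [ip]
  conv_lhs => enter [2, 2, x]; rw [h1 x]
  simp only [mul_assoc, ← Finset.mul_sum, Finset.sum_mul]
  rw [mul_left_comm]
  congr 1
  rw [Finset.sum_comm, Finset.mul_sum]
  refine Finset.sum_congr rfl fun k _ => ?_
  rw [← Finset.mul_sum, mul_left_comm]
  congr 1
  rw [fourier_eq, map_mul, Complex.conj_ofReal, map_sum]
  congr 1
  refine Finset.sum_congr rfl fun x _ => ?_
  rw [map_mul, conj_chr, neg_neg, mul_comm]

lemma norm_sq_eq_fourier (f : Lattice M → ℂ) :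
    mesh M * ∑ x, ‖f x‖ ^ 2 = (2 * Real.pi)⁻¹ * ∑ k, ‖fourier M f k‖ ^ 2 := by
  have := ip_eq_fourier f f
  simp only [ip, Complex.mul_conj, Complex.normSq_eq_norm_sq] at this
  exact_mod_cast this

lemma lpNorm_two_sq (f : Lattice M → ℂ) : lpNorm 2 M f ^ 2 = mesh M * ∑ x, ‖f x‖ ^ 2 := by
  have h0 : 0 ≤ mesh M * ∑ x, ‖f x‖ ^ 2 :=
    mul_nonneg (mesh_pos M).le (Finset.sum_nonneg fun _ _ => by positivity)
  simp only [lpNorm, Real.rpow_two]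
  rw [← Real.sqrt_eq_rpow, Real.sq_sqrt h0]

lemma lpNorm_four_pow (f : Lattice M → ℂ) : lpNorm 4 M f ^ 4 = mesh M * ∑ x, ‖f x‖ ^ 4 := by
  have h0 : 0 ≤ mesh M * ∑ x, ‖f x‖ ^ 4 :=
    mul_nonneg (mesh_pos M).le (Finset.sum_nonneg fun _ _ => by positivity)
  have h1 : ∀ r : ℝ, r ^ (4 : ℝ) = r ^ 4 := fun r => by exact_mod_cast Real.rpow_natCast r 4
  simp only [lpNorm, h1]
  rw [← Real.rpow_natCast, ← Real.rpow_mul h0]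
  norm_num

lemma fourier_multiplier (m f : Lattice M → ℂ) (k : Lattice M) :
    fourier M (multiplier M m f) k = m k * fourier M f k := by
  rw [multiplier, fourier_fourierInv]

lemma fourier_injective : Function.Injective (fourier M) :=
  Function.LeftInverse.injective fourierInv_fourier

lemma fourier_add (f g : Lattice M → ℂ) : fourier M (f + g) = fourier M f + fourier M g := by
  funext k
  simp only [fourier, Pi.add_apply, add_mul, Finset.sum_add_distrib, mul_add]

lemma fourier_smul (c : ℂ) (f : Lattice M → ℂ) : fourier M (c • f) = c • fourier M f := by
  funext k
  simp only [fourier, Pi.smul_apply, smul_eq_mul, mul_assoc, ← Finset.mul_sum]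
  ring

/-- The discrete Fourier transform as a linear map. -/
def fourierL (M : ℕ) [NeZero M] : (Lattice M → ℂ) →ₗ[ℂ] (Lattice M → ℂ) where
  toFun := fourier M
  map_add' := fourier_add
  map_smul' := fourier_smul

/-- Fourier multipliers, linear in the symbol and in the function. -/
def multL (M : ℕ) [NeZero M] :
    (Lattice M → ℂ) →L[ℂ] (Lattice M → ℂ) →L[ℂ] (Lattice M → ℂ) :=
  LinearMap.toContinuousLinearMap
    { toFun := fun m => LinearMap.toContinuousLinearMap
        { toFun := multiplier M m
          map_add' := fun f g => fourier_injective (by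
            funext k
            simp only [fourier_add, fourier_multiplier, Pi.add_apply, mul_add])
          map_smul' := fun c f => fourier_injective (by
            funext k
            simp only [fourier_smul, fourier_multiplier, Pi.smul_apply, smul_eq_mul,
              RingHom.id_apply]
            ring) }
      map_add' := fun m n => by
        ext1 f
        refine fourier_injective ?_
        funext k
        simp only [LinearMap.coe_toContinuousLinearMap', LinearMap.coe_mk, AddHom.coe_mk,
          add_apply, fourier_add, fourier_multiplier, Pi.add_apply, add_mul]
      map_smul' := fun c m => by
        ext1 f
        refine fourier_injective ?_
        funext k
        simp only [LinearMap.coe_toContinuousLinearMap', LinearMap.coe_mk, AddHom.coe_mk,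
          smul_apply, fourier_smul, fourier_multiplier, Pi.smul_apply,
          smul_eq_mul, RingHom.id_apply]
        ring }

lemma fourier_multL (m f : Lattice M → ℂ) (k : Lattice M) :
    fourier M (multL M m f) k = m k * fourier M f k := fourier_multiplier m f k

/-- The symbol of the propagator. -/
def propSymbol (α : ℝ) (M : ℕ) (t : ℝ) (k : Lattice M) : ℂ :=
  Complex.exp (-(Complex.I * (t * symbol α M k : ℝ)))

lemma norm_propSymbol (α t : ℝ) (k : Lattice M) : ‖propSymbol α M t k‖ = 1 := by
  rw [propSymbol, ← mul_neg, mul_comm, ← Complex.ofReal_neg, Complex.norm_exp_ofReal_mul_I]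

/-- The propagator as a continuous linear map. -/
def prop (α : ℝ) (M : ℕ) [NeZero M] (t : ℝ) : (Lattice M → ℂ) →L[ℂ] (Lattice M → ℂ) :=
  multL M (propSymbol α M t)

lemma prop_apply (α t : ℝ) (f : Lattice M → ℂ) : prop α M t f = propagator α M t f := rfl

lemma fourier_prop (α t : ℝ) (f : Lattice M → ℂ) (k : Lattice M) :
    fourier M (prop α M t f) k = propSymbol α M t k * fourier M f k := fourier_multL _ _ k

lemma prop_add (α s t : ℝ) (f : Lattice M → ℂ) :
    prop α M (s + t) f = prop α M s (prop α M t f) := by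
  refine fourier_injective ?_
  funext k
  rw [fourier_prop, fourier_prop, fourier_prop, ← mul_assoc]
  congr 1
  rw [propSymbol, propSymbol, propSymbol, ← Complex.exp_add]
  congr 1
  push_cast; ring

lemma prop_zero (α : ℝ) (f : Lattice M → ℂ) : prop α M 0 f = f := by
  refine fourier_injective ?_
  funext k
  simp [fourier_prop, propSymbol]

lemma prop_prop_neg (α t : ℝ) (f : Lattice M → ℂ) : prop α M t (prop α M (-t) f) = f := by
  rw [← prop_add, add_neg_cancel, prop_zero]

/-- The generator `(-Δ_h)^{α/2}`. -/
def gen (α : ℝ) (M : ℕ) [NeZero M] : (Lattice M → ℂ) →L[ℂ] (Lattice M → ℂ) :=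
  multL M (fun k => (symbol α M k : ℂ))

lemma fourier_gen (α : ℝ) (f : Lattice M → ℂ) (k : Lattice M) :
    fourier M (gen α M f) k = (symbol α M k : ℂ) * fourier M f k := fourier_multL _ _ k

/-- `multL` is linear in the symbol, so only the scalar exponentials have to be differentiated. -/
lemma hasDerivAt_prop (α t : ℝ) :
    HasDerivAt (fun t => prop α M t) (-Complex.I • (prop α M t ∘L gen α M)) t := by
  have h : HasDerivAt (fun t : ℝ => propSymbol α M t)
      (fun k => propSymbol α M t k * (-(Complex.I * (symbol α M k : ℂ)))) t := by
    rw [hasDerivAt_pi]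
    intro k
    have h1 : HasDerivAt (fun t : ℝ => -(Complex.I * ((t * symbol α M k : ℝ) : ℂ)))
        (-(Complex.I * ((1 * symbol α M k : ℝ) : ℂ))) t :=
      (((hasDerivAt_id t).mul_const _).ofReal_comp.const_mul _).neg
    simpa [propSymbol] using h1.cexp
  have h2 := ((multL M).restrictScalars ℝ).hasFDerivAt.comp_hasDerivAt t h
  have h3 : -Complex.I • (prop α M t ∘L gen α M) =
      multL M (fun k => propSymbol α M t k * (-(Complex.I * (symbol α M k : ℂ)))) := by
    ext1 f
    refine fourier_injective ?_
    funext k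
    rw [fourier_multL]
    simp only [smul_apply, ContinuousLinearMap.comp_apply, fourier_smul,
      Pi.smul_apply, fourier_prop, fourier_gen, smul_eq_mul]
    ring
  rw [h3]
  exact h2

lemma continuous_prop (α : ℝ) : Continuous (fun t => prop α M t) :=
  continuous_iff_continuousAt.2 fun t => (hasDerivAt_prop α t).continuousAt

lemma gen_prop (α t : ℝ) (f : Lattice M → ℂ) :
    gen α M (prop α M t f) = prop α M t (gen α M f) := by
  refine fourier_injective ?_
  funext k
  rw [fourier_gen, fourier_prop, fourier_prop, fourier_gen]
  ring

lemma sobolevNorm_prop (s α t : ℝ) (f : Lattice M → ℂ) :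
    sobolevNorm s M (prop α M t f) = sobolevNorm s M f := by
  simp only [sobolevNorm, fourier_prop, norm_mul, norm_propSymbol, one_mul]

/-- From here on the L^∞_h norm is the norm that the finite product `Lattice M → ℂ` carries anyway.
-/
lemma linftyNorm_eq (f : Lattice M → ℂ) : linftyNorm M f = ‖f‖ := by
  refine le_antisymm (ciSup_le fun x => norm_le_pi_norm f x) ?_
  refine (pi_norm_le_iff_of_nonempty f).2 fun x => ?_
  exact le_ciSup (f := fun x => ‖f x‖) (Set.finite_range _).bddAbove x

end FDNLS
end

/-! ### The equation on a fixed lattice: conservation laws and global solutions -/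

noncomputable section
set_option linter.unusedSectionVars false
namespace FDNLS
open Set MeasureTheory

variable {M : ℕ} [NeZero M]

/-- The vector field of the fractional discrete nonlinear Schrödinger equation. -/
def field (α μ : ℝ) (M : ℕ) [NeZero M] (u : Lattice M → ℂ) : Lattice M → ℂ :=
  -Complex.I • (gen α M u + (μ : ℂ) • cubic M u)

lemma contDiff_cubic : ContDiff ℝ 1 (cubic M) := by
  rw [contDiff_pi]
  intro x
  have h : ContDiff ℝ 1 (fun f : Lattice M → ℂ => f x) := contDiff_apply ℝ ℂ x
  simp only [cubic]
  exact (Complex.ofRealCLM.contDiff.comp (h.norm_sq ℝ)).mul h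

lemma continuous_cubic : Continuous (cubic M) := contDiff_cubic.continuous

lemma contDiff_field (α μ : ℝ) : ContDiff ℝ 1 (field α μ M) := by
  refine ContDiff.const_smul _ (ContDiff.add ?_ (contDiff_cubic.const_smul _))
  exact ((gen α M).restrictScalars ℝ).contDiff

lemma ip_self (f : Lattice M → ℂ) : ip f f = ((mesh M * ∑ x, ‖f x‖ ^ 2 : ℝ) : ℂ) := by
  simp only [ip, Complex.mul_conj, Complex.normSq_eq_norm_sq]
  push_cast; rfl

lemma mass_eq (f : Lattice M → ℂ) : mass M f = mesh M * ∑ x, ‖f x‖ ^ 2 := lpNorm_two_sq f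

lemma symbol_half_sq (α : ℝ) (k : Lattice M) :
    symbol (α / 2) M k ^ 2 = symbol α M k := by
  rw [symbol, symbol, ← Real.rpow_natCast, ← Real.rpow_mul (abs_nonneg _)]
  congr 1
  push_cast; ring

/-- With the kinetic part on the Fourier side and the quartic part as a square of |f|², the energy
is a polynomial in squared norms and can be differentiated term by term. -/
lemma energy_eq (α μ : ℝ) (f : Lattice M → ℂ) :
    energy α μ M f = 1 / 2 * ((2 * Real.pi)⁻¹ * ∑ k, symbol α M k * ‖fourier M f k‖ ^ 2)
      + μ / 4 * (mesh M * ∑ x, (‖f x‖ ^ 2) ^ 2) := by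
  have h4 : ∀ x, (‖f x‖ ^ 2) ^ 2 = ‖f x‖ ^ 4 := fun x => by ring
  rw [energy, lpNorm_two_sq, norm_sq_eq_fourier, lpNorm_four_pow]
  simp only [absGrad, fourier_multiplier, norm_mul, mul_pow, h4, Complex.norm_real, Real.norm_eq_abs,
    sq_abs, symbol_half_sq]

/-- The symbol is real, so the generator is symmetric. -/
lemma re_ip_gen_self_mul_I (α : ℝ) (f : Lattice M → ℂ) : (ip (gen α M f) f).im = 0 := by
  rw [ip_eq_fourier]
  have : ∀ k, fourier M (gen α M f) k * (starRingEnd ℂ) (fourier M f k) =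
      ((symbol α M k * ‖fourier M f k‖ ^ 2 : ℝ) : ℂ) := by
    intro k
    rw [fourier_gen, mul_assoc, Complex.mul_conj, Complex.normSq_eq_norm_sq]
    push_cast; rfl
  simp only [this]
  rw [← Complex.ofReal_inv, ← Complex.ofReal_sum, ← Complex.ofReal_mul, Complex.ofReal_im]

lemma ip_add_left (f g k : Lattice M → ℂ) : ip (f + g) k = ip f k + ip g k := by
  simp only [ip, Pi.add_apply, add_mul, Finset.sum_add_distrib, mul_add]

lemma ip_smul_left (c : ℂ) (f g : Lattice M → ℂ) : ip (c • f) g = c * ip f g := by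
  simp only [ip, Pi.smul_apply, smul_eq_mul, mul_assoc, ← Finset.mul_sum]
  ring

lemma ip_smul_right (c : ℂ) (f g : Lattice M → ℂ) :
    ip f (c • g) = (starRingEnd ℂ) c * ip f g := by
  simp only [ip, Pi.smul_apply, smul_eq_mul, map_mul, mul_left_comm _ ((starRingEnd ℂ) c),
    ← Finset.mul_sum]

lemma ip_cubic_self (f : Lattice M → ℂ) :
    ip (cubic M f) f = ((mesh M * ∑ x, ‖f x‖ ^ 4 : ℝ) : ℂ) := by
  simp only [ip, cubic, mul_assoc, Complex.mul_conj, Complex.normSq_eq_norm_sq]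
  push_cast
  congr 1
  exact Finset.sum_congr rfl fun x _ => by ring

/-- The field is -i times a vector whose pairing with f is real; this is mass conservation. -/
lemma re_ip_field_self (α μ : ℝ) (f : Lattice M → ℂ) : (ip (field α μ M f) f).re = 0 := by
  rw [field, ip_smul_left, ip_add_left, ip_smul_left, ip_cubic_self]
  have := re_ip_gen_self_mul_I α f
  generalize mesh M * ∑ x, ‖f x‖ ^ 4 = r
  simp [this]

variable {α μ : ℝ} {u : ℝ → Lattice M → ℂ} {t c : ℝ}

lemma hasDerivWithinAt_mass {s : Set ℝ} {u' : Lattice M → ℂ}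
    (hu : HasDerivWithinAt u u' s t) :
    HasDerivWithinAt (fun t => mass M (u t)) (2 * (ip u' (u t)).re) s t := by
  simp only [mass_eq]
  have h : ∀ x, HasDerivWithinAt (fun t => ‖u t x‖ ^ 2) (2 * inner ℝ (u t x) (u' x)) s t :=
    fun x => ((hasDerivWithinAt_pi.1 hu) x).norm_sq
  have h2 := (HasDerivWithinAt.fun_sum (u := Finset.univ) fun x _ => h x).const_mul (mesh M)
  refine h2.congr_deriv ?_
  simp only [ip, Complex.re_ofReal_mul, Complex.re_sum, Complex.inner, ← Finset.mul_sum]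
  ring

lemma hasDerivWithinAt_energy {s : Set ℝ} {u' : Lattice M → ℂ}
    (hu : HasDerivWithinAt u u' s t) :
    HasDerivWithinAt (fun t => energy α μ M (u t))
      (ip (gen α M (u t) + (μ : ℂ) • cubic M (u t)) u').re s t := by
  simp only [energy_eq]
  have h : ∀ x, HasDerivWithinAt (fun t => ‖u t x‖ ^ 2) (2 * inner ℝ (u t x) (u' x)) s t :=
    fun x => ((hasDerivWithinAt_pi.1 hu) x).norm_sq
  have hF : HasDerivWithinAt (fun t => fourier M (u t)) (fourier M u') s t :=
    ((LinearMap.toContinuousLinearMap (fourierL M)).restrictScalars ℝ).hasFDerivAt.comp_hasDerivWithinAt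
      t hu
  have hk : ∀ k, HasDerivWithinAt (fun t => ‖fourier M (u t) k‖ ^ 2)
      (2 * inner ℝ (fourier M (u t) k) (fourier M u' k)) s t :=
    fun k => ((hasDerivWithinAt_pi.1 hF) k).norm_sq
  have h2 := (HasDerivWithinAt.fun_sum (u := Finset.univ)
    fun x _ => (h x).fun_pow 2).const_mul (mesh M) |>.const_mul (μ / 4)
  have h3 := (HasDerivWithinAt.fun_sum (u := Finset.univ)
    fun k _ => (hk k).const_mul (symbol α M k)).const_mul ((2 * Real.pi)⁻¹) |>.const_mul (1 / 2)
  refine (h3.fun_add h2).congr_deriv ?_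
  symm
  have e1 : ∀ z w : ℂ, (z * (starRingEnd ℂ) w).re = inner ℝ z w := by
    intro z w; simp [Complex.inner]; ring
  have e2 : ∀ (r : ℝ) (z w : ℂ), ((r : ℂ) * z * (starRingEnd ℂ) w).re = r * inner ℝ z w := by
    intro r z w; rw [mul_assoc, Complex.re_ofReal_mul, e1]
  rw [ip_add_left, ip_eq_fourier, ip_smul_left, Complex.add_re, Complex.re_ofReal_mul,
    ← Complex.ofReal_inv, Complex.re_ofReal_mul, ip, Complex.re_ofReal_mul, Complex.re_sum,
    Complex.re_sum]
  simp only [fourier_gen, cubic, e2]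
  congr 1
  · simp only [Finset.mul_sum]
    exact Finset.sum_congr rfl fun k _ => by ring
  · simp only [Finset.mul_sum]
    exact Finset.sum_congr rfl fun k _ => by push_cast; ring

/-- The field is -i times the gradient w of the energy, and Re⟨w, -iw⟩ = 0; this is energy
conservation. -/
lemma re_ip_field_energy (α μ : ℝ) (f : Lattice M → ℂ) :
    (ip (gen α M f + (μ : ℂ) • cubic M f) (field α μ M f)).re = 0 := by
  rw [field, ip_smul_right, ip_self]
  generalize mesh M * ∑ x : Lattice M, _ = r
  simp

/-- The real factor c(t) only reparametrises time, so both laws survive it. It is there because the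
solution is first built for a truncated field, which is such a multiple of the true one. -/
lemma conserved {T : ℝ} {c : ℝ → ℝ} (hu : ContinuousOn u (Icc 0 T))
    (hu' : ∀ t ∈ Ico 0 T, HasDerivWithinAt u (c t • field α μ M (u t)) (Ici t) t) :
    (∀ t ∈ Icc 0 T, mass M (u t) = mass M (u 0)) ∧
    ∀ t ∈ Icc 0 T, energy α μ M (u t) = energy α μ M (u 0) := by
  have hx : ∀ x, ContinuousOn (fun t => u t x) (Icc 0 T) := fun x =>
    (continuous_apply x).comp_continuousOn hu
  have hF : ∀ k, ContinuousOn (fun t => fourier M (u t) k) (Icc 0 T) := fun k =>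
    (continuous_apply k).comp_continuousOn
      ((LinearMap.toContinuousLinearMap (fourierL M)).continuous.comp_continuousOn hu)
  have hc : ∀ (t : ℝ) (v : Lattice M → ℂ), c t • v = (c t : ℂ) • v := fun t v => by
    funext x; simp
  constructor
  · refine constant_of_has_deriv_right_zero ?_ fun t ht => ?_
    · simp only [mass_eq]
      fun_prop
    · refine (hasDerivWithinAt_mass (hu' t ht)).congr_deriv ?_
      rw [hc, ip_smul_left, Complex.re_ofReal_mul, re_ip_field_self]
      ring
  · refine constant_of_has_deriv_right_zero ?_ fun t ht => ?_
    · simp only [energy_eq]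
      fun_prop
    · refine (hasDerivWithinAt_energy (hu' t ht)).congr_deriv ?_
      rw [hc, ip_smul_right, Complex.conj_ofReal, Complex.re_ofReal_mul, re_ip_field_energy]
      ring

/-- The constant degenerates as h → 0. This bound serves only on a fixed lattice, to exclude blow-up
and to compare topologies. -/
lemma norm_sq_le_mass (f : Lattice M → ℂ) (x : Lattice M) :
    ‖f x‖ ^ 2 ≤ (mesh M)⁻¹ * mass M f := by
  rw [mass_eq, ← mul_assoc, inv_mul_cancel₀ (mesh_pos M).ne', one_mul]
  exact Finset.single_le_sum (f := fun x => ‖f x‖ ^ 2) (fun i _ => by positivity) (Finset.mem_univ x)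

lemma norm_le_mass (f : Lattice M → ℂ) : ‖f‖ ≤ Real.sqrt ((mesh M)⁻¹ * mass M f) :=
  (pi_norm_le_iff_of_nonempty f).2 fun x => Real.le_sqrt_of_sq_le (norm_sq_le_mass f x)

/-- A globally Lipschitz and bounded truncation of the vector field. -/
lemma exists_truncation (α μ : ℝ) (R : ℝ) (hR : 0 < R) :
    ∃ χ : (Lattice M → ℂ) → ℝ, (∀ f, ‖f‖ ≤ R → χ f = 1) ∧
      (∃ K, LipschitzWith K (fun f => χ f • field α μ M f)) ∧
      ∃ L, ∀ f, ‖χ f • field α μ M f‖ ≤ L := by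
  let b : ContDiffBump (0 : Lattice M → ℂ) := ⟨R, R + 1, hR, by linarith⟩
  have hcd : ContDiff ℝ 1 (fun f => b f • field α μ M f) := b.contDiff.smul (contDiff_field α μ)
  have hcs : HasCompactSupport (fun f => b f • field α μ M f) := b.hasCompactSupport.smul_right
  refine ⟨b, fun f hf => b.one_of_mem_closedBall (by simpa using hf), ?_, ?_⟩
  · exact ContDiff.lipschitzWith_of_hasCompactSupport hcs hcd (by norm_num)
  · exact hcs.exists_bound_of_continuous hcd.continuous

/-- A field bounded by L moves a curve by at most LT in time T, so a single Picard–Lindelöf step on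
a ball of that radius covers [0,T]. The curve is continued by constants to all of ℝ, which makes
every later integrand continuous on the line. -/
lemma exists_global_ode {F : (Lattice M → ℂ) → Lattice M → ℂ} {K : NNReal} {L : ℝ}
    (hK : LipschitzWith K F) (hL : ∀ f, ‖F f‖ ≤ L) (u₀ : Lattice M → ℂ) (T : ℝ) (hT : 0 < T) :
    ∃ u : ℝ → Lattice M → ℂ, Continuous u ∧ u 0 = u₀ ∧
      ∀ t ∈ Icc 0 T, HasDerivWithinAt u (F (u t)) (Icc 0 T) t := by
  have hL0 : 0 ≤ L := (norm_nonneg _).trans (hL 0)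
  have hP : IsPicardLindelof (fun _ => F) (tmin := 0) (tmax := T) ⟨0, left_mem_Icc.2 hT.le⟩ u₀
      (L.toNNReal * T.toNNReal) 0 L.toNNReal K :=
    { lipschitzOnWith := fun t _ => hK.lipschitzOnWith
      continuousOn := fun x _ => continuousOn_const
      norm_le := fun t _ x _ => by rw [Real.coe_toNNReal _ hL0]; exact hL x
      mul_max_le := by simp [Real.coe_toNNReal _ hL0, Real.coe_toNNReal _ hT.le, hT.le] }
  obtain ⟨u, hu0, hu⟩ := hP.exists_eq_forall_mem_Icc_hasDerivWithinAt₀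
  have hc : ContinuousOn u (Icc 0 T) := fun t ht => (hu t ht).continuousWithinAt
  refine ⟨IccExtend hT.le (fun t : Icc (0 : ℝ) T => u t), ?_, ?_, fun t ht => ?_⟩
  · exact Continuous.Icc_extend' (continuousOn_iff_continuous_domRestrict.1 hc)
  · rw [IccExtend_of_mem _ _ (left_mem_Icc.2 hT.le)]; exact hu0
  · rw [IccExtend_of_mem _ _ ht]
    exact (hu t ht).congr (fun y hy => by rw [IccExtend_of_mem _ _ hy])
      (by rw [IccExtend_of_mem _ _ ht])

/-- The Duhamel formula as an identity of vectors. -/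
def Duhamel (α μ : ℝ) (T : ℝ) (u₀ : Lattice M → ℂ) (u : ℝ → Lattice M → ℂ) : Prop :=
  ∀ t ∈ Icc 0 T, u t = prop α M t
    (u₀ - (Complex.I * (μ : ℂ)) • ∫ τ in (0 : ℝ)..t, prop α M (-τ) (cubic M (u τ)))

lemma continuous_prop_apply {v : ℝ → Lattice M → ℂ} {φ : ℝ → ℝ} (hφ : Continuous φ)
    (hv : Continuous v) : Continuous (fun τ => prop α M (φ τ) (v τ)) :=
  ((continuous_prop α).comp hφ).clm_apply hv

lemma prop_integral {v : ℝ → Lattice M → ℂ} (hv : Continuous v) (s : ℝ) :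
    prop α M s (∫ τ in (0 : ℝ)..t, prop α M (-τ) (v τ)) =
      ∫ τ in (0 : ℝ)..t, prop α M (s - τ) (v τ) := by
  rw [← ContinuousLinearMap.intervalIntegral_comp_comm _
    ((continuous_prop_apply continuous_neg hv).intervalIntegrable _ _)]
  refine intervalIntegral.integral_congr fun τ _ => ?_
  rw [← prop_add, sub_eq_add_neg]

/-- By the group law U(t-τ) = U(t)U(-τ), the factor U(t) comes out of the integral; evaluation at a
point commutes with the integral. -/
lemma duhamel_iff {T : ℝ} {u₀ : Lattice M → ℂ} (hu : Continuous u) :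
    Duhamel α μ T u₀ u ↔ ∀ t ∈ Icc 0 T, ∀ x : Lattice M,
    u t x = propagator α M t u₀ x
      - Complex.I * (μ : ℂ) * ∫ τ in (0 : ℝ)..t, propagator α M (t - τ) (cubic M (u τ)) x := by
  have key : ∀ t x, (prop α M t
      (u₀ - (Complex.I * (μ : ℂ)) • ∫ τ in (0 : ℝ)..t, prop α M (-τ) (cubic M (u τ)))) x =
      propagator α M t u₀ x
      - Complex.I * (μ : ℂ) * ∫ τ in (0 : ℝ)..t, propagator α M (t - τ) (cubic M (u τ)) x := by
    intro t x
    have hc : Continuous fun τ => cubic M (u τ) := continuous_cubic.comp hu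
    rw [map_sub, map_smul, prop_integral hc, Pi.sub_apply, Pi.smul_apply, smul_eq_mul]
    congr 2
    exact (ContinuousLinearMap.intervalIntegral_comp_comm
      (ContinuousLinearMap.proj (R := ℂ) (φ := fun _ : Lattice M => ℂ) x)
      ((continuous_prop_apply (by fun_prop : Continuous fun τ => t - τ) hc).intervalIntegrable
        _ _)).symm
  constructor
  · intro h t ht x; rw [h t ht, key]
  · intro h t ht; funext x; rw [h t ht, key]

/-- There are finitely many lattice points, so membership in X_T is the same as continuity on [0,T];
this is one direction and `continuousOn_of_memX` the other. -/
lemma memX_of_continuousOn {T : ℝ} (hu : ContinuousOn u (Icc 0 T)) : MemX M T u := by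
  constructor
  · intro t₀ ht₀
    have h1 : ContinuousWithinAt (fun t => lpNorm 2 M (u t - u t₀)) (Icc 0 T) t₀ := by
      have hx : ∀ x, ContinuousWithinAt (fun t => u t x) (Icc 0 T) t₀ := fun x =>
        (continuous_apply x).continuousAt.comp_continuousWithinAt (hu t₀ ht₀)
      simp only [lpNorm, Pi.sub_apply, Real.rpow_two]
      refine ContinuousWithinAt.rpow_const ?_ (Or.inr (by norm_num))
      refine continuousWithinAt_const.mul (tendsto_finsetSum _ fun x _ => ?_)
      exact (((hx x).sub continuousWithinAt_const).norm.pow 2)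
    have h2 := h1.tendsto
    have h0 : lpNorm 2 M (u t₀ - u t₀) = 0 := by
      simp [lpNorm]
    rwa [h0] at h2
  · have hn : ContinuousOn (fun t => linftyNorm M (u t)) (Icc 0 T) := by
      simp only [linftyNorm_eq]; exact hu.norm
    obtain ⟨C, hC⟩ := isCompact_Icc.exists_bound_of_continuousOn hn
    refine MemLp.of_bound (hn.aestronglyMeasurable measurableSet_Icc) C ?_
    exact (ae_restrict_iff' measurableSet_Icc).2 (Filter.Eventually.of_forall hC)

lemma continuousOn_of_memX {T : ℝ} (hu : MemX M T u) : ContinuousOn u (Icc 0 T) := by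
  intro t₀ ht₀
  have h1 := hu.1 t₀ ht₀
  rw [ContinuousWithinAt, tendsto_iff_norm_sub_tendsto_zero]
  have h2 : Filter.Tendsto (fun t => Real.sqrt ((mesh M)⁻¹ * (lpNorm 2 M (u t - u t₀)) ^ 2))
      (nhdsWithin t₀ (Icc 0 T)) (nhds 0) := by
    have := ((h1.pow 2).const_mul ((mesh M)⁻¹)).sqrt
    simpa using this
  exact squeeze_zero (fun _ => norm_nonneg _) (fun t => norm_le_mass _) h2

/-- The extension of a curve on `[0,T]` to the line by its boundary values. -/
def extend (T : ℝ) (hT : 0 ≤ T) (u : ℝ → Lattice M → ℂ) : ℝ → Lattice M → ℂ :=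
  IccExtend hT (fun t : Icc (0 : ℝ) T => u t)

lemma extend_apply {T : ℝ} (hT : 0 ≤ T) {t : ℝ} (ht : t ∈ Icc 0 T) : extend T hT u t = u t := by
  rw [extend, IccExtend_of_mem _ _ ht]

lemma continuous_extend {T : ℝ} (hT : 0 ≤ T) (hu : ContinuousOn u (Icc 0 T)) :
    Continuous (extend T hT u) :=
  Continuous.Icc_extend' (continuousOn_iff_continuous_domRestrict.1 hu)

lemma IsSolution.duhamel {T : ℝ} (hT : 0 ≤ T) {u₀ : Lattice M → ℂ}
    (h : IsSolution α μ M T u₀ u) :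
    Continuous (extend T hT u) ∧ Duhamel α μ T u₀ (extend T hT u) := by
  have hc := continuous_extend hT (continuousOn_of_memX h.1)
  refine ⟨hc, (duhamel_iff hc).2 fun t ht x => ?_⟩
  rw [extend_apply hT ht, h.2 t ht x]
  congr 2
  refine intervalIntegral.integral_congr fun τ hτ => ?_
  rw [uIcc_of_le ht.1] at hτ
  rw [extend_apply hT ⟨hτ.1, hτ.2.trans ht.2⟩]

lemma Duhamel.isSolution {T : ℝ} {u₀ : Lattice M → ℂ} (hu : Continuous u)
    (h : Duhamel α μ T u₀ u) : IsSolution α μ M T u₀ u :=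
  ⟨memX_of_continuousOn hu.continuousOn, (duhamel_iff hu).1 h⟩

lemma Duhamel.hasDerivWithinAt {T : ℝ} {u₀ : Lattice M → ℂ} (hu : Continuous u)
    (h : Duhamel α μ T u₀ u) {t : ℝ} (ht : t ∈ Icc 0 T) :
    HasDerivWithinAt u (field α μ M (u t)) (Icc 0 T) t := by
  have hc : Continuous fun τ => prop α M (-τ) (cubic M (u τ)) :=
    continuous_prop_apply continuous_neg (continuous_cubic.comp hu)
  have hW : HasDerivAt (fun t => u₀ - (Complex.I * (μ : ℂ)) •
      ∫ τ in (0 : ℝ)..t, prop α M (-τ) (cubic M (u τ)))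
      (-((Complex.I * (μ : ℂ)) • prop α M (-t) (cubic M (u t)))) t :=
    ((hc.integral_hasStrictDerivAt 0 t).hasDerivAt.const_smul (Complex.I * (μ : ℂ))).const_sub u₀
  have hP : HasDerivAt (fun t => (prop α M t).restrictScalars ℝ)
      ((-Complex.I • (prop α M t ∘L gen α M)).restrictScalars ℝ) t :=
    (ContinuousLinearMap.restrictScalarsL ℂ (Lattice M → ℂ) (Lattice M → ℂ) ℝ ℝ).hasFDerivAt.comp_hasDerivAt
      t (hasDerivAt_prop α t)
  have hV := hP.clm_apply hW
  refine (hV.hasDerivWithinAt (s := Icc 0 T)).congr_of_eventuallyEq ?_ ?_ |>.congr_deriv ?_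
  · filter_upwards [self_mem_nhdsWithin] with y hy
    exact h y hy
  · exact h t ht
  · simp only [ContinuousLinearMap.coe_restrictScalars', smul_apply,
      ContinuousLinearMap.comp_apply, map_neg, map_smul, prop_prop_neg]
    rw [← gen_prop, ← h t ht, field, smul_add, smul_smul]
    simp only [neg_smul, neg_mul]

/-- In the interaction picture U(-τ)u(τ) the linear term cancels, and the fundamental theorem of
calculus integrates what is left. -/
lemma duhamel_of_hasDerivWithinAt {T : ℝ} (hu : Continuous u)
    (h : ∀ t ∈ Icc 0 T, HasDerivWithinAt u (field α μ M (u t)) (Icc 0 T) t) :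
    Duhamel α μ T (u 0) u := by
  intro t ht
  have hc : Continuous fun τ => prop α M (-τ) (cubic M (u τ)) :=
    continuous_prop_apply continuous_neg (continuous_cubic.comp hu)
  have key : ∀ τ ∈ Ioo 0 t, HasDerivWithinAt (fun τ => prop α M (-τ) (u τ))
      (-(Complex.I * (μ : ℂ)) • prop α M (-τ) (cubic M (u τ))) (Ioi τ) τ := by
    intro τ hτ
    have h1 : HasDerivAt u (field α μ M (u τ)) τ :=
      (h τ ⟨hτ.1.le, hτ.2.le.trans ht.2⟩).hasDerivAt (Icc_mem_nhds hτ.1 (hτ.2.trans_le ht.2))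
    have h0 := ((hasDerivAt_prop (M := M) α (-τ)).scomp τ (hasDerivAt_neg τ))
    have hP : HasDerivAt (fun t => (prop α M (-t)).restrictScalars ℝ)
        (((-1 : ℝ) • (-Complex.I • (prop α M (-τ) ∘L gen α M))).restrictScalars ℝ) τ :=
      (ContinuousLinearMap.restrictScalarsL ℂ (Lattice M → ℂ) (Lattice M → ℂ)
        ℝ ℝ).hasFDerivAt.comp_hasDerivAt τ h0
    refine ((hP.clm_apply h1).congr_deriv ?_).hasDerivWithinAt
    simp only [ContinuousLinearMap.coe_restrictScalars', smul_apply,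
      ContinuousLinearMap.comp_apply, field, map_smul, map_add, smul_smul, neg_smul,
      one_smul, neg_neg, neg_mul, smul_add, map_neg]
    module
  have h2 := intervalIntegral.integral_eq_sub_of_hasDeriv_right_of_le ht.1
    (continuous_prop_apply continuous_neg hu).continuousOn key
    ((hc.const_smul (-(Complex.I * (μ : ℂ)))).intervalIntegrable 0 t)
  rw [intervalIntegral.integral_smul, neg_zero, prop_zero] at h2
  rw [sub_eq_add_neg, ← neg_smul, h2, add_sub_cancel, prop_prop_neg]

lemma hasDerivWithinAt_Ici {T : ℝ} {u' : Lattice M → ℂ} (ht : t ∈ Ico 0 T)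
    (h : HasDerivWithinAt u u' (Icc 0 T) t) : HasDerivWithinAt u u' (Ici t) t :=
  h.mono_of_mem_nhdsWithin (Icc_mem_nhdsGE_of_mem ht)

/-- The Duhamel formula determines the curve on `[0,T]`. -/
lemma Duhamel.unique {T : ℝ} (hT : 0 ≤ T) {u₀ : Lattice M → ℂ} {v : ℝ → Lattice M → ℂ}
    (hu : Continuous u) (hv : Continuous v)
    (hu' : Duhamel α μ T u₀ u) (hv' : Duhamel α μ T u₀ v) : EqOn u v (Icc 0 T) := by
  obtain ⟨R₁, h1⟩ := isCompact_Icc.exists_bound_of_continuousOn (hu.continuousOn (s := Icc 0 T))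
  obtain ⟨R₂, h2⟩ := isCompact_Icc.exists_bound_of_continuousOn (hv.continuousOn (s := Icc 0 T))
  -- Both curves stay in a ball on which the truncated field agrees with the true one, so the
  -- uniqueness theorem for globally Lipschitz fields applies. The 1 only makes the radius positive.
  obtain ⟨χ, hχ, ⟨K, hK⟩, -⟩ := exists_truncation (M := M) α μ (max (max R₁ R₂) 1) (by positivity)
  have h0 : (0 : ℝ) ∈ Icc 0 T := left_mem_Icc.2 hT
  refine ODE_solution_unique (v := fun _ f => χ f • field α μ M f) (fun _ => hK)
    hu.continuousOn (fun t ht => ?_) hv.continuousOn (fun t ht => ?_) ?_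
  · have := h1 t (Ico_subset_Icc_self ht)
    rw [hχ (u t) (this.trans (by simp)), one_smul]
    exact hasDerivWithinAt_Ici ht (hu'.hasDerivWithinAt hu (Ico_subset_Icc_self ht))
  · have := h2 t (Ico_subset_Icc_self ht)
    rw [hχ (v t) (this.trans (by simp)), one_smul]
    exact hasDerivWithinAt_Ici ht (hv'.hasDerivWithinAt hv (Ico_subset_Icc_self ht))
  · rw [hu' 0 h0, hv' 0 h0]; simp

/-- Global existence, uniqueness and conservation laws on a fixed lattice. -/
theorem exists_solution (α μ : ℝ) (u₀ : Lattice M → ℂ) (T : ℝ) (hT : 0 < T) :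
    ∃ u : ℝ → Lattice M → ℂ, IsSolution α μ M T u₀ u ∧
      (∀ v : ℝ → Lattice M → ℂ, IsSolution α μ M T u₀ v → EqOn v u (Icc 0 T)) ∧
      (∀ t ∈ Icc 0 T, mass M (u t) = mass M u₀) ∧
      (∀ t ∈ Icc 0 T, energy α μ M (u t) = energy α μ M u₀) := by
  -- The truncated flow also conserves mass, so it never leaves the ball of this radius, where the
  -- truncation is inactive; hence it solves the original equation.
  obtain ⟨χ, hχ, ⟨K, hK⟩, L, hL⟩ := exists_truncation (M := M) α μ
    (Real.sqrt ((mesh M)⁻¹ * mass M u₀) + 1) (by positivity)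
  obtain ⟨u, hu, rfl, hu'⟩ := exists_global_ode hK hL u₀ T hT
  have hcons := conserved (c := fun t => χ (u t)) (α := α) (μ := μ) hu.continuousOn
    (fun t ht => hasDerivWithinAt_Ici ht (hu' t (Ico_subset_Icc_self ht)))
  have hD : Duhamel α μ T (u 0) u := by
    refine duhamel_of_hasDerivWithinAt hu fun t ht => ?_
    have := hu' t ht
    rwa [hχ, one_smul] at this
    refine (norm_le_mass _).trans ?_
    rw [hcons.1 t ht]
    linarith
  refine ⟨u, hD.isSolution hu, fun v hv => ?_, hcons⟩
  obtain ⟨h1, h2⟩ := hv.duhamel hT.le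
  intro t ht
  rw [← h2.unique hT.le h1 hu hD ht, extend_apply hT.le ht]

end FDNLS
end

/-! ### Exponential sums: Kusmin–Landau and van der Corput -/

noncomputable section
set_option linter.unusedSectionVars false
namespace FDNLS
open Set

/-- `cot (δ / 2)`. -/
def cotHalf (δ : ℝ) : ℝ := Real.cos (δ / 2) / Real.sin (δ / 2)

lemma sin_half_lower {l δ : ℝ} (hl : 0 < l) (h1 : l ≤ δ) (h2 : δ ≤ 2 * Real.pi - l) :
    l / Real.pi ≤ Real.sin (δ / 2) := by
  have hpi := Real.pi_pos
  have key : ∀ x : ℝ, l / 2 ≤ x → x ≤ Real.pi / 2 → l / Real.pi ≤ Real.sin x := by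
    intro x hx1 hx2
    have := Real.mul_le_sin (by linarith) hx2
    refine le_trans ?_ this
    rw [div_mul_eq_mul_div, div_le_div_iff_of_pos_right hpi]
    linarith
  rcases le_total (δ / 2) (Real.pi / 2) with h | h
  · exact key _ (by linarith) h
  · rw [← Real.sin_pi_sub]
    exact key _ (by linarith) (by linarith)

lemma abs_cotHalf_le {l δ : ℝ} (hl : 0 < l) (h1 : l ≤ δ) (h2 : δ ≤ 2 * Real.pi - l) :
    |cotHalf δ| ≤ Real.pi / l := by
  have h := sin_half_lower hl h1 h2
  have hp : 0 < l / Real.pi := div_pos hl Real.pi_pos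
  rw [cotHalf, abs_div, abs_of_pos (hp.trans_le h)]
  calc _ ≤ 1 / (l / Real.pi) :=
        div_le_div₀ zero_le_one (Real.abs_cos_le_one _) hp h
    _ = _ := by field_simp

lemma cotHalf_anti {a b : ℝ} (ha : 0 < a) (hab : a ≤ b) (hb : b < 2 * Real.pi) :
    cotHalf b ≤ cotHalf a := by
  have h1 : 0 < Real.sin (a / 2) := Real.sin_pos_of_pos_of_lt_pi (by linarith) (by linarith)
  have h2 : 0 < Real.sin (b / 2) := Real.sin_pos_of_pos_of_lt_pi (by linarith) (by linarith)
  rw [cotHalf, cotHalf, div_le_div_iff₀ h2 h1]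
  have h3 : 0 ≤ Real.sin (b / 2 - a / 2) :=
    Real.sin_nonneg_of_nonneg_of_le_pi (by linarith) (by linarith)
  rw [Real.sin_sub] at h3
  linarith

/-- `1 / (exp (iδ) - 1)`. -/
def invExpSub (δ : ℝ) : ℂ := -(1 / 2) - Complex.I / 2 * (cotHalf δ : ℂ)

lemma invExpSub_spec {δ : ℝ} (h : Real.sin (δ / 2) ≠ 0) :
    (Complex.exp (δ * Complex.I) - 1) * invExpSub δ = 1 := by
  have h1 : (δ : ℂ) = 2 * ((δ / 2 : ℝ) : ℂ) := by push_cast; ring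
  have h2 : Complex.exp (δ * Complex.I) =
      ((1 - 2 * Real.sin (δ / 2) ^ 2 : ℝ) : ℂ) +
        ((2 * Real.sin (δ / 2) * Real.cos (δ / 2) : ℝ) : ℂ) * Complex.I := by
    rw [Complex.exp_mul_I, ← Complex.ofReal_cos, ← Complex.ofReal_sin]
    have e1 : Real.cos δ = 1 - 2 * Real.sin (δ / 2) ^ 2 := by
      have := Real.cos_sq_add_sin_sq (δ / 2)
      conv_lhs => rw [show δ = 2 * (δ / 2) by ring, Real.cos_two_mul]
      linarith
    have e2 : Real.sin δ = 2 * Real.sin (δ / 2) * Real.cos (δ / 2) := by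
      conv_lhs => rw [show δ = 2 * (δ / 2) by ring, Real.sin_two_mul]
    rw [e1, e2]
  rw [h2, invExpSub, cotHalf]
  have hs := Real.cos_sq_add_sin_sq (δ / 2)
  generalize Real.sin (δ / 2) = s at *
  generalize Real.cos (δ / 2) = c at *
  have hs' : (c : ℂ) ^ 2 + (s : ℂ) ^ 2 = 1 := by exact_mod_cast hs
  have h' : (s : ℂ) ≠ 0 := by exact_mod_cast h
  push_cast
  field_simp
  ring_nf
  simp only [Complex.I_sq]
  linear_combination (2 * (s : ℂ)) * hs'

lemma norm_invExpSub_le (δ : ℝ) : ‖invExpSub δ‖ ≤ 1 / 2 + |cotHalf δ| / 2 := by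
  refine (norm_sub_le _ _).trans ?_
  simp [div_mul_eq_mul_div]

/-- The real part of 1/(e^{iδ} - 1) is the constant -1/2, so its variation is that of cot(δ/2), a
monotone function. -/
lemma norm_invExpSub_sub (a b : ℝ) :
    ‖invExpSub a - invExpSub b‖ = |cotHalf a - cotHalf b| / 2 := by
  have : invExpSub a - invExpSub b = -(Complex.I / 2) * ((cotHalf a - cotHalf b : ℝ) : ℂ) := by
    simp only [invExpSub]; push_cast; ring
  rw [this, norm_mul, Complex.norm_real]
  simp
  ring

/-- The **Kusmin–Landau inequality**. -/
lemma kusmin_landau {l : ℝ} (hl : 0 < l) (hl1 : l ≤ 1) (n : ℕ) (φ : ℕ → ℝ)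
    (h1 : ∀ k < n, l ≤ φ (k + 1) - φ k) (h2 : ∀ k < n, φ (k + 1) - φ k ≤ 2 * Real.pi - l)
    (h3 : ∀ k, k + 1 < n → φ (k + 1) - φ k ≤ φ (k + 2) - φ (k + 1)) :
    ‖∑ k ∈ Finset.range n, Complex.exp (φ k * Complex.I)‖ ≤ 8 / l := by
  set δ : ℕ → ℝ := fun k => φ (k + 1) - φ k with hδ
  have hpi := Real.pi_pos
  -- Each term is a forward difference of the exponentials divided by e^{iδ_k} - 1, ready for
  -- summation by parts.
  have hz : ∀ k < n, Complex.exp (φ k * Complex.I) =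
      (Complex.exp (φ (k + 1) * Complex.I) - Complex.exp (φ k * Complex.I)) * invExpSub (δ k) := by
    intro k hk
    have hs := sin_half_lower hl (h1 k hk) (h2 k hk)
    have := invExpSub_spec (δ := δ k) ((div_pos hl hpi).trans_le hs).ne'
    have e : Complex.exp (φ (k + 1) * Complex.I) =
        Complex.exp (φ k * Complex.I) * Complex.exp (δ k * Complex.I) := by
      rw [← Complex.exp_add]; congr 1; simp only [hδ]; push_cast; ring
    rw [e]
    linear_combination (-Complex.exp (φ k * Complex.I)) * this
  -- Summation by parts as an induction. The increments δ_k increase, so the cotangents decrease and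
  -- their total variation telescopes.
  have key : ∀ m, m < n → ‖∑ k ∈ Finset.range (m + 1), Complex.exp (φ k * Complex.I) -
      Complex.exp (φ (m + 1) * Complex.I) * invExpSub (δ m)‖ ≤
      ‖invExpSub (δ 0)‖ + (cotHalf (δ 0) - cotHalf (δ m)) / 2 := by
    intro m
    induction m with
    | zero =>
      intro hm
      have := hz 0 hm
      rw [Finset.sum_range_one]
      have e : Complex.exp (φ 0 * Complex.I) - Complex.exp (φ (0 + 1) * Complex.I) * invExpSub (δ 0)
          = -(Complex.exp (φ 0 * Complex.I) * invExpSub (δ 0)) := by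
        linear_combination this
      rw [e, norm_neg, norm_mul, Complex.norm_exp_ofReal_mul_I]
      simp
    | succ m ih =>
      intro hm
      have ih := ih (by omega)
      have := hz (m + 1) hm
      rw [Finset.sum_range_succ]
      have e : ∑ k ∈ Finset.range (m + 1), Complex.exp (φ k * Complex.I) +
          Complex.exp (φ (m + 1 : ℕ) * Complex.I) -
          Complex.exp (φ (m + 1 + 1) * Complex.I) * invExpSub (δ (m + 1)) =
          (∑ k ∈ Finset.range (m + 1), Complex.exp (φ k * Complex.I) -
            Complex.exp (φ (m + 1) * Complex.I) * invExpSub (δ m)) +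
          Complex.exp (φ (m + 1) * Complex.I) * (invExpSub (δ m) - invExpSub (δ (m + 1))) := by
        linear_combination this
      rw [e]
      have hanti := cotHalf_anti (hl.trans_le (h1 m (by omega))) (h3 m hm)
        ((h2 (m + 1) hm).trans_lt (by linarith))
      refine (norm_add_le _ _).trans ?_
      rw [norm_mul, Complex.norm_exp_ofReal_mul_I, one_mul, norm_invExpSub_sub,
        abs_of_nonneg (sub_nonneg.2 hanti)]
      linarith
  rcases Nat.eq_zero_or_pos n with rfl | hn
  · simp; positivity
  obtain ⟨m, rfl⟩ : ∃ m, n = m + 1 := ⟨n - 1, by omega⟩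
  have hk := key m (by omega)
  have c0 := abs_cotHalf_le hl (h1 0 hn) (h2 0 hn)
  have cm := abs_cotHalf_le hl (h1 m (by omega)) (h2 m (by omega))
  have g0 := norm_invExpSub_le (δ 0)
  have gm := norm_invExpSub_le (δ m)
  have htri := norm_sub_norm_le (∑ k ∈ Finset.range (m + 1), Complex.exp (φ k * Complex.I))
    (Complex.exp (φ (m + 1) * Complex.I) * invExpSub (δ m))
  rw [norm_mul, Complex.norm_exp_ofReal_mul_I, one_mul] at htri
  have a0 := abs_le.1 c0
  have am := abs_le.1 cm
  -- The two boundary terms and the variation add up to at most 1 + 2π/l, and l ≤ 1.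
  have hfin : 1 + 2 * (Real.pi / l) ≤ 8 / l := by
    rw [← mul_div_assoc, le_div_iff₀ hl, add_mul, div_mul_cancel₀ _ hl.ne']
    linarith [Real.pi_lt_d2]
  change |cotHalf (δ 0)| ≤ _ at c0
  change |cotHalf (δ m)| ≤ _ at cm
  linarith [a0.1, a0.2, am.1, am.2, abs_nonneg (cotHalf (δ 0))]

/-- A sublevel set of a monotone sequence is an initial segment. This cuts a range of summation
where a monotone quantity crosses a level. -/
lemma exists_threshold (n : ℕ) (δ : ℕ → ℝ) (hδ : ∀ j k, j ≤ k → k < n → δ j ≤ δ k) (a : ℝ) :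
    ∃ p ≤ n, (∀ k < p, δ k < a) ∧ ∀ k, p ≤ k → k < n → a ≤ δ k := by
  induction n with
  | zero => exact ⟨0, le_rfl, by simp, by simp⟩
  | succ n ih =>
    obtain ⟨p, hp, h1, h2⟩ := ih fun j k hjk hk => hδ j k hjk (by omega)
    rcases hp.lt_or_eq with h | h
    · exact ⟨p, by omega, h1, fun k hk hk' => (h2 p le_rfl h).trans (hδ p k hk hk')⟩
    · rcases lt_or_ge (δ n) a with h' | h'
      · exact ⟨n + 1, le_rfl, fun k hk => (hδ k n (by omega) (by omega)).trans_lt h', by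
          intro k h3 h4; omega⟩
      · exact ⟨n, by omega, h ▸ h1, fun k hk hk' => by
          rwa [show k = n by omega]⟩

/-- The second derivative test of van der Corput, for increasing differences. -/
lemma van_der_corput_aux {m : ℝ} (hm : 0 < m) (n : ℕ) (φ : ℕ → ℝ)
    (h2 : ∀ k < n, |φ (k + 1) - φ k| ≤ 4)
    (h3 : ∀ k, k + 1 < n → φ (k + 1) - φ k + m ≤ φ (k + 2) - φ (k + 1)) :
    ‖∑ k ∈ Finset.range n, Complex.exp (φ k * Complex.I)‖ ≤ 18 * (1 / Real.sqrt m + 1) := by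
  have hpi := Real.pi_gt_three
  set δ : ℕ → ℝ := fun k => φ (k + 1) - φ k with hδ
  have hgap : ∀ j i, j + i < n → δ j + i * m ≤ δ (j + i) := by
    intro j i
    induction i with
    | zero => simp
    | succ i ih =>
      intro h
      have := h3 (j + i) (by omega)
      have := ih (by omega)
      simp only [hδ] at *
      push_cast
      rw [show j + (i + 1) = j + i + 1 by ring]
      linarith
  have hmono : ∀ j k, j ≤ k → k < n → δ j ≤ δ k := by
    intro j k hjk hk
    obtain ⟨i, rfl⟩ := Nat.exists_eq_add_of_le hjk
    have := hgap j i hk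
    have : 0 ≤ (i : ℝ) * m := by positivity
    linarith
  have hsm : 0 < Real.sqrt m := Real.sqrt_pos.2 hm
  -- At l = √m the Kusmin–Landau bound 8/l balances the number 2l/m of indices whose increment lies
  -- in (-l, l); the minimum with 1 meets the hypothesis of `kusmin_landau`.
  set l := min 1 (Real.sqrt m) with hl
  have hl0 : 0 < l := lt_min one_pos hsm
  have hl1 : l ≤ 1 := min_le_left _ _
  obtain ⟨p, hpn, hp1, hp2⟩ := exists_threshold n δ hmono (-l)
  obtain ⟨q, hqn, hq1, hq2⟩ := exists_threshold n δ hmono l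
  have hpq : p ≤ q := by
    by_contra! h
    have := hp1 q h
    have := hq2 q le_rfl (by omega)
    linarith
  have hinv : 1 / l ≤ 1 / Real.sqrt m + 1 := by
    rcases min_choice 1 (Real.sqrt m) with h | h
    · rw [hl, h]
      simp
    · rw [hl, h]; linarith
  have s1 : ‖∑ k ∈ Finset.range p, Complex.exp (φ k * Complex.I)‖ ≤ 8 / l := by
    -- Adding 2πk to the phase does not change the exponentials, and it moves the increments from
    -- [-4, -l] into [l, 2π - l].
    have := kusmin_landau hl0 hl1 p (fun k => φ k + k * (2 * Real.pi)) ?_ ?_ ?_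
    · refine le_of_eq_of_le ?_ this
      congr 1
      refine Finset.sum_congr rfl fun k _ => ?_
      push_cast
      rw [add_mul, Complex.exp_add, mul_assoc (k : ℂ), Complex.exp_nat_mul_two_pi_mul_I, mul_one]
    · intro k hk
      have := abs_le.1 (h2 k (by omega))
      push_cast
      linarith
    · intro k hk
      have := hp1 k hk
      simp only [hδ] at this
      push_cast
      linarith
    · intro k hk
      have := h3 k (by omega)
      push_cast
      linarith
  have s3 : ‖∑ k ∈ Finset.Ico q n, Complex.exp (φ k * Complex.I)‖ ≤ 8 / l := by
    rw [Finset.sum_Ico_eq_sum_range]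
    refine kusmin_landau hl0 hl1 (n - q) (fun k => φ (q + k)) ?_ ?_ ?_
    · intro k hk
      exact hq2 (q + k) (by omega) (by omega)
    · intro k hk
      have := abs_le.1 (h2 (q + k) (by omega))
      have e : φ (q + (k + 1)) = φ (q + k + 1) := by rw [add_assoc]
      rw [e]; linarith
    · intro k hk
      have := h3 (q + k) (by omega)
      have e : φ (q + (k + 1)) = φ (q + k + 1) := by rw [add_assoc]
      have e2 : φ (q + (k + 2)) = φ (q + k + 2) := by rw [add_assoc]
      simp only [e, e2]; linarith
  have s2 : ‖∑ k ∈ Finset.Ico p q, Complex.exp (φ k * Complex.I)‖ ≤ 2 / Real.sqrt m + 1 := by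
    have hb : ‖∑ k ∈ Finset.Ico p q, Complex.exp (φ k * Complex.I)‖ ≤ ((q - p : ℕ) : ℝ) := by
      refine (norm_sum_le _ _).trans ?_
      simp [Complex.norm_exp_ofReal_mul_I]
    refine hb.trans ?_
    rcases hpq.lt_or_eq with h | h
    · have g := hgap p (q - 1 - p) (by omega)
      rw [show p + (q - 1 - p) = q - 1 by omega] at g
      have g1 := hp2 p le_rfl (by omega)
      have g2 := hq1 (q - 1) (by omega)
      have g3 : ((q - 1 - p : ℕ) : ℝ) = ((q - p : ℕ) : ℝ) - 1 := by
        rw [show q - 1 - p = q - p - 1 by omega, Nat.cast_sub (by omega)]; simp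
      rw [g3] at g
      have g4 : (((q - p : ℕ) : ℝ) - 1) * m ≤ 2 * Real.sqrt m := by
        have : l ≤ Real.sqrt m := min_le_right _ _
        linarith
      have g5 : ((q - p : ℕ) : ℝ) - 1 ≤ 2 / Real.sqrt m := by
        rw [le_div_iff₀ hsm]
        have e : m = Real.sqrt m * Real.sqrt m := (Real.mul_self_sqrt hm.le).symm
        have g6 : (((q - p : ℕ) : ℝ) - 1) * Real.sqrt m * Real.sqrt m ≤ 2 * Real.sqrt m := by
          rw [mul_assoc, ← e]; exact g4
        exact le_of_mul_le_mul_right g6 hsm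
      linarith
    · rw [h]; simp; positivity
  have hsplit : ∑ k ∈ Finset.range n, Complex.exp (φ k * Complex.I) =
      ∑ k ∈ Finset.range p, Complex.exp (φ k * Complex.I) +
      ∑ k ∈ Finset.Ico p q, Complex.exp (φ k * Complex.I) +
      ∑ k ∈ Finset.Ico q n, Complex.exp (φ k * Complex.I) := by
    rw [Finset.sum_range_add_sum_Ico _ hpq, Finset.sum_range_add_sum_Ico _ hqn]
  rw [hsplit]
  refine (norm_add₃_le).trans ?_
  have e8 : 8 / l = 8 * (1 / l) := by ring
  have e2 : 2 / Real.sqrt m = 2 * (1 / Real.sqrt m) := by ring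
  rw [e8] at s1 s3
  rw [e2] at s2
  linarith

lemma norm_sum_exp_neg (s : Finset ℕ) (φ : ℕ → ℝ) :
    ‖∑ k ∈ s, Complex.exp ((-φ k : ℝ) * Complex.I)‖ =
      ‖∑ k ∈ s, Complex.exp (φ k * Complex.I)‖ := by
  rw [← Complex.norm_conj, map_sum]
  congr 1
  refine Finset.sum_congr rfl fun k _ => ?_
  rw [← Complex.exp_conj]
  simp

/-- The second derivative test of **van der Corput** for exponential sums. -/
lemma van_der_corput {m : ℝ} (hm : 0 < m) (n : ℕ) (φ : ℕ → ℝ)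
    (h2 : ∀ k < n, |φ (k + 1) - φ k| ≤ 4)
    (h3 : (∀ k, k + 1 < n → m ≤ φ (k + 2) - 2 * φ (k + 1) + φ k) ∨
      ∀ k, k + 1 < n → φ (k + 2) - 2 * φ (k + 1) + φ k ≤ -m) :
    ‖∑ k ∈ Finset.range n, Complex.exp (φ k * Complex.I)‖ ≤ 18 * (1 / Real.sqrt m + 1) := by
  rcases h3 with h3 | h3
  · exact van_der_corput_aux hm n φ h2 fun k hk => by linarith [h3 k hk]
  · rw [← norm_sum_exp_neg]
    refine van_der_corput_aux hm n (fun k => -φ k) (fun k hk => ?_) fun k hk => ?_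
    · rw [← abs_neg]; convert h2 k hk using 2; ring
    · linarith [h3 k hk]

end FDNLS
end

/-! ### The dispersion relation and its inflection point -/

noncomputable section
set_option linter.unusedSectionVars false
namespace FDNLS
open Set

/-- The dispersion relation `(sin (aξ) / a)^α`, where `a = h / 2`. -/
def disp (α a ξ : ℝ) : ℝ := (Real.sin (a * ξ) / a) ^ α

/-- The first derivative of the dispersion relation. -/
def disp' (α a ξ : ℝ) : ℝ := α * (Real.sin (a * ξ) / a) ^ (α - 1) * Real.cos (a * ξ)

/-- The second derivative of the dispersion relation. -/
def disp'' (α a ξ : ℝ) : ℝ :=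
  α * (Real.sin (a * ξ) / a) ^ (α - 2) * ((α - 1) - α * Real.sin (a * ξ) ^ 2)

variable {α a ξ N d : ℝ}

lemma hasDerivAt_sin_div (ha : 0 < a) :
    HasDerivAt (fun ξ => Real.sin (a * ξ) / a) (Real.cos (a * ξ)) ξ := by
  have h : HasDerivAt (fun ξ => a * ξ) a ξ := by simpa using (hasDerivAt_id ξ).const_mul a
  refine (h.sin.div_const a).congr_deriv ?_
  field_simp

lemma sin_div_pos (ha : 0 < a) (h0 : 0 < ξ) (h1 : a * ξ ≤ Real.pi / 2) :
    0 < Real.sin (a * ξ) / a :=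
  div_pos (Real.sin_pos_of_pos_of_lt_pi (by positivity) (by linarith [Real.pi_pos])) ha

lemma hasDerivAt_disp (ha : 0 < a) (h0 : 0 < ξ) (h1 : a * ξ ≤ Real.pi / 2) :
    HasDerivAt (disp α a) (disp' α a ξ) ξ := by
  have hS := sin_div_pos ha h0 h1
  refine ((hasDerivAt_sin_div (ξ := ξ) ha).rpow_const (p := α) (Or.inl hS.ne')).congr_deriv ?_
  simp only [disp']; ring

lemma hasDerivAt_disp' (ha : 0 < a) (h0 : 0 < ξ) (h1 : a * ξ ≤ Real.pi / 2) :
    HasDerivAt (disp' α a) (disp'' α a ξ) ξ := by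
  have hS := sin_div_pos ha h0 h1
  have h : HasDerivAt (fun ξ => a * ξ) a ξ := by simpa using (hasDerivAt_id ξ).const_mul a
  have hd := (((hasDerivAt_sin_div (ξ := ξ) ha).rpow_const (p := α - 1)
    (Or.inl hS.ne')).const_mul α).fun_mul h.cos
  refine hd.congr_deriv ?_
  have e : (Real.sin (a * ξ) / a) ^ (α - 1) =
      (Real.sin (a * ξ) / a) ^ (α - 2) * (Real.sin (a * ξ) / a) := by
    rw [← Real.rpow_add_one hS.ne']; congr 1; ring
  simp only [disp'']
  rw [show α - 1 - 1 = α - 2 by ring, e]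
  have hc := Real.cos_sq_add_sin_sq (a * ξ)
  generalize (Real.sin (a * ξ) / a) ^ (α - 2) = P
  field_simp
  linear_combination (P * α * (α - 1)) * hc

/-- Sum-to-product and Jordan's inequality; the condition on u + v keeps the cosine factor above
1/4. -/
lemma sin_sub_sin_lower {u v : ℝ} (hu : 0 ≤ u) (huv : u ≤ v) (h : u + v ≤ 3 * Real.pi / 4) :
    (v - u) / (2 * Real.pi) ≤ Real.sin v - Real.sin u := by
  have hpi := Real.pi_pos
  rw [Real.sin_sub_sin]
  have h1 := Real.mul_le_sin (x := (v - u) / 2) (by linarith) (by linarith)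
  have h2 := Real.mul_le_sin (x := Real.pi / 2 - (v + u) / 2) (by linarith) (by linarith)
  rw [Real.sin_pi_div_two_sub] at h2
  have h3 : 1 / 4 ≤ Real.cos ((v + u) / 2) := by
    refine le_trans ?_ h2
    rw [div_mul_eq_mul_div, le_div_iff₀ hpi]
    linarith
  have h4 : (v - u) / (2 * Real.pi) = 2 * (2 / Real.pi * ((v - u) / 2)) * (1 / 4) := by
    field_simp; ring
  rw [h4]
  have h5 : 0 ≤ 2 / Real.pi * ((v - u) / 2) := by
    have : 0 ≤ v - u := by linarith
    positivity
  gcongr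
  linarith

/-- The sine of the inflection angle. -/
def inflSin (α : ℝ) : ℝ := Real.sqrt ((α - 1) / α)

/-- The inflection angle: the value of `aξ` at which the second derivative vanishes. -/
def inflAngle (α : ℝ) : ℝ := Real.arcsin (inflSin α)

lemma inflSin_pos (h1 : 1 < α) : 0 < inflSin α :=
  Real.sqrt_pos.2 (div_pos (by linarith) (by linarith))

lemma inflSin_sq (h1 : 1 < α) : inflSin α ^ 2 = (α - 1) / α :=
  Real.sq_sqrt (div_pos (by linarith) (by linarith)).le

lemma inflSin_le_one (h1 : 1 < α) : inflSin α ≤ 1 := by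
  rw [inflSin]
  exact Real.sqrt_le_one.2 ((div_le_one (by linarith)).2 (by linarith))

lemma inflAngle_pos (h1 : 1 < α) : 0 < inflAngle α := Real.arcsin_pos.2 (inflSin_pos h1)

/-- For α ≤ 2 the squared sine (α-1)/α is at most 1/2. The sum of this angle and any aξ ≤ π/2 is
then at most 3π/4, as `sin_sub_sin_lower` demands. -/
lemma inflAngle_le (h1 : 1 < α) (h2 : α ≤ 2) : inflAngle α ≤ Real.pi / 4 := by
  refine (Real.arcsin_le_iff_le_sin ⟨by linarith [inflSin_pos h1], inflSin_le_one h1⟩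
    ⟨by linarith [Real.pi_pos], by linarith [Real.pi_pos]⟩).2 ?_
  rw [Real.sin_pi_div_four, inflSin, Real.sqrt_le_left (by positivity), div_pow,
    Real.sq_sqrt (by norm_num), div_le_div_iff₀ (by linarith) (by norm_num)]
  linarith

lemma sin_inflAngle (h1 : 1 < α) : Real.sin (inflAngle α) = inflSin α :=
  Real.sin_arcsin (by linarith [inflSin_pos h1]) (inflSin_le_one h1)

/-- The constant in the lower bound of the second derivative. -/
def inflConst (α : ℝ) : ℝ := inflSin α * inflAngle α / (16 * Real.pi)

lemma inflConst_pos (h1 : 1 < α) : 0 < inflConst α := by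
  have := inflSin_pos h1
  have := inflAngle_pos h1
  have := Real.pi_pos
  unfold inflConst
  positivity

/-- This is uniform in a. If the whole block lies well below the inflection, the angular gap is at
least half the inflection angle; otherwise a is at least a multiple of 1/N and converts the distance
d into an angle. -/
lemma angle_gap (hα : 1 < α) (ha : 0 < a) (hN : 0 < N) (hd0 : 0 ≤ d) (hd : d ≤ N)
    (hξ2 : ξ ≤ 2 * N) (hk : d ≤ |inflAngle α / a - ξ|) :
    inflAngle α * d / (4 * N) ≤ |inflAngle α - a * ξ| := by
  have h0 := inflAngle_pos hα
  rcases le_total (2 * a * N) (inflAngle α / 2) with h | h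
  · have h1 : a * ξ ≤ inflAngle α / 2 := by nlinarith
    rw [abs_of_nonneg (by linarith)]
    have : inflAngle α * d / (4 * N) ≤ inflAngle α / 4 := by
      rw [div_le_div_iff₀ (by positivity) (by positivity)]
      nlinarith [mul_le_mul_of_nonneg_left hd h0.le]
    linarith
  · have e : inflAngle α - a * ξ = a * (inflAngle α / a - ξ) := by field_simp
    rw [e, abs_mul, abs_of_pos ha]
    refine le_trans ?_ (mul_le_mul_of_nonneg_left hk ha.le)
    rw [div_le_iff₀ (by positivity)]
    nlinarith [mul_le_mul_of_nonneg_right h hd0]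

lemma rpow_sin_div_lower (hα₂ : α ≤ 2) (ha : 0 < a) (hN : 0 < N) (hξ1 : N ≤ ξ)
    (hξ2 : ξ ≤ 2 * N) (h1 : a * ξ ≤ Real.pi / 2) (hα₁ : 1 < α) :
    1 / 2 * N ^ (α - 2) ≤ (Real.sin (a * ξ) / a) ^ (α - 2) := by
  have hξ : 0 < ξ := hN.trans_le hξ1
  have hS := sin_div_pos ha hξ h1
  have hS2 : Real.sin (a * ξ) / a ≤ 2 * N := by
    refine le_trans ?_ hξ2
    rw [div_le_iff₀ ha, mul_comm ξ]
    exact Real.sin_le (by positivity)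
  calc 1 / 2 * N ^ (α - 2) ≤ (2 : ℝ) ^ (α - 2) * N ^ (α - 2) := by
        gcongr
        calc (1 / 2 : ℝ) = (2 : ℝ) ^ (-1 : ℝ) := by rw [Real.rpow_neg_one]; norm_num
          _ ≤ _ := Real.rpow_le_rpow_of_exponent_le (by norm_num) (by linarith)
    _ = (2 * N) ^ (α - 2) := (Real.mul_rpow (by norm_num) hN.le).symm
    _ ≤ _ := Real.rpow_le_rpow_of_nonpos hS hS2 (by linarith)

/-- The factor inflSin - sin is a simple zero at the inflection angle. So at distance d from the
inflection point the second derivative has size at least N^{α-2}·d/N, up to a constant. -/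
lemma disp''_factor (hα : 1 < α) :
    disp'' α a ξ = (Real.sin (a * ξ) / a) ^ (α - 2) *
      (α * α * ((inflSin α + Real.sin (a * ξ)) * (inflSin α - Real.sin (a * ξ)))) := by
  have h : (α - 1) = α * inflSin α ^ 2 := by
    rw [inflSin_sq hα]; field_simp
  rw [disp'', h]; ring

lemma rpow_sub_three (hN : 0 < N) : N ^ (α - 3) = N ^ (α - 2) / N := by
  rw [← Real.rpow_sub_one hN.ne']; congr 1; ring

lemma le_disp'' (hα₁ : 1 < α) (hα₂ : α ≤ 2) (ha : 0 < a) (hN : 0 < N) (hd0 : 0 ≤ d) (hd : d ≤ N)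
    (hξ1 : N ≤ ξ) (hξ2 : ξ ≤ 2 * N) (h1 : a * ξ ≤ Real.pi / 2) (hk : ξ ≤ inflAngle α / a - d) :
    inflConst α * N ^ (α - 3) * d ≤ disp'' α a ξ := by
  have hξ : 0 < ξ := hN.trans_le hξ1
  have h0 := inflAngle_pos hα₁
  have hy := inflSin_pos hα₁
  have hgap := angle_gap hα₁ ha hN hd0 hd hξ2 (d := d) (le_abs.2 (Or.inl (by linarith)))
  have hle : a * ξ ≤ inflAngle α := by
    have : ξ ≤ inflAngle α / a := by linarith
    rwa [le_div_iff₀ ha, mul_comm] at this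
  rw [abs_of_nonneg (by linarith)] at hgap
  have hsin := sin_sub_sin_lower (u := a * ξ) (v := inflAngle α) (by positivity) hle
    (by linarith [inflAngle_le hα₁ hα₂])
  rw [sin_inflAngle hα₁] at hsin
  have hs0 : 0 ≤ Real.sin (a * ξ) :=
    Real.sin_nonneg_of_nonneg_of_le_pi (by positivity) (by linarith [Real.pi_pos])
  have hpi := Real.pi_pos
  have hdiff : inflAngle α * d / (4 * N) / (2 * Real.pi) ≤ inflSin α - Real.sin (a * ξ) :=
    le_trans (by gcongr) hsin
  rw [disp''_factor hα₁]
  have hP := rpow_sin_div_lower hα₂ ha hN hξ1 hξ2 h1 hα₁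
  have hα2 : 1 ≤ α * α := by nlinarith
  calc inflConst α * N ^ (α - 3) * d
      = 1 / 2 * N ^ (α - 2) *
        (1 * (inflSin α * (inflAngle α * d / (4 * N) / (2 * Real.pi)))) := by
        rw [rpow_sub_three hN, inflConst]; field_simp; ring
    _ ≤ _ := by gcongr; linarith

lemma disp''_le (hα₁ : 1 < α) (hα₂ : α ≤ 2) (ha : 0 < a) (hN : 0 < N) (hd0 : 0 ≤ d) (hd : d ≤ N)
    (hξ1 : N ≤ ξ) (hξ2 : ξ ≤ 2 * N) (h1 : a * ξ ≤ Real.pi / 2) (hk : inflAngle α / a + d ≤ ξ) :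
    disp'' α a ξ ≤ -(inflConst α * N ^ (α - 3) * d) := by
  have hξ : 0 < ξ := hN.trans_le hξ1
  have h0 := inflAngle_pos hα₁
  have hy := inflSin_pos hα₁
  have hgap := angle_gap hα₁ ha hN hd0 hd hξ2 (d := d) (le_abs.2 (Or.inr (by linarith)))
  have hle : inflAngle α ≤ a * ξ := by
    have : inflAngle α / a ≤ ξ := by linarith
    rwa [div_le_iff₀ ha, mul_comm] at this
  rw [abs_of_nonpos (by linarith)] at hgap
  have hsin := sin_sub_sin_lower (v := a * ξ) (u := inflAngle α) h0.le hle
    (by linarith [inflAngle_le hα₁ hα₂])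
  rw [sin_inflAngle hα₁] at hsin
  have hs0 : 0 ≤ Real.sin (a * ξ) :=
    Real.sin_nonneg_of_nonneg_of_le_pi (by positivity) (by linarith [Real.pi_pos])
  have hpi := Real.pi_pos
  have hdiff : inflAngle α * d / (4 * N) / (2 * Real.pi) ≤ Real.sin (a * ξ) - inflSin α :=
    le_trans (by gcongr; linarith) hsin
  rw [disp''_factor hα₁, le_neg]
  have hP := rpow_sin_div_lower hα₂ ha hN hξ1 hξ2 h1 hα₁
  have hα2 : 1 ≤ α * α := by nlinarith
  calc inflConst α * N ^ (α - 3) * d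
      = 1 / 2 * N ^ (α - 2) *
        (1 * (inflSin α * (inflAngle α * d / (4 * N) / (2 * Real.pi)))) := by
        rw [rpow_sub_three hN, inflConst]; field_simp; ring
    _ ≤ (Real.sin (a * ξ) / a) ^ (α - 2) *
      (α * α * ((inflSin α + Real.sin (a * ξ)) * (Real.sin (a * ξ) - inflSin α))) := by
        gcongr; linarith
    _ = _ := by ring

lemma abs_disp'_le (hα₁ : 1 < α) (hα₂ : α ≤ 2) (ha : 0 < a) (hN : 0 < N)
    (hξ1 : N ≤ ξ) (hξ2 : ξ ≤ 2 * N) (h1 : a * ξ ≤ Real.pi / 2) :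
    |disp' α a ξ| ≤ 4 * N ^ (α - 1) := by
  have hξ : 0 < ξ := hN.trans_le hξ1
  have hS := sin_div_pos ha hξ h1
  have hS2 : Real.sin (a * ξ) / a ≤ 2 * N := by
    refine le_trans ?_ hξ2
    rw [div_le_iff₀ ha, mul_comm ξ]
    exact Real.sin_le (by positivity)
  rw [disp', abs_mul, abs_mul, abs_of_pos (by linarith : 0 < α),
    abs_of_pos (Real.rpow_pos_of_pos hS _)]
  calc α * (Real.sin (a * ξ) / a) ^ (α - 1) * |Real.cos (a * ξ)|
      ≤ 2 * (2 * N) ^ (α - 1) * 1 := by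
        gcongr
        exact Real.abs_cos_le_one _
    _ = 2 * (2 : ℝ) ^ (α - 1) * N ^ (α - 1) := by rw [Real.mul_rpow (by norm_num) hN.le]; ring
    _ ≤ 2 * (2 : ℝ) ^ (1 : ℝ) * N ^ (α - 1) := by
        gcongr
        · norm_num
        · linarith
    _ = _ := by rw [Real.rpow_one]; norm_num

lemma sub_mem_of_deriv {f f' : ℝ → ℝ} {x lo hi : ℝ}
    (h : ∀ y ∈ Icc x (x + 1), HasDerivAt f (f' y) y) (hb : ∀ y ∈ Icc x (x + 1), f' y ∈ Icc lo hi) :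
    f (x + 1) - f x ∈ Icc lo hi := by
  obtain ⟨c, hc, hc'⟩ := exists_hasDerivAt_eq_slope f f' (by linarith : x < x + 1)
    (fun y hy => (h y hy).continuousAt.continuousWithinAt) (fun y hy => h y (Ioo_subset_Icc_self hy))
  rw [add_sub_cancel_left, div_one] at hc'
  rw [← hc']
  exact hb c (Ioo_subset_Icc_self hc)

/-- The mean value theorem twice: for the first difference of f, and for f'. -/
lemma second_difference_mem {f f' f'' : ℝ → ℝ} {x lo hi : ℝ}
    (h : ∀ y ∈ Icc x (x + 2), HasDerivAt f (f' y) y)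
    (h' : ∀ y ∈ Icc x (x + 2), HasDerivAt f' (f'' y) y)
    (hb : ∀ y ∈ Icc x (x + 2), f'' y ∈ Icc lo hi) :
    f (x + 2) - 2 * f (x + 1) + f x ∈ Icc lo hi := by
  have key := sub_mem_of_deriv (f := fun y => f (y + 1) - f y) (f' := fun y => f' (y + 1) - f' y)
    (x := x) (lo := lo) (hi := hi) ?_ ?_
  · rw [show x + 1 + 1 = x + 2 by ring] at key
    convert key using 1; ring
  · intro y hy
    refine HasDerivAt.sub ?_ (h y ⟨hy.1, by linarith [hy.2]⟩)
    exact (h (y + 1) ⟨by linarith [hy.1], by linarith [hy.2]⟩).comp_add_const y 1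
  · intro y hy
    exact sub_mem_of_deriv (f := f') (f' := f'')
      (fun z hz => h' z ⟨by linarith [hy.1, hz.1], by linarith [hy.2, hz.2]⟩)
      (fun z hz => hb z ⟨by linarith [hy.1, hz.1], by linarith [hy.2, hz.2]⟩)

end FDNLS
end

/-! ### The dispersive estimate on a dyadic block -/

noncomputable section
set_option linter.unusedSectionVars false
namespace FDNLS
open Set

variable {α a : ℝ}

/-- The phase of the kernel on a dyadic block starting at `N`. -/
def phase (α a : ℝ) (N : ℕ) (t θ : ℝ) (i : ℕ) : ℝ :=
  ((N + i : ℕ) : ℝ) * θ - t * disp α a ((N + i : ℕ) : ℝ)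

/-- On this time scale t times the first derivative is at most 1/3, so the increments are at most π
+ 1/3 < 4 and no frequency aliasing occurs. It is this lemma that dictates the length N^{1-α}/12 of
the short intervals. -/
lemma phase_first_difference (hα₁ : 1 < α) (hα₂ : α ≤ 2) (ha : 0 < a) {N n : ℕ} (hN : 0 < N)
    (hn : n ≤ N) (hM : a * (N + n : ℕ) ≤ Real.pi / 2) {t θ : ℝ} (hθ : |θ| ≤ Real.pi)
    (ht : |t| ≤ (N : ℝ) ^ (1 - α) / 12) {k : ℕ} (hk : k < n) :
    |phase α a N t θ (k + 1) - phase α a N t θ k| ≤ 4 := by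
  have hN' : (0 : ℝ) < N := by exact_mod_cast hN
  have hkn : (k : ℝ) + 1 ≤ n := by exact_mod_cast hk
  have hnN : (n : ℝ) ≤ N := by exact_mod_cast hn
  push_cast at hM
  have hr : ∀ y ∈ Icc ((N : ℝ) + k) (N + k + 1), (N : ℝ) ≤ y ∧ y ≤ 2 * N ∧ a * y ≤ Real.pi / 2 := by
    intro y hy
    have hk0 : (0 : ℝ) ≤ k := by positivity
    refine ⟨by linarith [hy.1], by linarith [hy.2], le_trans ?_ hM⟩
    exact mul_le_mul_of_nonneg_left (by linarith [hy.2]) ha.le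
  have h := sub_mem_of_deriv (f := disp α a) (f' := disp' α a) (x := (N : ℝ) + k)
    (lo := -(4 * (N : ℝ) ^ (α - 1))) (hi := 4 * (N : ℝ) ^ (α - 1))
    (fun y hy => hasDerivAt_disp ha (hN'.trans_le (hr y hy).1) (hr y hy).2.2)
    (fun y hy => abs_le.1 (abs_disp'_le hα₁ hα₂ ha hN' (hr y hy).1 (hr y hy).2.1 (hr y hy).2.2))
  have h' := abs_le.2 h
  have e : phase α a N t θ (k + 1) - phase α a N t θ k =
      θ - t * (disp α a ((N : ℝ) + k + 1) - disp α a ((N : ℝ) + k)) := by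
    simp only [phase]; push_cast; rw [← add_assoc]; ring
  rw [e]
  refine (abs_sub _ _).trans ?_
  rw [abs_mul]
  have h1 : |t| * |disp α a ((N : ℝ) + k + 1) - disp α a ((N : ℝ) + k)| ≤
      (N : ℝ) ^ (1 - α) / 12 * (4 * (N : ℝ) ^ (α - 1)) := by gcongr
  have h2 : (N : ℝ) ^ (1 - α) / 12 * (4 * (N : ℝ) ^ (α - 1)) = 1 / 3 := by
    have : (N : ℝ) ^ (1 - α) * (N : ℝ) ^ (α - 1) = 1 := by
      rw [← Real.rpow_add hN']; simp
    linear_combination (1 / 3) * this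
  linarith [Real.pi_lt_d2]

lemma phase_second_difference {lo hi : ℝ} (ha : 0 < a) {N n : ℕ} (hN : 0 < N)
    (hM : a * (N + n : ℕ) ≤ Real.pi / 2) {t θ : ℝ} (ht : 0 ≤ t) {k : ℕ} (hk : k + 2 ≤ n)
    (hb : ∀ y ∈ Icc ((N : ℝ) + k) (N + k + 2), disp'' α a y ∈ Icc lo hi) :
    phase α a N t θ (k + 2) - 2 * phase α a N t θ (k + 1) + phase α a N t θ k ∈
      Icc (-(t * hi)) (-(t * lo)) := by
  have hN' : (0 : ℝ) < N := by exact_mod_cast hN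
  have hkn : (k : ℝ) + 2 ≤ n := by exact_mod_cast hk
  push_cast at hM
  have hr : ∀ y ∈ Icc ((N : ℝ) + k) (N + k + 2), 0 < y ∧ a * y ≤ Real.pi / 2 := by
    intro y hy
    have hk0 : (0 : ℝ) ≤ k := by positivity
    refine ⟨by linarith [hy.1], le_trans ?_ hM⟩
    exact mul_le_mul_of_nonneg_left (by linarith [hy.2]) ha.le
  have h := second_difference_mem (f := disp α a) (f' := disp' α a) (f'' := disp'' α a)
    (x := (N : ℝ) + k)
    (fun y hy => hasDerivAt_disp ha (hr y hy).1 (hr y hy).2)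
    (fun y hy => hasDerivAt_disp' ha (hr y hy).1 (hr y hy).2) hb
  have e : phase α a N t θ (k + 2) - 2 * phase α a N t θ (k + 1) + phase α a N t θ k =
      -(t * (disp α a ((N : ℝ) + k + 2) - 2 * disp α a ((N : ℝ) + k + 1)
        + disp α a ((N : ℝ) + k))) := by
    simp only [phase]; push_cast; rw [← add_assoc, ← add_assoc]; ring
  rw [e]
  exact ⟨neg_le_neg (mul_le_mul_of_nonneg_left h.2 ht), neg_le_neg (mul_le_mul_of_nonneg_left h.1 ht)⟩

/-- The decay estimate before the inflection point is removed; `d` is the distance that is cut. -/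
lemma kernel_cut (hα₁ : 1 < α) (hα₂ : α ≤ 2) (ha : 0 < a) {N n : ℕ} (hN : 0 < N)
    (hn : n ≤ N) (hM : a * (N + n : ℕ) ≤ Real.pi / 2) {t θ d : ℝ} (hθ : |θ| ≤ Real.pi)
    (ht0 : 0 < t) (ht : t ≤ (N : ℝ) ^ (1 - α) / 12) (hd0 : 0 < d) (hd : d ≤ N) :
    ‖∑ k ∈ Finset.range n, Complex.exp (phase α a N t θ k * Complex.I)‖ ≤
      36 * (1 / Real.sqrt (t * (inflConst α * (N : ℝ) ^ (α - 3) * d)) + 1) + (2 * d + 2) := by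
  have hN' : (0 : ℝ) < N := by exact_mod_cast hN
  have hc := inflConst_pos hα₁
  have hnN : (n : ℝ) ≤ N := by exact_mod_cast hn
  have hM' := hM
  push_cast at hM'
  set m := t * (inflConst α * (N : ℝ) ^ (α - 3) * d) with hm
  have hm0 : 0 < m := by positivity
  set k₀ := inflAngle α / a with hk₀
  have hmono : ∀ j k : ℕ, j ≤ k → k < n → (N : ℝ) + j ≤ N + k := fun j k h _ => by
    have : (j : ℝ) ≤ k := by exact_mod_cast h
    linarith
  -- The second difference at k involves the derivative on [k, k+2], while the threshold controls
  -- only k+1; the extra -1 keeps k+2 at distance d from the inflection point.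
  obtain ⟨p, hpn, hp1, hp2⟩ := exists_threshold n (fun i => (N : ℝ) + i) hmono (k₀ - d - 1)
  obtain ⟨q, hqn, hq1, hq2⟩ := exists_threshold n (fun i => (N : ℝ) + i) hmono (k₀ + d)
  have hpq : p ≤ q := by
    by_contra! h
    have := hp1 q h
    have := hq2 q le_rfl (by omega)
    linarith
  have habs : |t| ≤ (N : ℝ) ^ (1 - α) / 12 := by rwa [abs_of_pos ht0]
  have s1 : ‖∑ k ∈ Finset.range p, Complex.exp (phase α a N t θ k * Complex.I)‖ ≤
      18 * (1 / Real.sqrt m + 1) := by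
    refine van_der_corput hm0 p _ (fun k hk => ?_) (Or.inr fun k hk => ?_)
    · exact phase_first_difference hα₁ hα₂ ha hN hn hM hθ habs (by omega)
    · have hkn : (k : ℝ) + 2 ≤ n := by exact_mod_cast (show k + 2 ≤ n by omega)
      have hp := hp1 (k + 1) hk
      push_cast at hp
      have hl : ∀ y ∈ Icc ((N : ℝ) + k) (N + k + 2),
          inflConst α * (N : ℝ) ^ (α - 3) * d ≤ disp'' α a y := by
        intro y hy
        have hk0 : (0 : ℝ) ≤ k := by positivity
        refine le_disp'' hα₁ hα₂ ha hN' hd0.le hd (by linarith [hy.1]) (by linarith [hy.2]) ?_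
          (by linarith [hy.2])
        exact le_trans (mul_le_mul_of_nonneg_left (by linarith [hy.2]) ha.le) hM'
      -- `phase_second_difference` wants a two-sided bound. Continuity supplies the other side,
      -- whose value does not enter the estimate.
      have hu : ContinuousOn (disp'' α a) (Icc ((N : ℝ) + k) (N + k + 2)) := by
        intro y hy
        have hk0 : (0 : ℝ) ≤ k := by positivity
        have hy0 : 0 < y := by linarith [hy.1]
        have hy1 : a * y ≤ Real.pi / 2 :=
          le_trans (mul_le_mul_of_nonneg_left (by linarith [hy.2]) ha.le) hM'
        have hS := sin_div_pos ha hy0 hy1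
        refine ContinuousAt.continuousWithinAt ?_
        unfold disp''
        have h1 : ContinuousAt (fun ξ => (Real.sin (a * ξ) / a) ^ (α - 2)) y :=
          ContinuousAt.rpow_const (by fun_prop) (Or.inl hS.ne')
        fun_prop
      obtain ⟨B, hB⟩ := isCompact_Icc.exists_bound_of_continuousOn hu
      exact (phase_second_difference ha hN hM ht0.le (by omega)
        fun y hy => ⟨hl y hy, (abs_le.1 (hB y hy)).2⟩).2
  have s3 : ‖∑ k ∈ Finset.Ico q n, Complex.exp (phase α a N t θ k * Complex.I)‖ ≤
      18 * (1 / Real.sqrt m + 1) := by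
    rw [Finset.sum_Ico_eq_sum_range]
    refine van_der_corput hm0 (n - q) _ (fun k hk => ?_) (Or.inl fun k hk => ?_)
    · exact phase_first_difference hα₁ hα₂ ha hN hn hM hθ habs (k := q + k) (by omega)
    · have hkn : ((q + k : ℕ) : ℝ) + 2 ≤ n := by exact_mod_cast (show q + k + 2 ≤ n by omega)
      have hq := hq2 (q + k) (by omega) (by omega)
      have hu : ∀ y ∈ Icc ((N : ℝ) + (q + k : ℕ)) (N + (q + k : ℕ) + 2),
          disp'' α a y ≤ -(inflConst α * (N : ℝ) ^ (α - 3) * d) := by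
        intro y hy
        have hk0 : (0 : ℝ) ≤ (q + k : ℕ) := by positivity
        refine disp''_le hα₁ hα₂ ha hN' hd0.le hd (by linarith [hy.1]) (by linarith [hy.2]) ?_
          (by linarith [hy.1])
        exact le_trans (mul_le_mul_of_nonneg_left (by linarith [hy.2]) ha.le) hM'
      have hl : ContinuousOn (disp'' α a) (Icc ((N : ℝ) + (q + k : ℕ)) (N + (q + k : ℕ) + 2)) := by
        intro y hy
        have hk0 : (0 : ℝ) ≤ (q + k : ℕ) := by positivity
        have hy0 : 0 < y := by linarith [hy.1]
        have hy1 : a * y ≤ Real.pi / 2 :=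
          le_trans (mul_le_mul_of_nonneg_left (by linarith [hy.2]) ha.le) hM'
        have hS := sin_div_pos ha hy0 hy1
        refine ContinuousAt.continuousWithinAt ?_
        unfold disp''
        have h1 : ContinuousAt (fun ξ => (Real.sin (a * ξ) / a) ^ (α - 2)) y :=
          ContinuousAt.rpow_const (by fun_prop) (Or.inl hS.ne')
        fun_prop
      obtain ⟨B, hB⟩ := isCompact_Icc.exists_bound_of_continuousOn hl
      have := (phase_second_difference (θ := θ) ha hN hM ht0.le (k := q + k) (by omega)
        fun y hy => ⟨(abs_le.1 (hB y hy)).1, hu y hy⟩).1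
      rw [mul_neg, neg_neg] at this
      exact this
  have s2 : ‖∑ k ∈ Finset.Ico p q, Complex.exp (phase α a N t θ k * Complex.I)‖ ≤ 2 * d + 2 := by
    have hb : ‖∑ k ∈ Finset.Ico p q, Complex.exp (phase α a N t θ k * Complex.I)‖ ≤
        ((q - p : ℕ) : ℝ) := by
      refine (norm_sum_le _ _).trans ?_
      simp [Complex.norm_exp_ofReal_mul_I]
    refine hb.trans ?_
    rcases hpq.lt_or_eq with h | h
    · have g1 := hp2 p le_rfl (by omega)
      have g2 := hq1 (q - 1) (by omega)
      rw [Nat.cast_sub (by omega)] at g2 ⊢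
      push_cast at g2
      linarith
    · rw [h]; simp; positivity
  have hsplit : ∑ k ∈ Finset.range n, Complex.exp (phase α a N t θ k * Complex.I) =
      ∑ k ∈ Finset.range p, Complex.exp (phase α a N t θ k * Complex.I) +
      ∑ k ∈ Finset.Ico p q, Complex.exp (phase α a N t θ k * Complex.I) +
      ∑ k ∈ Finset.Ico q n, Complex.exp (phase α a N t θ k * Complex.I) := by
    rw [Finset.sum_range_add_sum_Ico _ hpq, Finset.sum_range_add_sum_Ico _ hqn]
  rw [hsplit]
  refine (norm_add₃_le).trans ?_
  linarith

/-- The constant of the dispersive estimate. -/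
def dispConst (α : ℝ) : ℝ := (36 / Real.sqrt (inflConst α) + 41) ^ 3 + 1

lemma dispConst_pos (α : ℝ) : 0 < dispConst α := by
  unfold dispConst
  positivity

/-- Cutting at d = R = (N^{3-α}/t)^{1/3} balances the number 2d of discarded terms with the van der
Corput bound (t N^{α-3} d)^{-1/2}. If R ≥ N, counting terms suffices. The slack a in the hypothesis
admits one index more than `kernel_cut` allows, since the frequency -M belongs to the lattice. -/
lemma kernel_pos (hα₁ : 1 < α) (hα₂ : α ≤ 2) (ha : 0 < a) {N n : ℕ} (hN : 0 < N)
    (hn : n ≤ N) (hM : a * (N + n : ℕ) ≤ Real.pi / 2 + a) {t θ : ℝ} (hθ : |θ| ≤ Real.pi)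
    (ht0 : 0 < t) (ht : t ≤ (N : ℝ) ^ (1 - α) / 12) :
    ‖∑ k ∈ Finset.range n, Complex.exp (phase α a N t θ k * Complex.I)‖ ^ 3 * t ≤
      (36 / Real.sqrt (inflConst α) + 41) ^ 3 * (N : ℝ) ^ (3 - α) := by
  have hN' : (0 : ℝ) < N := by exact_mod_cast hN
  have hN1 : (1 : ℝ) ≤ N := by exact_mod_cast hN
  have hc := inflConst_pos hα₁
  have hnN : (n : ℝ) ≤ N := by exact_mod_cast hn
  set R := ((N : ℝ) ^ (3 - α) / t) ^ (1 / 3 : ℝ) with hR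
  have hX : 0 < (N : ℝ) ^ (3 - α) / t := by positivity
  have hR0 : 0 < R := Real.rpow_pos_of_pos hX _
  have hR3 : R ^ 3 = (N : ℝ) ^ (3 - α) / t := by
    rw [hR, ← Real.rpow_natCast, ← Real.rpow_mul hX.le]; norm_num
  set c₁ := 36 / Real.sqrt (inflConst α) with hc₁
  have hc₁0 : 0 < c₁ := by positivity
  suffices h : ‖∑ k ∈ Finset.range n, Complex.exp (phase α a N t θ k * Complex.I)‖ ≤
      (c₁ + 41) * R by
    calc _ ≤ ((c₁ + 41) * R) ^ 3 * t := by gcongr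
      _ = _ := by rw [mul_pow, hR3]; field_simp
  have htriv : ∀ s : Finset ℕ,
      ‖∑ k ∈ s, Complex.exp (phase α a N t θ k * Complex.I)‖ ≤ s.card := by
    intro s
    refine (norm_sum_le _ _).trans ?_
    simp [Complex.norm_exp_ofReal_mul_I]
  have hR1 : 1 ≤ R := by
    refine Real.one_le_rpow ?_ (by norm_num)
    rw [one_le_div ht0]
    refine ht.trans ?_
    have : (N : ℝ) ^ (1 - α) ≤ (N : ℝ) ^ (3 - α) :=
      Real.rpow_le_rpow_of_exponent_le hN1 (by linarith)
    have : 0 < (N : ℝ) ^ (3 - α) := by positivity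
    linarith
  rcases le_total (N : ℝ) R with h | h
  · have := htriv (Finset.range n)
    rw [Finset.card_range] at this
    nlinarith
  · rcases Nat.eq_zero_or_pos n with rfl | hn0
    · simp; positivity
    -- The last term is split off and bounded by 1. As R ≥ 1, the additive constants 36 + 2 + 1 and
    -- the term 2R are absorbed in 41R.
    obtain ⟨n, rfl⟩ : ∃ n', n = n' + 1 := ⟨n - 1, by omega⟩
    have hcut := kernel_cut hα₁ hα₂ ha hN (n := n) (by omega) (by push_cast at hM ⊢; linarith)
      hθ ht0 ht hR0 h
    have e : t * (inflConst α * (N : ℝ) ^ (α - 3) * R) = inflConst α / R ^ 2 := by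
      have h3 : (N : ℝ) ^ (α - 3) * (N : ℝ) ^ (3 - α) = 1 := by
        rw [← Real.rpow_add hN']; simp
      have h4 : R ^ 3 * t = (N : ℝ) ^ (3 - α) := by rw [hR3]; field_simp
      rw [eq_div_iff (by positivity)]
      linear_combination (inflConst α * (N : ℝ) ^ (α - 3)) * h4 + inflConst α * h3
    rw [e, Real.sqrt_div' _ (by positivity), Real.sqrt_sq hR0.le] at hcut
    rw [Finset.sum_range_succ]
    refine (norm_add_le _ _).trans ?_
    rw [Complex.norm_exp_ofReal_mul_I]
    have e2 : 36 * (1 / (Real.sqrt (inflConst α) / R) + 1) = c₁ * R + 36 := by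
      rw [hc₁]; field_simp
    rw [e2] at hcut
    nlinarith

/-- The **dispersive estimate** on a dyadic block, uniform in the mesh size. -/
lemma dispersive_estimate (hα₁ : 1 < α) (hα₂ : α ≤ 2) (ha : 0 < a) {N n : ℕ} (hN : 0 < N)
    (hn : n ≤ N) (hM : a * (N + n : ℕ) ≤ Real.pi / 2 + a) {t : ℝ} (θ : ℝ)
    (ht : |t| ≤ (N : ℝ) ^ (1 - α) / 12) :
    ‖∑ k ∈ Finset.range n, Complex.exp (phase α a N t θ k * Complex.I)‖ ^ 3 ≤
      dispConst α * (N : ℝ) ^ (3 - α) / (|t| + (N : ℝ) ^ (-α)) := by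
  have hN' : (0 : ℝ) < N := by exact_mod_cast hN
  have hnN : (n : ℝ) ≤ N := by exact_mod_cast hn
  rw [le_div_iff₀ (by positivity), mul_add]
  -- Counting terms gives N³, which accounts for the regularisation N^{-α} of the singularity at t =
  -- 0.
  have h2 : ‖∑ k ∈ Finset.range n, Complex.exp (phase α a N t θ k * Complex.I)‖ ^ 3
      * (N : ℝ) ^ (-α) ≤ (N : ℝ) ^ (3 - α) := by
    have h3 : ‖∑ k ∈ Finset.range n, Complex.exp (phase α a N t θ k * Complex.I)‖ ≤ N := by
      refine ((norm_sum_le _ _).trans ?_).trans hnN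
      simp [Complex.norm_exp_ofReal_mul_I]
    calc _ ≤ (N : ℝ) ^ 3 * (N : ℝ) ^ (-α) := by gcongr
      _ = _ := by
        rw [← Real.rpow_natCast, ← Real.rpow_add hN']; congr 1
  have h1 : ‖∑ k ∈ Finset.range n, Complex.exp (phase α a N t θ k * Complex.I)‖ ^ 3 * |t| ≤
      (36 / Real.sqrt (inflConst α) + 41) ^ 3 * (N : ℝ) ^ (3 - α) := by
    -- The frequencies are integers, so θ matters only modulo 2π. Negative times are then treated by
    -- conjugation.
    have red : ∀ (s θ : ℝ), ∃ θ' : ℝ, |θ'| ≤ Real.pi ∧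
        ‖∑ k ∈ Finset.range n, Complex.exp (phase α a N s θ k * Complex.I)‖ =
        ‖∑ k ∈ Finset.range n, Complex.exp (phase α a N s θ' k * Complex.I)‖ := by
      intro s θ
      have hpi := Real.pi_pos
      refine ⟨θ - round (θ / (2 * Real.pi)) * (2 * Real.pi), ?_, ?_⟩
      · have := abs_sub_round (θ / (2 * Real.pi))
        have e : θ - round (θ / (2 * Real.pi)) * (2 * Real.pi) =
            (θ / (2 * Real.pi) - round (θ / (2 * Real.pi))) * (2 * Real.pi) := by
          field_simp
        rw [e, abs_mul, abs_of_pos (by linarith : 0 < 2 * Real.pi)]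
        nlinarith
      · congr 1
        refine Finset.sum_congr rfl fun k _ => ?_
        generalize round (θ / (2 * Real.pi)) = m
        have e : (phase α a N s θ k : ℂ) * Complex.I =
            (phase α a N s (θ - m * (2 * Real.pi)) k : ℂ) * Complex.I +
            (((N + k : ℕ) * m : ℤ) : ℂ) * (2 * Real.pi * Complex.I) := by
          simp only [phase]; push_cast; ring
        rw [e, Complex.exp_add, Complex.exp_int_mul_two_pi_mul_I, mul_one]
    rcases lt_trichotomy t 0 with h | h | h
    · obtain ⟨θ', hθ', e⟩ := red (-t) (-θ)
      have := kernel_pos hα₁ hα₂ ha hN hn hM hθ' (neg_pos.2 h) (by rwa [abs_of_neg h] at ht)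
      rw [abs_of_neg h]
      rw [← e] at this
      convert this using 3
      rw [← norm_sum_exp_neg]
      congr 1
      refine Finset.sum_congr rfl fun k _ => ?_
      simp only [phase]
      congr 3
      ring
    · rw [h]; simp; positivity
    · obtain ⟨θ', hθ', e⟩ := red t θ
      rw [abs_of_pos h, e]
      exact kernel_pos hα₁ hα₂ ha hN hn hM hθ' h (by rwa [abs_of_pos h] at ht)
  rw [dispConst, add_mul, one_mul]
  linarith

end FDNLS
end

/-! ### The TT* argument -/

noncomputable section
set_option linter.unusedSectionVars false
namespace FDNLS
open Set MeasureTheory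

lemma intervalIntegral_swap {f : ℝ → ℝ → ℝ} (hf : Continuous (Function.uncurry f)) {a b c d : ℝ}
    (hcd : c ≤ d) :
    ∫ x in a..b, ∫ y in c..d, f x y = ∫ y in c..d, ∫ x in a..b, f x y := by
  simp only [intervalIntegral.integral_of_le hcd]
  refine intervalIntegral_integral_swap ?_
  rw [Measure.prod_restrict]
  refine ((hf.continuousOn (s := uIcc a b ×ˢ Icc c d)).integrableOn_compact
    (isCompact_uIcc.prod isCompact_Icc)).mono_set ?_
  exact prod_mono uIoc_subset_uIcc Ioc_subset_Icc_self

/-- This is x²y ≤ (2x³ + y³)/3 with x = s/r and y = r²κ, multiplied by s³. It is a pointwise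
substitute for Young's convolution inequality with a kernel in L³; the free parameter r will make
the first term absorbable. -/
lemma am_gm_kernel {r s κ : ℝ} (hr : 0 < r) (hs : 0 ≤ s) (hκ : 0 ≤ κ) :
    s ^ 5 * κ ≤ 2 / (3 * r ^ 3) * s ^ 6 + (r ^ 3) ^ 2 / 3 * (s ^ 3 * κ ^ 3) := by
  set x := s / r with hx
  set y := r ^ 2 * κ with hy
  have hx0 : 0 ≤ x := by positivity
  have hy0 : 0 ≤ y := by positivity
  have h : 3 * (x ^ 2 * y) ≤ 2 * x ^ 3 + y ^ 3 := by
    nlinarith [mul_nonneg (sq_nonneg (x - y)) (by linarith : 0 ≤ 2 * x + y)]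
  have e1 : x ^ 2 * y = s ^ 2 * κ := by rw [hx, hy]; field_simp
  have e2 : x ^ 3 = s ^ 3 / r ^ 3 := by rw [hx, div_pow]
  have e3 : y ^ 3 = (r ^ 3) ^ 2 * κ ^ 3 := by rw [hy]; ring
  rw [e1, e2, e3] at h
  have h3 : 0 ≤ s ^ 3 := by positivity
  have := mul_le_mul_of_nonneg_left h h3
  have e4 : s ^ 3 * (2 * (s ^ 3 / r ^ 3) + (r ^ 3) ^ 2 * κ ^ 3) =
      3 * (2 / (3 * r ^ 3) * s ^ 6 + (r ^ 3) ^ 2 / 3 * (s ^ 3 * κ ^ 3)) := by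
    field_simp
  nlinarith

variable {K X : Type*} [Fintype K] [Fintype X] [Nonempty X]

/-- Measurable weights that single out the points where a function of `x` is maximal. -/
lemma exists_max_weights (F : ℝ → X → ℂ) (hF : Continuous F) :
    ∃ p : ℝ → X → ℝ, (∀ x, Measurable fun t => p t x) ∧ (∀ t x, 0 ≤ p t x) ∧
      (∀ t, ∑ x, p t x = 1) ∧ ∀ t x, p t x ≠ 0 → ‖F t x‖ = ‖F t‖ := by
  classical
  let q : ℝ → X → ℝ := fun t x => if ‖F t‖ ≤ ‖F t x‖ then 1 else 0
  have hq0 : ∀ t x, 0 ≤ q t x := fun t x => by simp only [q]; split_ifs <;> norm_num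
  have hqm : ∀ x, Measurable fun t => q t x := by
    intro x
    have hx : Continuous fun t => F t x := (continuous_apply x).comp hF
    exact Measurable.ite (measurableSet_le hF.norm.measurable hx.norm.measurable)
      measurable_const measurable_const
  have hn : ∀ t, 0 < ∑ x, q t x := by
    intro t
    obtain ⟨x, hx⟩ := Finite.exists_max fun x => ‖F t x‖
    have h1 : ‖F t‖ ≤ ‖F t x‖ := (pi_norm_le_iff_of_nonempty _).2 hx
    have h2 : q t x = 1 := if_pos h1
    have := Finset.single_le_sum (f := q t) (fun i _ => hq0 t i) (Finset.mem_univ x)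
    linarith
  refine ⟨fun t x => q t x / ∑ y, q t y, fun x => ?_, fun t x => ?_, fun t => ?_, fun t x h => ?_⟩
  · exact (hqm x).div (Finset.measurable_fun_sum _ fun y _ => hqm y)
  · exact div_nonneg (hq0 t x) (hn t).le
  · rw [← Finset.sum_div, div_self (hn t).ne']
  · refine le_antisymm (norm_le_pi_norm _ x) ?_
    by_contra h'
    exact h (by simp only [q, if_neg h', zero_div])

lemma norm_sum_sum_le {w : X → ℂ} {w' : X → ℂ} {A : X → X → ℂ} {κ : ℝ}
    (hA : ∀ x x', ‖A x x'‖ ≤ κ) :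
    ‖∑ x, ∑ x', w x * w' x' * A x x'‖ ≤ (∑ x, ‖w x‖) * (∑ x, ‖w' x‖) * κ := by
  calc _ ≤ ∑ x, ∑ x', ‖w x‖ * ‖w' x'‖ * κ := by
        refine (norm_sum_le _ _).trans (Finset.sum_le_sum fun x _ => ?_)
        refine (norm_sum_le _ _).trans (Finset.sum_le_sum fun x' _ => ?_)
        rw [norm_mul, norm_mul]
        exact mul_le_mul_of_nonneg_left (hA x x') (by positivity)
    _ = _ := by
        rw [Finset.sum_mul_sum]
        simp only [Finset.sum_mul]

/-- The `TT*` argument for `L⁶_t L^∞_x`. -/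
lemma tt_star {a b Q : ℝ} (hab : a ≤ b) (E : ℝ → K → X → ℂ)
    (hE : ∀ k x, Continuous fun t => E t k x) (hE1 : ∀ t k x, ‖E t k x‖ ≤ 1) (c : K → ℂ)
    (κ : ℝ → ℝ) (hκ : Continuous κ) (hκ0 : ∀ t, 0 ≤ κ t) (hκs : ∀ t, κ (-t) = κ t)
    (hker : ∀ t ∈ Icc a b, ∀ t' ∈ Icc a b, ∀ x x',
      ‖∑ k, E t k x * (starRingEnd ℂ) (E t' k x')‖ ≤ κ (t - t'))
    (hQ : ∀ t ∈ Icc a b, ∫ t' in a..b, κ (t - t') ^ 3 ≤ Q) :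
    ∫ t in a..b, ‖fun x => ∑ k, c k * E t k x‖ ^ 6 ≤ (∑ k, ‖c k‖ ^ 2) ^ 3 * Q := by
  set F : ℝ → X → ℂ := fun t x => ∑ k, c k * E t k x with hFdef
  have hF : Continuous F := continuous_pi fun x =>
    continuous_finsetSum _ fun k _ => continuous_const.mul (hE k x)
  set v : ℝ → ℝ := fun t => ‖F t‖ with hv
  have hvc : Continuous v := hF.norm
  have hv0 : ∀ t, 0 ≤ v t := fun t => norm_nonneg _
  set A := ∫ t in a..b, v t ^ 6 with hA
  change A ≤ _
  set m := ∑ k, ‖c k‖ ^ 2 with hm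
  have hm0 : 0 ≤ m := Finset.sum_nonneg fun k _ => by positivity
  have hA0 : 0 ≤ A := intervalIntegral.integral_nonneg hab fun t _ => by positivity
  have hQ0 : 0 ≤ Q := (intervalIntegral.integral_nonneg hab fun t _ => by
    have := hκ0 (a - t); positivity).trans (hQ a (left_mem_Icc.2 hab))
  rcases hm0.eq_or_lt with hm1 | hm1
  · have hc : ∀ k, c k = 0 := fun k => by
      have := (Finset.sum_eq_zero_iff_of_nonneg (fun k _ => by positivity)).1 hm1.symm k
        (Finset.mem_univ k)
      simpa using this
    have : ∀ t, v t = 0 := fun t => by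
      have : F t = 0 := by funext x; simp [hFdef, hc]
      simp [hv, this]
    have hA1 : A = 0 := by simp [hA, this]
    rw [hA1]; positivity
  obtain ⟨p, hpm, hp0, hp1, hpF⟩ := exists_max_weights F hF
  have hFx : ∀ x, Continuous fun t => F t x := fun x => (continuous_apply x).comp hF
  -- the dual function
  set g : ℝ → X → ℂ := fun t x => (p t x : ℂ) * ((v t : ℂ) ^ 4 * (starRingEnd ℂ) (F t x)) with hg
  have hgn : ∀ t, ∑ x, ‖g t x‖ = v t ^ 5 := by
    intro t
    have : ∀ x, ‖g t x‖ = p t x * v t ^ 5 := by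
      intro x
      simp only [hg, norm_mul, norm_pow, Complex.norm_real, Real.norm_eq_abs, RCLike.norm_conj,
        abs_of_nonneg (hp0 t x), abs_of_nonneg (hv0 t)]
      by_cases h : p t x = 0
      · simp [h]
      · rw [hpF t x h]; simp only [hv]; ring
    simp only [this, ← Finset.sum_mul, hp1, one_mul]
  have hgF : ∀ t, ∑ x, g t x * F t x = ((v t ^ 6 : ℝ) : ℂ) := by
    intro t
    have : ∀ x, g t x * F t x = ((p t x * v t ^ 6 : ℝ) : ℂ) := by
      intro x
      have e : (starRingEnd ℂ) (F t x) * F t x = ((‖F t x‖ ^ 2 : ℝ) : ℂ) := by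
        rw [mul_comm, Complex.mul_conj, Complex.normSq_eq_norm_sq]
      simp only [hg]
      rw [mul_assoc, mul_assoc, e]
      by_cases h : p t x = 0
      · simp [h]
      · rw [hpF t x h]; simp only [hv]; push_cast; ring
    simp only [this]
    rw [← Complex.ofReal_sum, ← Finset.sum_mul, hp1, one_mul]
  set γ : K → ℝ → ℂ := fun k t => ∑ x, g t x * E t k x with hγ
  have hγb : ∀ k t, ‖γ k t‖ ≤ v t ^ 5 := by
    intro k t
    rw [← hgn]
    refine (norm_sum_le _ _).trans (Finset.sum_le_sum fun x _ => ?_)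
    rw [norm_mul]
    exact mul_le_of_le_one_right (norm_nonneg _) (hE1 t k x)
  have hγm : ∀ k, Measurable (γ k) := by
    intro k
    refine Finset.measurable_fun_sum _ fun x _ => ?_
    refine Measurable.mul ?_ (hE k x).measurable
    refine (Complex.measurable_ofReal.comp (hpm x)).mul ?_
    refine Measurable.mul ?_ ?_
    · exact ((Complex.continuous_ofReal.comp hvc).pow 4).measurable
    · exact (Complex.continuous_conj.comp (hFx x)).measurable
  have hγi : ∀ k s t, IntervalIntegrable (γ k) volume s t := fun k s t =>
    ((hvc.pow 5).intervalIntegrable s t).mono_fun (hγm k).aestronglyMeasurable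
      (Filter.Eventually.of_forall fun τ => by
        change ‖γ k τ‖ ≤ |v τ ^ 5|
        exact (hγb k τ).trans (le_abs_self _))
  set Γ : K → ℂ := fun k => ∫ t in a..b, γ k t with hΓ
  -- Duality: pairing F with the dual function returns A, and the Γ k are the coefficients of the
  -- adjoint. Cauchy–Schwarz gives A² ≤ mD with D = ∑|Γ k|².
  have hAc : (A : ℂ) = ∑ k, c k * Γ k := by
    have h1 : ∀ t, ((v t ^ 6 : ℝ) : ℂ) = ∑ k, c k * γ k t := by
      intro t
      rw [← hgF]
      simp only [hγ, hFdef, Finset.mul_sum]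
      rw [Finset.sum_comm]
      exact Finset.sum_congr rfl fun k _ => Finset.sum_congr rfl fun x _ => by ring
    rw [hA, ← intervalIntegral.integral_ofReal]
    simp only [h1]
    rw [intervalIntegral.integral_finsetSum fun k _ => (hγi k a b).const_mul _]
    exact Finset.sum_congr rfl fun k _ => intervalIntegral.integral_const_mul _ _
  set D := ∑ k, ‖Γ k‖ ^ 2 with hD
  have hAD : A ^ 2 ≤ m * D := by
    have h1 : A ≤ ∑ k, ‖c k‖ * ‖Γ k‖ := by
      have : A = ‖(A : ℂ)‖ := by rw [Complex.norm_real, Real.norm_eq_abs, abs_of_nonneg hA0]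
      rw [this, hAc]
      refine (norm_sum_le _ _).trans (le_of_eq ?_)
      simp only [norm_mul]
    calc A ^ 2 ≤ (∑ k, ‖c k‖ * ‖Γ k‖) ^ 2 := by gcongr
      _ ≤ _ := Finset.sum_mul_sq_le_sq_mul_sq _ _ _
  -- With r³ = m the first term of `am_gm_kernel` contributes exactly (2/3)A² to mD, which the left
  -- side absorbs.
  set r := m ^ (1 / 3 : ℝ) with hr
  have hr0 : 0 < r := Real.rpow_pos_of_pos hm1 _
  have hr3 : r ^ 3 = m := by
    rw [hr, ← Real.rpow_natCast, ← Real.rpow_mul hm0]; norm_num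
  have hpt : ∀ t t', (v t * v t') ^ 5 * κ (t - t') ≤ 2 / (3 * m) * (v t ^ 6 * v t' ^ 6) +
      m ^ 2 / 6 * (v t ^ 6 * κ (t - t') ^ 3 + v t' ^ 6 * κ (t - t') ^ 3) := by
    intro t t'
    have h1 := am_gm_kernel hr0 (mul_nonneg (hv0 t) (hv0 t')) (hκ0 (t - t'))
    rw [hr3] at h1
    have h2 : (v t * v t') ^ 3 ≤ (v t ^ 6 + v t' ^ 6) / 2 := by
      nlinarith [sq_nonneg (v t ^ 3 - v t' ^ 3)]
    have h3 : 0 ≤ m ^ 2 / 3 * κ (t - t') ^ 3 := by have := hκ0 (t - t'); positivity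
    have h4 := mul_le_mul_of_nonneg_left h2 h3
    calc _ ≤ _ := h1
      _ ≤ _ := by rw [mul_pow]; linarith
  have hv6 : Continuous fun t => v t ^ 6 := hvc.pow 6
  have hκu : Continuous (Function.uncurry fun t t' => v t' ^ 6 * κ (t - t') ^ 3) := by
    simp only [Function.uncurry_def]; fun_prop
  set J : ℝ → ℝ := fun t => ∫ t' in a..b, v t' ^ 6 * κ (t - t') ^ 3 with hJ
  have hJc : Continuous J :=
    intervalIntegral.continuous_parametric_intervalIntegral_of_continuous' hκu a b
  have hJle : ∫ t in a..b, J t ≤ A * Q := by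
    rw [hJ, intervalIntegral_swap hκu hab]
    have h1 : ∀ t' ∈ Icc a b, ∫ t in a..b, v t' ^ 6 * κ (t - t') ^ 3 ≤ v t' ^ 6 * Q := by
      intro t' ht'
      rw [intervalIntegral.integral_const_mul]
      refine mul_le_mul_of_nonneg_left ?_ (by positivity)
      refine le_of_eq_of_le ?_ (hQ t' ht')
      refine intervalIntegral.integral_congr fun t _ => ?_
      rw [← hκs, neg_sub]
    refine (intervalIntegral.integral_mono_on hab ?_ ?_ h1).trans ?_
    · have : Continuous (Function.uncurry fun t' t => v t' ^ 6 * κ (t - t') ^ 3) := by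
        simp only [Function.uncurry_def]; fun_prop
      exact (intervalIntegral.continuous_parametric_intervalIntegral_of_continuous' this a
        b).intervalIntegrable _ _
    · exact (hv6.mul continuous_const).intervalIntegrable _ _
    · rw [intervalIntegral.integral_mul_const]
  have hinner : ∀ t ∈ Icc a b, ‖∑ k, γ k t * (starRingEnd ℂ) (Γ k)‖ ≤
      2 / (3 * m) * (v t ^ 6 * A) + m ^ 2 / 6 * (v t ^ 6 * Q + J t) := by
    intro t ht
    have hconj : ∀ k, IntervalIntegrable (fun t' => (starRingEnd ℂ) (γ k t')) volume a b := by
      intro k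
      exact ((hvc.pow 5).intervalIntegrable a b).mono_fun
        (Complex.continuous_conj.measurable.comp (hγm k)).aestronglyMeasurable
        (Filter.Eventually.of_forall fun τ => by
          change ‖(starRingEnd ℂ) (γ k τ)‖ ≤ |v τ ^ 5|
          rw [RCLike.norm_conj]
          exact (hγb k τ).trans (le_abs_self _))
    have e : ∑ k, γ k t * (starRingEnd ℂ) (Γ k) =
        ∫ t' in a..b, ∑ k, γ k t * (starRingEnd ℂ) (γ k t') := by
      rw [intervalIntegral.integral_finsetSum fun k _ => (hconj k).const_mul _]
      refine Finset.sum_congr rfl fun k _ => ?_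
      rw [intervalIntegral.integral_const_mul, hΓ]
      congr 1
      simp only [intervalIntegral.integral_of_le hab]
      exact integral_conj.symm
    rw [e]
    have hb : ∀ t' ∈ Icc a b, ‖∑ k, γ k t * (starRingEnd ℂ) (γ k t')‖ ≤
        2 / (3 * m) * (v t ^ 6 * v t' ^ 6) +
        m ^ 2 / 6 * (v t ^ 6 * κ (t - t') ^ 3 + v t' ^ 6 * κ (t - t') ^ 3) := by
      intro t' ht'
      refine le_trans ?_ (hpt t t')
      -- Expanding the product brings out the kernel of TT*, bounded by κ(t - t'), tested against
      -- functions of x with ℓ¹ norms v(t)⁵ and v(t')⁵.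
      have e2 : ∑ k, γ k t * (starRingEnd ℂ) (γ k t') =
          ∑ x, ∑ x', g t x * (starRingEnd ℂ) (g t' x') *
            ∑ k, E t k x * (starRingEnd ℂ) (E t' k x') := by
        simp only [hγ, map_sum, map_mul]
        simp only [Finset.sum_mul_sum]
        simp only [Finset.mul_sum]
        rw [Finset.sum_comm]
        refine Finset.sum_congr rfl fun x _ => ?_
        rw [Finset.sum_comm]
        exact Finset.sum_congr rfl fun x' _ => Finset.sum_congr rfl fun k _ => by ring
      rw [e2]
      refine (norm_sum_sum_le (hker t ht t' ht')).trans (le_of_eq ?_)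
      simp only [RCLike.norm_conj, hgn]
      ring
    have hci : Continuous fun t' => 2 / (3 * m) * (v t ^ 6 * v t' ^ 6) +
        m ^ 2 / 6 * (v t ^ 6 * κ (t - t') ^ 3 + v t' ^ 6 * κ (t - t') ^ 3) := by fun_prop
    refine (intervalIntegral.norm_integral_le_of_norm_le hab
      (Filter.Eventually.of_forall fun t' ht' => hb t' (Ioc_subset_Icc_self ht'))
      (hci.intervalIntegrable _ _)).trans ?_
    rw [intervalIntegral.integral_add ((by fun_prop : Continuous fun t' =>
        2 / (3 * m) * (v t ^ 6 * v t' ^ 6)).intervalIntegrable _ _)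
      ((by fun_prop : Continuous fun t' => m ^ 2 / 6 * (v t ^ 6 * κ (t - t') ^ 3 +
        v t' ^ 6 * κ (t - t') ^ 3)).intervalIntegrable _ _),
      intervalIntegral.integral_const_mul, intervalIntegral.integral_const_mul,
      intervalIntegral.integral_const_mul,
      intervalIntegral.integral_add ((by fun_prop : Continuous fun t' =>
        v t ^ 6 * κ (t - t') ^ 3).intervalIntegrable _ _)
      ((by fun_prop : Continuous fun t' => v t' ^ 6 * κ (t - t') ^ 3).intervalIntegrable _ _),
      intervalIntegral.integral_const_mul]
    have := mul_le_mul_of_nonneg_left (hQ t ht) (by positivity : 0 ≤ v t ^ 6)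
    gcongr
  have hDle : D ≤ 2 / (3 * m) * (A * A) + m ^ 2 / 6 * (A * Q + A * Q) := by
    have e : (D : ℂ) = ∫ t in a..b, ∑ k, γ k t * (starRingEnd ℂ) (Γ k) := by
      rw [intervalIntegral.integral_finsetSum fun k _ => (hγi k a b).mul_const _, hD]
      push_cast
      refine Finset.sum_congr rfl fun k _ => ?_
      rw [intervalIntegral.integral_mul_const, Complex.mul_conj, Complex.normSq_eq_norm_sq]
      push_cast; rfl
    have hD0 : 0 ≤ D := Finset.sum_nonneg fun k _ => by positivity
    have : D = ‖(D : ℂ)‖ := by rw [Complex.norm_real, Real.norm_eq_abs, abs_of_nonneg hD0]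
    rw [this, e]
    refine (intervalIntegral.norm_integral_le_of_norm_le hab
      (Filter.Eventually.of_forall fun t ht => hinner t (Ioc_subset_Icc_self ht))
      ((by fun_prop : Continuous fun t => 2 / (3 * m) * (v t ^ 6 * A) +
        m ^ 2 / 6 * (v t ^ 6 * Q + J t)).intervalIntegrable _ _)).trans ?_
    rw [intervalIntegral.integral_add ((by fun_prop : Continuous fun t =>
        2 / (3 * m) * (v t ^ 6 * A)).intervalIntegrable _ _)
      ((by fun_prop : Continuous fun t => m ^ 2 / 6 * (v t ^ 6 * Q + J t)).intervalIntegrable _ _),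
      intervalIntegral.integral_const_mul, intervalIntegral.integral_const_mul,
      intervalIntegral.integral_mul_const,
      intervalIntegral.integral_add ((by fun_prop : Continuous fun t =>
        v t ^ 6 * Q).intervalIntegrable _ _) (hJc.intervalIntegrable _ _),
      intervalIntegral.integral_mul_const]
    gcongr
  rcases hA0.eq_or_lt with h0 | h0
  · rw [← h0]; positivity
  have hfin := hAD.trans (mul_le_mul_of_nonneg_left hDle hm0)
  have e : m * (2 / (3 * m) * (A * A) + m ^ 2 / 6 * (A * Q + A * Q)) =
      2 / 3 * (A * A) + m ^ 3 / 3 * (A * Q) := by field_simp; ring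
  rw [e] at hfin
  have : A * A ≤ A * (m ^ 3 * Q) := by nlinarith
  exact le_of_mul_le_mul_left this h0

end FDNLS
end

/-! ### Strichartz estimate for one block of frequencies -/

noncomputable section
set_option linter.unusedSectionVars false
namespace FDNLS
open Set MeasureTheory

variable {α : ℝ}

/-- The cubed kernel decays like 1/|t|, which just fails to be integrable at 0; its regularisation
at scale ε costs a logarithm. -/
lemma integral_inv_abs_add_le {a b δ ε t : ℝ} (hε : 0 < ε) (hab : b - a ≤ δ)
    (ht : t ∈ Icc a b) :
    ∫ t' in a..b, 1 / (|t - t'| + ε) ≤ 2 * Real.log ((δ + ε) / ε) := by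
  have hδ : 0 ≤ δ := by linarith [ht.1, ht.2]
  have hc : Continuous fun s : ℝ => 1 / (|s| + ε) :=
    continuous_const.div (by fun_prop) fun s => by positivity
  rw [intervalIntegral.integral_comp_sub_left (fun s => 1 / (|s| + ε))]
  have h1 : ∫ s in (t - b)..(t - a), 1 / (|s| + ε) ≤ ∫ s in (-δ)..δ, 1 / (|s| + ε) := by
    refine intervalIntegral.integral_mono_interval (by linarith [ht.1]) (by linarith [ht.1, ht.2])
      (by linarith [ht.2]) (Filter.Eventually.of_forall fun s => ?_) (hc.intervalIntegrable _ _)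
    simp only [Pi.zero_apply]
    positivity
  refine h1.trans ?_
  have h2 : ∫ s in (0 : ℝ)..δ, 1 / (|s| + ε) = Real.log ((δ + ε) / ε) := by
    have : ∫ s in (0 : ℝ)..δ, 1 / (|s| + ε) = ∫ s in (0 : ℝ)..δ, 1 / (s + ε) := by
      refine intervalIntegral.integral_congr fun s hs => ?_
      rw [uIcc_of_le hδ] at hs
      simp only [abs_of_nonneg hs.1]
    rw [this, intervalIntegral.integral_comp_add_right (fun s => 1 / s), zero_add,
      integral_one_div_of_pos hε (by linarith)]
  have h3 : ∫ s in (-δ)..0, 1 / (|s| + ε) = ∫ s in (0 : ℝ)..δ, 1 / (|s| + ε) := by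
    have := intervalIntegral.integral_comp_neg (a := 0) (b := δ) fun s => 1 / (|s| + ε)
    simp only [abs_neg, neg_zero] at this
    exact this.symm
  rw [← intervalIntegral.integral_add_adjacent_intervals (hc.intervalIntegrable (-δ) 0)
    (hc.intervalIntegrable 0 δ), h3, h2]
  linarith

variable {M : ℕ} [NeZero M]

/-- A plane wave of the linear flow. -/
def wave (α : ℝ) (M : ℕ) (t ξ ω : ℝ) (x : Lattice M) : ℂ :=
  Complex.exp (((ξ * point M x - t * disp α (mesh M / 2) ω : ℝ) : ℂ) * Complex.I)

lemma norm_wave (t ξ ω : ℝ) (x : Lattice M) : ‖wave α M t ξ ω x‖ = 1 :=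
  Complex.norm_exp_ofReal_mul_I _

lemma continuous_wave (ξ ω : ℝ) (x : Lattice M) : Continuous fun t => wave α M t ξ ω x := by
  unfold wave
  fun_prop

/-- TT* with κ³ equal to the dispersive bound. With δ = N^{1-α}/12 and ε = N^{-α} the ratio δ/ε is
N/12, so the logarithm is at most log(N+1). -/
lemma block_strichartz_short (hα₁ : 1 < α) (hα₂ : α ≤ 2) {N n : ℕ} (hN : 0 < N) (hn : n ≤ N)
    (hM : N + n ≤ M + 1) (σ : ℝ) {a b : ℝ} (hab : a ≤ b)
    (hδ : b - a ≤ (N : ℝ) ^ (1 - α) / 12) (c : Fin n → ℂ) :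
    ∫ t in a..b, ‖fun x : Lattice M => ∑ i : Fin n, c i *
        wave α M t (σ * (N + i : ℕ)) (N + i : ℕ) x‖ ^ 6 ≤
      (∑ i, ‖c i‖ ^ 2) ^ 3 * (2 * dispConst α * (N : ℝ) ^ (3 - α) * Real.log (N + 1)) := by
  have hN' : (0 : ℝ) < N := by exact_mod_cast hN
  have hh := mesh_pos M
  have hC := dispConst_pos α
  have hpos : ∀ t : ℝ, 0 < |t| + (N : ℝ) ^ (-α) := fun t => by positivity
  set κ : ℝ → ℝ := fun t =>
    (dispConst α * (N : ℝ) ^ (3 - α) / (|t| + (N : ℝ) ^ (-α))) ^ (1 / 3 : ℝ) with hκ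
  have hb0 : ∀ t, 0 ≤ dispConst α * (N : ℝ) ^ (3 - α) / (|t| + (N : ℝ) ^ (-α)) := fun t => by
    have := hpos t; positivity
  have hκ3 : ∀ t, κ t ^ 3 = dispConst α * (N : ℝ) ^ (3 - α) / (|t| + (N : ℝ) ^ (-α)) := by
    intro t
    simp only [hκ]
    rw [← Real.rpow_natCast, ← Real.rpow_mul (hb0 t)]; norm_num
  refine tt_star hab (fun t (i : Fin n) x => wave α M t (σ * (N + i : ℕ)) (N + i : ℕ) x)
    (fun i x => continuous_wave _ _ x) (fun t i x => (norm_wave _ _ _ x).le) c κ ?_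
    (fun t => Real.rpow_nonneg (hb0 t) _) (fun t => by simp only [hκ, abs_neg]) ?_ ?_
  · refine Continuous.rpow_const ?_ fun _ => Or.inr (by norm_num)
    exact continuous_const.div (by fun_prop) fun t => (hpos t).ne'
  · intro t ht t' ht' x x'
    have hk0 : 0 ≤ κ (t - t') := Real.rpow_nonneg (hb0 _) _
    refine le_of_pow_le_pow_left₀ (n := 3) (by norm_num) hk0 ?_
    rw [hκ3]
    have htt : |t - t'| ≤ (N : ℝ) ^ (1 - α) / 12 := by
      refine le_trans ?_ hδ
      rw [abs_le]; constructor <;> linarith [ht.1, ht.2, ht'.1, ht'.2]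
    have hM' : mesh M / 2 * (N + n : ℕ) ≤ Real.pi / 2 + mesh M / 2 := by
      have : ((N + n : ℕ) : ℝ) ≤ M + 1 := by exact_mod_cast hM
      have h2 := mul_le_mul_of_nonneg_left this (by positivity : 0 ≤ mesh M / 2)
      linarith [mesh_mul M]
    have := dispersive_estimate hα₁ hα₂ (half_pos hh) hN hn hM'
      (σ * (point M x - point M x')) htt
    refine le_of_eq_of_le ?_ this
    congr 2
    rw [Finset.sum_range]
    refine Finset.sum_congr rfl fun i _ => ?_
    simp only [wave, phase]
    rw [← Complex.exp_conj, ← Complex.exp_add]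
    congr 1
    simp only [map_mul, Complex.conj_ofReal, Complex.conj_I]
    push_cast
    ring
  · intro t ht
    simp only [hκ3]
    have e : ∀ t' : ℝ, dispConst α * (N : ℝ) ^ (3 - α) / (|t - t'| + (N : ℝ) ^ (-α)) =
        dispConst α * (N : ℝ) ^ (3 - α) * (1 / (|t - t'| + (N : ℝ) ^ (-α))) := fun t' => by ring
    simp only [e]
    rw [intervalIntegral.integral_const_mul]
    have h1 := integral_inv_abs_add_le (ε := (N : ℝ) ^ (-α)) (by positivity) hδ ht
    have h2 : Real.log (((N : ℝ) ^ (1 - α) / 12 + (N : ℝ) ^ (-α)) / (N : ℝ) ^ (-α)) ≤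
        Real.log (N + 1) := by
      refine Real.log_le_log (by positivity) ?_
      rw [div_le_iff₀ (by positivity), add_mul, one_mul]
      have : (N : ℝ) * (N : ℝ) ^ (-α) = (N : ℝ) ^ (1 - α) := by
        rw [sub_eq_add_neg, Real.rpow_add hN', Real.rpow_one]
      rw [this]
      have : 0 < (N : ℝ) ^ (1 - α) := by positivity
      linarith
    calc _ ≤ dispConst α * (N : ℝ) ^ (3 - α) * (2 * Real.log (N + 1)) := by
          gcongr; linarith
      _ = _ := by ring

lemma block_strichartz (hα₁ : 1 < α) (hα₂ : α ≤ 2) {N n : ℕ} (hN : 0 < N) (hn : n ≤ N)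
    (hM : N + n ≤ M + 1) (σ : ℝ) (c : Fin n → ℂ) :
    ∫ t in (0 : ℝ)..1, ‖fun x : Lattice M => ∑ i : Fin n, c i *
        wave α M t (σ * (N + i : ℕ)) (N + i : ℕ) x‖ ^ 6 ≤
      26 * dispConst α * ((N : ℝ) ^ 2 * Real.log (N + 1)) * (∑ i, ‖c i‖ ^ 2) ^ 3 := by
  have hN' : (0 : ℝ) < N := by exact_mod_cast hN
  have hN1 : (1 : ℝ) ≤ N := by exact_mod_cast hN
  have hC := dispConst_pos α
  set f : ℝ → ℝ := fun t => ‖fun x : Lattice M => ∑ i : Fin n, c i *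
        wave α M t (σ * (N + i : ℕ)) (N + i : ℕ) x‖ ^ 6 with hf
  have hfc : Continuous f := by
    refine Continuous.pow (Continuous.norm (continuous_pi fun x => ?_)) 6
    exact continuous_finsetSum _ fun i _ => continuous_const.mul (continuous_wave _ _ x)
  -- The number of short intervals that fill [0,1]. It is at most 13 N^{α-1}, whence the constant
  -- 26, and N^{α-1}·N^{3-α} = N².
  set ν : ℕ := ⌈12 * (N : ℝ) ^ (α - 1)⌉₊ with hν
  have hP : 1 ≤ (N : ℝ) ^ (α - 1) := Real.one_le_rpow hN1 (by linarith)
  have hν1 : 12 * (N : ℝ) ^ (α - 1) ≤ ν := Nat.le_ceil _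
  have hν2 : (ν : ℝ) ≤ 13 * (N : ℝ) ^ (α - 1) := by
    have := Nat.ceil_lt_add_one (a := 12 * (N : ℝ) ^ (α - 1)) (by positivity)
    linarith
  have hν0 : (0 : ℝ) < ν := by linarith
  have hlen : 1 / (ν : ℝ) ≤ (N : ℝ) ^ (1 - α) / 12 := by
    have h1 : (N : ℝ) ^ (1 - α) = ((N : ℝ) ^ (α - 1))⁻¹ := by
      rw [← Real.rpow_neg hN'.le]; congr 1; ring
    rw [h1]
    calc 1 / (ν : ℝ) ≤ 1 / (12 * (N : ℝ) ^ (α - 1)) := by gcongr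
      _ = _ := by field_simp
  have hsum := intervalIntegral.sum_integral_adjacent_intervals (f := f) (μ := volume)
    (a := fun k : ℕ => (k : ℝ) / ν) (n := ν) fun k _ => hfc.intervalIntegrable _ _
  simp only [Nat.cast_zero, zero_div, div_self hν0.ne'] at hsum
  rw [← hsum]
  have hB0 : 0 ≤ (∑ i, ‖c i‖ ^ 2) ^ 3 :=
    pow_nonneg (Finset.sum_nonneg fun i _ => by positivity) 3
  have hL0 : 0 ≤ Real.log ((N : ℝ) + 1) := Real.log_nonneg (by linarith)
  calc _ ≤ ∑ k ∈ Finset.range ν, (∑ i, ‖c i‖ ^ 2) ^ 3 *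
        (2 * dispConst α * (N : ℝ) ^ (3 - α) * Real.log (N + 1)) := by
        refine Finset.sum_le_sum fun k _ => ?_
        have e : ((k + 1 : ℕ) : ℝ) / ν - (k : ℝ) / ν = 1 / ν := by push_cast; ring
        refine block_strichartz_short hα₁ hα₂ hN hn hM σ ?_ ?_ c
        · have : 0 ≤ 1 / (ν : ℝ) := by positivity
          linarith
        · rw [e]; exact hlen
    _ = ν * ((∑ i, ‖c i‖ ^ 2) ^ 3 *
        (2 * dispConst α * (N : ℝ) ^ (3 - α) * Real.log (N + 1))) := by
        rw [Finset.sum_const, Finset.card_range, nsmul_eq_mul]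
    _ ≤ 13 * (N : ℝ) ^ (α - 1) * ((∑ i, ‖c i‖ ^ 2) ^ 3 *
        (2 * dispConst α * (N : ℝ) ^ (3 - α) * Real.log (N + 1))) := by gcongr
    _ = 26 * dispConst α * (((N : ℝ) ^ (α - 1) * (N : ℝ) ^ (3 - α)) * Real.log (N + 1)) *
        (∑ i, ‖c i‖ ^ 2) ^ 3 := by ring
    _ = _ := by
        rw [← Real.rpow_add hN']
        norm_num

end FDNLS
end

/-! ### Summation over dyadic blocks -/

noncomputable section
set_option linter.unusedSectionVars false
namespace FDNLS
open Set MeasureTheory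

lemma sum_Ico_symm {E : Type*} [AddCommMonoid E] (f : ℤ → E) (L : ℕ) :
    ∑ k ∈ Finset.Ico (-(L : ℤ)) (L + 1), f k =
      f 0 + ∑ i ∈ Finset.range L, (f ((i + 1 : ℕ) : ℤ) + f (-((i + 1 : ℕ) : ℤ))) := by
  induction L with
  | zero => simp [show Finset.Ico (0 : ℤ) 1 = {0} from rfl]
  | succ L ih =>
    rw [Finset.sum_range_succ, ← add_assoc, ← ih]
    have h1 : Finset.Ico (-((L + 1 : ℕ) : ℤ)) ((L + 1 : ℕ) + 1) =
        insert (-((L + 1 : ℕ) : ℤ)) (insert ((L + 1 : ℕ) : ℤ) (Finset.Ico (-(L : ℤ)) (L + 1))) := by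
      ext x
      simp only [Finset.mem_insert, Finset.mem_Ico]
      push_cast
      omega
    rw [h1, Finset.sum_insert, Finset.sum_insert]
    · push_cast; abel
    · simp
    · simp only [Finset.mem_insert, Finset.mem_Ico]; push_cast; omega

lemma sum_range_dyadic {E : Type*} [AddCommMonoid E] (g : ℕ → E) (J : ℕ) :
    ∑ i ∈ Finset.range (2 ^ J - 1), g (i + 1) =
      ∑ j ∈ Finset.range J, ∑ i ∈ Finset.range (2 ^ j), g (2 ^ j + i) := by
  induction J with
  | zero => simp
  | succ J ih =>
    rw [Finset.sum_range_succ, ← ih]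
    have h1 : 1 ≤ 2 ^ J := Nat.one_le_two_pow
    rw [show 2 ^ (J + 1) - 1 = (2 ^ J - 1) + 2 ^ J by rw [pow_succ]; omega, Finset.sum_range_add]
    congr 1
    refine Finset.sum_congr rfl fun i _ => ?_
    congr 1
    omega

/-- Jensen with geometric weights. The sixth power of a sum is reduced to a sum of sixth powers at
the cost ρ^{-5j}, which blocks of size ρ^{6j} can afford. -/
lemma weighted_sum_pow_six (ρ : ℝ) (h0 : 0 < ρ) (h1 : ρ < 1) (J : ℕ) (a : ℕ → ℝ)
    (ha : ∀ j, 0 ≤ a j) :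
    (∑ j ∈ Finset.range J, a j) ^ 6 ≤
      (1 / (1 - ρ)) ^ 5 * ∑ j ∈ Finset.range J, a j ^ 6 / ρ ^ (5 * j) := by
  rcases Nat.eq_zero_or_pos J with rfl | hJ
  · simp
  set W := ∑ j ∈ Finset.range J, ρ ^ j with hW
  have hW0 : 0 < W := Finset.sum_pos (fun j _ => by positivity) (Finset.nonempty_range_iff.2 hJ.ne')
  have hW1 : W ≤ 1 / (1 - ρ) := by
    rw [hW, le_div_iff₀ (by linarith), geom_sum_mul_neg]
    have : 0 < ρ ^ J := by positivity
    linarith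
  have hm := Real.pow_arith_mean_le_arith_mean_pow (Finset.range J) (fun j => ρ ^ j / W)
    (fun j => a j / ρ ^ j) (fun j _ => by positivity)
    (by rw [← Finset.sum_div, div_self hW0.ne'])
    (fun j _ => div_nonneg (ha j) (by positivity)) 6
  have e1 : ∑ j ∈ Finset.range J, ρ ^ j / W * (a j / ρ ^ j) = (∑ j ∈ Finset.range J, a j) / W := by
    rw [Finset.sum_div]
    exact Finset.sum_congr rfl fun j _ => by field_simp
  have e2 : ∑ j ∈ Finset.range J, ρ ^ j / W * (a j / ρ ^ j) ^ 6 =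
      (∑ j ∈ Finset.range J, a j ^ 6 / ρ ^ (5 * j)) / W := by
    rw [Finset.sum_div]
    refine Finset.sum_congr rfl fun j _ => ?_
    rw [div_pow, ← pow_mul]
    have : ρ ^ (j * 6) = ρ ^ j * ρ ^ (5 * j) := by rw [← pow_add]; congr 1; ring
    rw [this]
    field_simp
  rw [e1, e2, div_pow, div_le_div_iff₀ (by positivity) hW0] at hm
  have hS : 0 ≤ ∑ j ∈ Finset.range J, a j ^ 6 / ρ ^ (5 * j) :=
    Finset.sum_nonneg fun j _ => div_nonneg (pow_nonneg (ha j) 6) (by positivity)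
  have h6 : (∑ j ∈ Finset.range J, a j) ^ 6 ≤
      W ^ 5 * ∑ j ∈ Finset.range J, a j ^ 6 / ρ ^ (5 * j) := by
    refine le_of_mul_le_mul_right ?_ hW0
    calc _ ≤ _ := hm
      _ = _ := by ring
  exact h6.trans (by gcongr)

variable {M : ℕ} [NeZero M] {α s : ℝ}

/-- The Fourier coefficients of a lattice function, extended by zero to all integers. -/
def coef (f : Lattice M → ℂ) (k : ℤ) : ℂ :=
  if h : k ∈ Finset.Ico (-(M : ℤ)) M then ((2 * Real.pi : ℝ) : ℂ)⁻¹ * fourier M f ⟨k, h⟩ else 0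

lemma coef_of_mem (f : Lattice M → ℂ) (k : Lattice M) :
    coef f k = ((2 * Real.pi : ℝ) : ℂ)⁻¹ * fourier M f k := by
  rw [coef, dif_pos k.2]

lemma symbol_eq (α : ℝ) (k : Lattice M) :
    symbol α M k = disp α (mesh M / 2) ((k : ℤ).natAbs : ℝ) := by
  have hh := mesh_pos M
  have hk : |((k : ℤ) : ℝ)| = ((k : ℤ).natAbs : ℝ) := by
    rw [Nat.cast_natAbs, Int.cast_abs]
  have hkM : ((k : ℤ).natAbs : ℝ) ≤ M := by
    have := Finset.mem_Ico.1 k.2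
    exact_mod_cast (show (k : ℤ).natAbs ≤ M by omega)
  rw [symbol, disp]
  congr 1
  have h0 : 0 ≤ mesh M / 2 * ((k : ℤ).natAbs : ℝ) := by positivity
  have h1 : mesh M / 2 * ((k : ℤ).natAbs : ℝ) ≤ Real.pi := by
    have := mul_le_mul_of_nonneg_left hkM (by positivity : 0 ≤ mesh M / 2)
    linarith [mesh_mul M, Real.pi_pos]
  have hs := Real.sin_nonneg_of_nonneg_of_le_pi h0 h1
  rw [← hk] at hs ⊢
  rw [abs_mul, abs_of_pos (by positivity : 0 < 2 / mesh M)]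
  have e : |Real.sin (mesh M * ((k : ℤ) : ℝ) / 2)| = Real.sin (mesh M / 2 * |((k : ℤ) : ℝ)|) := by
    rw [← abs_of_nonneg hs]
    rcases abs_choice ((k : ℤ) : ℝ) with h | h
    · rw [h]; congr 2; ring
    · rw [h, mul_neg, Real.sin_neg, abs_neg]; congr 2; ring
  rw [e]
  field_simp

lemma prop_eq_sum_wave (t : ℝ) (f : Lattice M → ℂ) (x : Lattice M) :
    prop α M t f x = ∑ k ∈ Finset.Ico (-(M : ℤ)) M, coef f k * wave α M t k k.natAbs x := by
  rw [← Finset.sum_coe_sort (Finset.Ico (-(M : ℤ)) M)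
    (fun k => coef f k * wave α M t k k.natAbs x), prop_apply, propagator, multiplier, fourierInv,
    Finset.mul_sum]
  refine Finset.sum_congr rfl fun k _ => ?_
  rw [coef_of_mem, wave, symbol_eq]
  have e : (((((k : ℤ) : ℝ) * point M x - t * disp α (mesh M / 2) ((k : ℤ).natAbs : ℝ) : ℝ)) : ℂ)
      * Complex.I = -(Complex.I * (t * disp α (mesh M / 2) ((k : ℤ).natAbs : ℝ) : ℝ)) +
        Complex.I * (((k : ℤ) : ℝ) * point M x : ℝ) := by push_cast; ring
  rw [e, Complex.exp_add]
  ring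

lemma le_bracket (ξ : ℝ) : |ξ| ≤ bracket ξ := by
  rw [bracket]
  exact Real.le_sqrt_of_sq_le (by linarith)

lemma one_le_bracket (ξ : ℝ) : 1 ≤ bracket ξ := by
  rw [bracket]
  exact Real.one_le_sqrt.2 (by linarith [sq_nonneg |ξ|])

lemma sobolevNorm_sq (s : ℝ) (f : Lattice M → ℂ) :
    sobolevNorm s M f ^ 2 =
      (2 * Real.pi)⁻¹ * ∑ k : Lattice M, bracket ((k : ℤ) : ℝ) ^ (2 * s) * ‖fourier M f k‖ ^ 2 := by
  refine Real.sq_sqrt ?_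
  have := Real.pi_pos
  refine mul_nonneg (by positivity) (Finset.sum_nonneg fun k _ => mul_nonneg ?_ (by positivity))
  exact Real.rpow_nonneg (by linarith [one_le_bracket ((k : ℤ) : ℝ)]) _

lemma sobolevNorm_nonneg (s : ℝ) (f : Lattice M → ℂ) : 0 ≤ sobolevNorm s M f := Real.sqrt_nonneg _

lemma sum_coef_le (f : Lattice M → ℂ) (T : Finset ℤ) :
    ∑ k ∈ T, bracket (k : ℝ) ^ (2 * s) * ‖coef f k‖ ^ 2 ≤ sobolevNorm s M f ^ 2 := by
  classical
  have hpi := Real.pi_gt_three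
  have hb : ∀ k : ℤ, 0 ≤ bracket (k : ℝ) ^ (2 * s) := fun k =>
    Real.rpow_nonneg (by linarith [one_le_bracket (k : ℝ)]) _
  have h1 : ∑ k ∈ T, bracket (k : ℝ) ^ (2 * s) * ‖coef f k‖ ^ 2 ≤
      ∑ k ∈ Finset.Ico (-(M : ℤ)) M, bracket (k : ℝ) ^ (2 * s) * ‖coef f k‖ ^ 2 := by
    have h2 : ∑ k ∈ T ∩ Finset.Ico (-(M : ℤ)) M, bracket (k : ℝ) ^ (2 * s) * ‖coef f k‖ ^ 2 =
        ∑ k ∈ T, bracket (k : ℝ) ^ (2 * s) * ‖coef f k‖ ^ 2 := by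
      refine Finset.sum_subset Finset.inter_subset_left fun k hk hk' => ?_
      have : k ∉ Finset.Ico (-(M : ℤ)) M := fun h => hk' (Finset.mem_inter.2 ⟨hk, h⟩)
      rw [coef, dif_neg this]; simp
    rw [← h2]
    exact Finset.sum_le_sum_of_subset_of_nonneg Finset.inter_subset_right fun k _ _ =>
      mul_nonneg (hb k) (by positivity)
  refine h1.trans ?_
  rw [sobolevNorm_sq, ← Finset.sum_coe_sort, Finset.mul_sum]
  refine Finset.sum_le_sum fun k _ => ?_
  rw [coef_of_mem, norm_mul, mul_pow, norm_inv, Complex.norm_real, Real.norm_eq_abs,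
    abs_of_pos (by linarith : 0 < 2 * Real.pi), ← mul_assoc, ← mul_assoc, mul_comm (_ ^ (2 * s))]
  have : ((2 * Real.pi)⁻¹) ^ 2 ≤ (2 * Real.pi)⁻¹ := by
    refine pow_le_of_le_one (by positivity) ?_ (by norm_num)
    exact inv_le_one_of_one_le₀ (by linarith)
  have := hb k
  gcongr

lemma norm_coef_zero_le (f : Lattice M → ℂ) : ‖coef f 0‖ ≤ sobolevNorm s M f := by
  have := sum_coef_le (s := s) f {0}
  rw [Finset.sum_singleton] at this
  have hb : bracket ((0 : ℤ) : ℝ) = 1 := by simp [bracket]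
  rw [hb, Real.one_rpow, one_mul] at this
  exact le_of_sq_le_sq this (sobolevNorm_nonneg s f)

lemma sum_block_coef_le (hs : 0 ≤ s) (f : Lattice M → ℂ) {N n : ℕ} (hN : 0 < N) {σ : ℤ}
    (hσ : σ.natAbs = 1) :
    ∑ i : Fin n, ‖coef f (σ * (N + i : ℕ))‖ ^ 2 ≤
      (N : ℝ) ^ (-(2 * s)) * sobolevNorm s M f ^ 2 := by
  classical
  have hN' : (0 : ℝ) < N := by exact_mod_cast hN
  have hinj : Set.InjOn (fun i : Fin n => σ * ((N + i : ℕ) : ℤ)) (Finset.univ : Finset (Fin n)) := by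
    intro i _ j _ h
    have hσ0 : σ ≠ 0 := by rintro rfl; simp at hσ
    have := mul_left_cancel₀ hσ0 h
    ext
    omega
  have h := sum_coef_le (s := s) f (Finset.univ.image fun i : Fin n => σ * ((N + i : ℕ) : ℤ))
  rw [Finset.sum_image hinj] at h
  rw [Real.rpow_neg hN'.le, ← div_eq_inv_mul, le_div_iff₀ (by positivity), mul_comm, Finset.mul_sum]
  refine (Finset.sum_le_sum fun i _ => ?_).trans h
  refine mul_le_mul_of_nonneg_right ?_ (by positivity)
  refine Real.rpow_le_rpow hN'.le (le_trans ?_ (le_bracket _)) (by linarith)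
  have e : |((σ * ((N + i : ℕ) : ℤ) : ℤ) : ℝ)| = ((N + i : ℕ) : ℝ) := by
    rw [← Int.cast_abs, abs_mul, Int.abs_eq_natAbs σ, hσ]
    simp
    positivity
  rw [e]
  push_cast
  have : (0 : ℝ) ≤ (i : ℕ) := by positivity
  linarith

/-- The surplus 6s - 2 of derivatives is divided into seven equal parts β: one pays for the
logarithm, log N ≲ N^β, and six remain as decay, 2 + β - 6s = -6β. -/
lemma block_le (hα₁ : 1 < α) (hα₂ : α ≤ 2) (f : Lattice M → ℂ) {N n : ℕ}
    (hN : 0 < N) (hn : n ≤ N) (hM : N + n ≤ M + 1) {σ : ℤ} (hσ : σ.natAbs = 1) {β : ℝ}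
    (hβ : 0 < β) (hβs : 7 * β = 6 * s - 2) :
    ∫ t in (0 : ℝ)..1, ‖fun x : Lattice M => ∑ i : Fin n, coef f (σ * (N + i : ℕ)) *
        wave α M t (σ * (N + i : ℕ)) (N + i : ℕ) x‖ ^ 6 ≤
      26 * dispConst α * (2 ^ β / β) * ((N : ℝ) ^ (-β)) ^ 6 * sobolevNorm s M f ^ 6 := by
  have hN' : (0 : ℝ) < N := by exact_mod_cast hN
  have hN1 : (1 : ℝ) ≤ N := by exact_mod_cast hN
  have hC := dispConst_pos α
  have hA := sobolevNorm_nonneg s f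
  refine (block_strichartz hα₁ hα₂ hN hn hM σ fun i => coef f (σ * (N + i : ℕ))).trans ?_
  have h1 := sum_block_coef_le (n := n) (by linarith : 0 ≤ s) f hN hσ
  have h2 : Real.log ((N : ℝ) + 1) ≤ 2 ^ β / β * (N : ℝ) ^ β := by
    refine (Real.log_le_rpow_div (by linarith) hβ).trans ?_
    rw [div_mul_eq_mul_div, ← Real.mul_rpow (by norm_num) hN'.le]
    gcongr
    linarith
  have h0 : 0 ≤ ∑ i : Fin n, ‖coef f (σ * (N + i : ℕ))‖ ^ 2 :=
    Finset.sum_nonneg fun i _ => by positivity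
  calc _ ≤ 26 * dispConst α * ((N : ℝ) ^ 2 * (2 ^ β / β * (N : ℝ) ^ β)) *
        ((N : ℝ) ^ (-(2 * s)) * sobolevNorm s M f ^ 2) ^ 3 := by gcongr
    _ = 26 * dispConst α * (2 ^ β / β) * ((N : ℝ) ^ 2 * (N : ℝ) ^ β * ((N : ℝ) ^ (-(2 * s))) ^ 3)
        * sobolevNorm s M f ^ 6 := by ring
    _ = _ := by
      congr 2
      rw [← Real.rpow_natCast, ← Real.rpow_natCast ((N : ℝ) ^ (-(2 * s))),
        ← Real.rpow_natCast ((N : ℝ) ^ (-β)), ← Real.rpow_mul hN'.le, ← Real.rpow_mul hN'.le,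
        ← Real.rpow_add hN', ← Real.rpow_add hN']
      congr 1
      push_cast
      linarith

/-- The part of the linear flow in the dyadic block of frequencies of sign `σ` and size `2^j`. -/
def dyadicPart (α : ℝ) (f : Lattice M → ℂ) (σ : ℤ) (j : ℕ) (t : ℝ) (x : Lattice M) : ℂ :=
  -- The block stops at frequency M, beyond which the dispersive estimate is unavailable and the
  -- coefficients vanish. The natural subtraction makes blocks beyond M empty.
  ∑ i : Fin (min (2 ^ j) (M + 1 - 2 ^ j)), coef f (σ * ((2 ^ j + i : ℕ) : ℤ)) *
    wave α M t (σ * ((2 ^ j + i : ℕ) : ℝ)) ((2 ^ j + i : ℕ) : ℝ) x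

lemma continuous_dyadicPart (f : Lattice M → ℂ) (σ : ℤ) (j : ℕ) :
    Continuous (dyadicPart α f σ j) :=
  continuous_pi fun x => continuous_finsetSum _ fun _ _ =>
    continuous_const.mul (continuous_wave _ _ x)

lemma dyadicPart_eq (f : Lattice M → ℂ) {σ : ℤ} (hσ : σ.natAbs = 1) (j : ℕ) (t : ℝ)
    (x : Lattice M) :
    dyadicPart α f σ j t x = ∑ i ∈ Finset.range (2 ^ j),
      coef f (σ * ((2 ^ j + i : ℕ) : ℤ)) * wave α M t ((σ * ((2 ^ j + i : ℕ) : ℤ) : ℤ) : ℝ)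
        (σ * ((2 ^ j + i : ℕ) : ℤ)).natAbs x := by
  have hab : ∀ i : ℕ, (σ * ((2 ^ j + i : ℕ) : ℤ)).natAbs = 2 ^ j + i := fun i => by
    rw [Int.natAbs_mul, hσ, one_mul, Int.natAbs_natCast]
  rw [dyadicPart, ← Finset.sum_range (fun i => coef f (σ * ((2 ^ j + i : ℕ) : ℤ)) *
    wave α M t (σ * ((2 ^ j + i : ℕ) : ℝ)) ((2 ^ j + i : ℕ) : ℝ) x)]
  have hsub : Finset.range (min (2 ^ j) (M + 1 - 2 ^ j)) ⊆ Finset.range (2 ^ j) :=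
    Finset.range_subset_range.2 (min_le_left _ _)
  rw [← Finset.sum_subset hsub]
  · refine Finset.sum_congr rfl fun i _ => ?_
    rw [hab]
    push_cast
    rfl
  · intro i hi hi'
    rw [Finset.mem_range] at hi hi'
    rw [coef, dif_neg, zero_mul]
    intro hmem
    have h1 := Finset.mem_Ico.1 hmem
    have h2 := hab i
    have h3 : 2 ^ j + i ≤ M := by omega
    exact hi' (lt_min hi (by omega))

lemma prop_eq_dyadic {J : ℕ} (hJ : M < 2 ^ J) (t : ℝ) (f : Lattice M → ℂ) :
    prop α M t f = (fun x => coef f 0 * wave α M t 0 0 x) +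
      ((∑ j ∈ Finset.range J, dyadicPart α f 1 j t) +
        ∑ j ∈ Finset.range J, dyadicPart α f (-1) j t) := by
  funext x
  have h1 : ∑ k ∈ Finset.Ico (-(M : ℤ)) M, coef f k * wave α M t k k.natAbs x =
      ∑ k ∈ Finset.Ico (-((2 ^ J - 1 : ℕ) : ℤ)) ((2 ^ J - 1 : ℕ) + 1),
        coef f k * wave α M t k k.natAbs x := by
    refine Finset.sum_subset (fun k hk => ?_) fun k _ hk => ?_
    · rw [Finset.mem_Ico] at hk ⊢
      omega
    · rw [coef, dif_neg hk, zero_mul]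
  rw [prop_eq_sum_wave, h1, sum_Ico_symm, Finset.sum_add_distrib,
    sum_range_dyadic (fun i => coef f (i : ℤ) * wave α M t (i : ℤ) (i : ℤ).natAbs x),
    sum_range_dyadic (fun i => coef f (-(i : ℤ)) * wave α M t (-(i : ℤ) : ℤ) (-(i : ℤ)).natAbs x)]
  simp only [Pi.add_apply, Finset.sum_apply, dyadicPart_eq f (show (1 : ℤ).natAbs = 1 from rfl),
    dyadicPart_eq f (show (-1 : ℤ).natAbs = 1 from rfl)]
  simp only [one_mul, neg_one_mul]
  simp

lemma sum_dyadicPart_le (hα₁ : 1 < α) (hα₂ : α ≤ 2) (f : Lattice M → ℂ)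
    {σ : ℤ} (hσ : σ.natAbs = 1) {β : ℝ} (hβ : 0 < β) (hβs : 7 * β = 6 * s - 2) (J : ℕ) :
    ∫ t in (0 : ℝ)..1, ‖∑ j ∈ Finset.range J, dyadicPart α f σ j t‖ ^ 6 ≤
      (1 / (1 - (2 : ℝ) ^ (-β))) ^ 6 * (26 * dispConst α * (2 ^ β / β)) *
        sobolevNorm s M f ^ 6 := by
  set ρ : ℝ := (2 : ℝ) ^ (-β) with hρ
  have hρ0 : 0 < ρ := by positivity
  have hρ1 : ρ < 1 := Real.rpow_lt_one_of_one_lt_of_neg (by norm_num) (by linarith)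
  have hA := sobolevNorm_nonneg s f
  have hC := dispConst_pos α
  have hblock : ∀ j, ∫ t in (0 : ℝ)..1, ‖dyadicPart α f σ j t‖ ^ 6 ≤
      26 * dispConst α * (2 ^ β / β) * (ρ ^ j) ^ 6 * sobolevNorm s M f ^ 6 := by
    intro j
    have hNρ : (((2 ^ j : ℕ) : ℝ)) ^ (-β) = ρ ^ j := by
      push_cast
      rw [hρ, ← Real.rpow_natCast, ← Real.rpow_natCast, ← Real.rpow_mul (by norm_num),
        ← Real.rpow_mul (by norm_num), mul_comm]
    by_cases hj : 2 ^ j ≤ M + 1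
    · have := block_le hα₁ hα₂ f (N := 2 ^ j) (n := min (2 ^ j) (M + 1 - 2 ^ j))
        (by positivity) (min_le_left _ _) (by omega) hσ hβ hβs
      rw [hNρ] at this
      exact this
    · have h0 : min (2 ^ j) (M + 1 - 2 ^ j) = 0 := by omega
      have h1 : ∀ t, dyadicPart α f σ j t = 0 := by
        intro t
        funext x
        have : IsEmpty (Fin (min (2 ^ j) (M + 1 - 2 ^ j))) := by rw [h0]; infer_instance
        simp [dyadicPart]
      simp only [h1, norm_zero]
      simp
      positivity
  have hcont : ∀ j, Continuous fun t => ‖dyadicPart α f σ j t‖ ^ 6 := fun j =>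
    (continuous_dyadicPart f σ j).norm.pow 6
  have hsum : Continuous fun t => ‖∑ j ∈ Finset.range J, dyadicPart α f σ j t‖ ^ 6 :=
    (continuous_finsetSum _ fun j _ => continuous_dyadicPart f σ j).norm.pow 6
  have hbound : Continuous fun t => (1 / (1 - ρ)) ^ 5 *
      ∑ j ∈ Finset.range J, ‖dyadicPart α f σ j t‖ ^ 6 / ρ ^ (5 * j) :=
    continuous_const.mul (continuous_finsetSum _ fun j _ => (hcont j).div_const _)
  have hgeom : ∑ j ∈ Finset.range J, ρ ^ j ≤ 1 / (1 - ρ) := by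
    rw [le_div_iff₀ (by linarith), geom_sum_mul_neg]
    have : 0 < ρ ^ J := by positivity
    linarith
  have h1ρ : 0 < 1 - ρ := by linarith
  calc _ ≤ ∫ t in (0 : ℝ)..1, (1 / (1 - ρ)) ^ 5 *
        ∑ j ∈ Finset.range J, ‖dyadicPart α f σ j t‖ ^ 6 / ρ ^ (5 * j) := by
        refine intervalIntegral.integral_mono_on zero_le_one (hsum.intervalIntegrable _ _)
          (hbound.intervalIntegrable _ _) fun t _ => ?_
        refine le_trans ?_ (weighted_sum_pow_six ρ hρ0 hρ1 J
          (fun j => ‖dyadicPart α f σ j t‖) fun j => norm_nonneg _)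
        gcongr
        exact norm_sum_le _ _
    _ = (1 / (1 - ρ)) ^ 5 * ∑ j ∈ Finset.range J,
        (∫ t in (0 : ℝ)..1, ‖dyadicPart α f σ j t‖ ^ 6) / ρ ^ (5 * j) := by
        rw [intervalIntegral.integral_const_mul, intervalIntegral.integral_finsetSum
          fun j _ => ((hcont j).div_const _).intervalIntegrable _ _]
        simp only [intervalIntegral.integral_div]
    _ ≤ (1 / (1 - ρ)) ^ 5 * ∑ j ∈ Finset.range J,
        26 * dispConst α * (2 ^ β / β) * sobolevNorm s M f ^ 6 * ρ ^ j := by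
        gcongr with j _
        rw [div_le_iff₀ (by positivity)]
        refine (hblock j).trans (le_of_eq ?_)
        rw [← pow_mul, mul_assoc (_ * sobolevNorm s M f ^ 6), ← pow_add]
        ring_nf
    _ = (1 / (1 - ρ)) ^ 5 * (26 * dispConst α * (2 ^ β / β) * sobolevNorm s M f ^ 6 *
        ∑ j ∈ Finset.range J, ρ ^ j) := by rw [Finset.mul_sum (s := Finset.range J) (f := fun j => ρ ^ j)]
    _ ≤ (1 / (1 - ρ)) ^ 5 * (26 * dispConst α * (2 ^ β / β) * sobolevNorm s M f ^ 6 *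
        (1 / (1 - ρ))) := by gcongr
    _ = _ := by ring

/-- The **Strichartz estimate** on the lattice, uniform in the mesh size, for `s > 1/3`. -/
theorem strichartz (hα₁ : 1 < α) (hα₂ : α ≤ 2) (hs : 1 / 3 < s) :
    ∃ C : ℝ, 0 < C ∧ ∀ (M : ℕ) [NeZero M] (f : Lattice M → ℂ),
      ∫ t in (0 : ℝ)..1, ‖prop α M t f‖ ^ 6 ≤ C * sobolevNorm s M f ^ 6 := by
  set β := (6 * s - 2) / 7 with hβdef
  have hβ : 0 < β := by rw [hβdef]; linarith
  have hβs : 7 * β = 6 * s - 2 := by rw [hβdef]; ring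
  have hρ1 : (2 : ℝ) ^ (-β) < 1 := Real.rpow_lt_one_of_one_lt_of_neg (by norm_num) (by linarith)
  have hC := dispConst_pos α
  set B := (1 / (1 - (2 : ℝ) ^ (-β))) ^ 6 * (26 * dispConst α * (2 ^ β / β)) with hB
  have h1ρ : 0 < 1 - (2 : ℝ) ^ (-β) := by linarith
  have hB0 : 0 < B := by positivity
  -- The inequality (x+y)⁶ ≤ 32(x⁶+y⁶) is used twice: to split off the zero mode, then to separate
  -- positive and negative frequencies, each contributing B.
  refine ⟨32 * (1 + 64 * B), by positivity, fun M _ f => ?_⟩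
  obtain ⟨J, hJ⟩ : ∃ J : ℕ, M < 2 ^ J := ⟨M, Nat.lt_two_pow_self⟩
  have hA := sobolevNorm_nonneg s f
  set P : ℤ → ℝ → ℝ := fun σ t => ‖∑ j ∈ Finset.range J, dyadicPart α f σ j t‖ ^ 6 with hP
  have hPc : ∀ σ, Continuous (P σ) := fun σ =>
    (continuous_finsetSum _ fun j _ => continuous_dyadicPart f σ j).norm.pow 6
  have h0 : ∀ t, ‖fun x : Lattice M => coef f 0 * wave α M t 0 0 x‖ ≤ sobolevNorm s M f := by
    intro t
    refine (pi_norm_le_iff_of_nonempty _).2 fun x => ?_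
    rw [norm_mul, norm_wave, mul_one]
    exact norm_coef_zero_le f
  have hcont : Continuous fun t => ‖prop α M t f‖ ^ 6 :=
    ((continuous_prop α).clm_apply continuous_const).norm.pow 6
  have hpt : ∀ t, ‖prop α M t f‖ ^ 6 ≤
      32 * (sobolevNorm s M f ^ 6 + 32 * (P 1 t + P (-1) t)) := by
    intro t
    rw [prop_eq_dyadic hJ]
    refine (pow_le_pow_left₀ (norm_nonneg _) (norm_add_le _ _) 6).trans ?_
    refine (add_pow_le (norm_nonneg _) (norm_nonneg _) 6).trans ?_
    have h1 := pow_le_pow_left₀ (norm_nonneg _) (h0 t) 6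
    have h2 := (pow_le_pow_left₀ (norm_nonneg _) (norm_add_le
      (∑ j ∈ Finset.range J, dyadicPart α f 1 j t)
      (∑ j ∈ Finset.range J, dyadicPart α f (-1) j t)) 6).trans
      (add_pow_le (norm_nonneg _) (norm_nonneg _) 6)
    norm_num only at h2 ⊢
    simp only [hP]
    gcongr
  have b1 := sum_dyadicPart_le hα₁ hα₂ f (show (1 : ℤ).natAbs = 1 from rfl) hβ hβs J
  have b2 := sum_dyadicPart_le hα₁ hα₂ f (show (-1 : ℤ).natAbs = 1 from rfl) hβ hβs J
  have hint : ∫ t in (0 : ℝ)..1, 32 * (sobolevNorm s M f ^ 6 + 32 * (P 1 t + P (-1) t)) =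
      32 * (sobolevNorm s M f ^ 6 +
        32 * ((∫ t in (0 : ℝ)..1, P 1 t) + ∫ t in (0 : ℝ)..1, P (-1) t)) := by
    have hc1 := (hPc 1).intervalIntegrable (μ := volume) 0 1
    have hc2 := (hPc (-1)).intervalIntegrable (μ := volume) 0 1
    rw [intervalIntegral.integral_const_mul, intervalIntegral.integral_add
      intervalIntegrable_const ((hc1.add hc2).const_mul 32), intervalIntegral.integral_const_mul,
      intervalIntegral.integral_add hc1 hc2]
    simp
  have hbc : Continuous fun t => 32 * (sobolevNorm s M f ^ 6 + 32 * (P 1 t + P (-1) t)) := by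
    have := hPc 1
    have := hPc (-1)
    fun_prop
  refine (intervalIntegral.integral_mono_on zero_le_one (hcont.intervalIntegrable _ _)
    (hbc.intervalIntegrable _ _) fun t _ => hpt t).trans ?_
  rw [hint]
  linarith

end FDNLS
end

/-! ### Fourier coefficients on the cyclic group and the Wiener algebra -/

noncomputable section
set_option linter.unusedSectionVars false
namespace FDNLS
open Set MeasureTheory

variable {M : ℕ} [NeZero M] {s : ℝ}

/-- The Fourier coefficients, indexed by the cyclic group. -/
def hat (f : Lattice M → ℂ) (c : ZMod (2 * M)) : ℂ :=
  ((2 * Real.pi : ℝ) : ℂ)⁻¹ * fourier M f ((resEquiv M).symm c)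

/-- The absolute value of the smallest representative of a residue class. -/
def absRes (c : ZMod (2 * M)) : ℝ := (c.valMinAbs.natAbs : ℝ)

lemma sum_lattice_eq {E : Type*} [AddCommMonoid E] (g : ZMod (2 * M) → E) :
    ∑ k : Lattice M, g (res k) = ∑ c, g c := (resEquiv M).sum_comp g

lemma hat_res (f : Lattice M → ℂ) (k : Lattice M) :
    hat f (res k) = ((2 * Real.pi : ℝ) : ℂ)⁻¹ * fourier M f k := by
  rw [hat, ← resEquiv_apply, Equiv.symm_apply_apply]

lemma eq_sum_hat (f : Lattice M → ℂ) (x : Lattice M) : f x = ∑ c, hat f c * chr (c * res x) := by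
  rw [← sum_lattice_eq]
  simp only [hat_res, mul_assoc, ← Finset.mul_sum]
  rw [← fourierInv_eq, fourierInv_fourier]

/-- With this, the coefficients of products, conjugates and translates can be read off from any
expansion in characters. -/
lemma hat_unique {f : Lattice M → ℂ} {a : ZMod (2 * M) → ℂ}
    (h : ∀ x, f x = ∑ c, a c * chr (c * res x)) : hat f = a := by
  have hpi : ((2 * Real.pi : ℝ) : ℂ) ≠ 0 := by exact_mod_cast Real.two_pi_pos.ne'
  have h1 : f = fourierInv M fun k => ((2 * Real.pi : ℝ) : ℂ) * a (res k) := by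
    funext x
    rw [h x, ← sum_lattice_eq, fourierInv_eq, Finset.mul_sum]
    refine Finset.sum_congr rfl fun k _ => ?_
    field_simp
  funext c
  obtain ⟨k, rfl⟩ := (res_bijective M).2 c
  rw [hat_res, h1, fourier_fourierInv]
  field_simp

lemma hat_mul (f g : Lattice M → ℂ) (e : ZMod (2 * M)) :
    hat (f * g) e = ∑ c, hat f c * hat g (e - c) := by
  revert e
  rw [← funext_iff]
  refine hat_unique fun x => ?_
  rw [Pi.mul_apply, eq_sum_hat f x, eq_sum_hat g x, Finset.sum_mul_sum]
  simp only [Finset.sum_mul]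
  rw [Finset.sum_comm (s := Finset.univ (α := ZMod (2 * M)))
    (f := fun e c => hat f c * hat g (e - c) * chr (e * res x))]
  refine Finset.sum_congr rfl fun c _ => ?_
  rw [← (Equiv.subRight c).sum_comp fun d => hat f c * chr (c * res x) * (hat g d * chr (d * res x))]
  refine Finset.sum_congr rfl fun e _ => ?_
  rw [Equiv.subRight_apply, show e * res x = c * res x + (e - c) * res x by ring, chr_add]
  ring

lemma hat_star (f : Lattice M → ℂ) (c : ZMod (2 * M)) :
    hat (star f) c = (starRingEnd ℂ) (hat f (-c)) := by
  revert c
  rw [← funext_iff]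
  refine hat_unique fun x => ?_
  rw [Pi.star_apply, eq_sum_hat f x, star_sum, ← Equiv.sum_comp (Equiv.neg (ZMod (2 * M)))]
  refine Finset.sum_congr rfl fun c _ => ?_
  rw [Equiv.neg_apply, star_mul', ← starRingEnd_apply, ← starRingEnd_apply, conj_chr]
  congr 2
  ring

lemma hat_add (f g : Lattice M → ℂ) : hat (f + g) = hat f + hat g := by
  funext c
  simp only [hat, fourier_add, Pi.add_apply, mul_add]

lemma hat_sub (f g : Lattice M → ℂ) : hat (f - g) = hat f - hat g := by
  rw [eq_sub_iff_add_eq, ← hat_add, sub_add_cancel]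

lemma absRes_res (k : Lattice M) : absRes (res k) = |((k : ℤ) : ℝ)| := by
  have hk := Finset.mem_Ico.1 k.2
  rw [absRes, Nat.cast_natAbs, Int.cast_abs]
  -- The class of M is represented by -M in the lattice but by M in `valMinAbs`; only the absolute
  -- values agree.
  by_cases h : (k : ℤ) = -M
  · have : (res k).valMinAbs = M := by
      rw [ZMod.valMinAbs_spec]
      refine ⟨?_, ?_⟩
      · rw [res, h, ZMod.intCast_eq_intCast_iff_dvd_sub]
        exact ⟨1, by push_cast; ring⟩
      · rw [Set.mem_Ioc]; push_cast; constructor <;> omega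
    rw [this, h]; simp
  · have : (res k).valMinAbs = k := by
      rw [ZMod.valMinAbs_spec]
      refine ⟨rfl, ?_⟩
      rw [Set.mem_Ioc]; push_cast; constructor <;> omega
    rw [this]

lemma absRes_nonneg (c : ZMod (2 * M)) : 0 ≤ absRes c := Nat.cast_nonneg _

lemma absRes_neg (c : ZMod (2 * M)) : absRes (-c) = absRes c := by
  rw [absRes, ZMod.natAbs_valMinAbs_neg, absRes]

lemma absRes_add_le (c d : ZMod (2 * M)) : absRes (c + d) ≤ absRes c + absRes d := by
  simp only [absRes]
  exact_mod_cast (ZMod.natAbs_valMinAbs_add_le c d).trans (Int.natAbs_add_le _ _)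

lemma bracket_abs (ξ : ℝ) : bracket |ξ| = bracket ξ := by rw [bracket, bracket, abs_abs]

lemma sobolevNorm_sq_hat (s : ℝ) (f : Lattice M → ℂ) :
    sobolevNorm s M f ^ 2 =
      2 * Real.pi * ∑ c, bracket (absRes c) ^ (2 * s) * ‖hat f c‖ ^ 2 := by
  have hpi := Real.pi_pos
  rw [sobolevNorm_sq, ← sum_lattice_eq, Finset.mul_sum, Finset.mul_sum]
  refine Finset.sum_congr rfl fun k _ => ?_
  rw [absRes_res, bracket_abs, hat_res, norm_mul, norm_inv, Complex.norm_real, Real.norm_eq_abs,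
    abs_of_pos (by linarith : 0 < 2 * Real.pi)]
  field_simp

lemma bracket_pos (ξ : ℝ) : 0 < bracket ξ := by linarith [one_le_bracket ξ]

lemma sobolevNorm_star (s : ℝ) (f : Lattice M → ℂ) :
    sobolevNorm s M (star f) = sobolevNorm s M f := by
  refine (pow_left_inj₀ (sobolevNorm_nonneg s _) (sobolevNorm_nonneg s _) two_ne_zero).1 ?_
  rw [sobolevNorm_sq_hat, sobolevNorm_sq_hat, ← Equiv.sum_comp (Equiv.neg (ZMod (2 * M)))]
  simp only [Equiv.neg_apply, hat_star, neg_neg, absRes_neg, RCLike.norm_conj]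

/-! ### The Wiener algebra -/

/-- The norm of the Wiener algebra: the sum of the absolute values of the Fourier coefficients. -/
def wiener (f : Lattice M → ℂ) : ℝ := ∑ c, ‖hat f c‖

lemma wiener_nonneg (f : Lattice M → ℂ) : 0 ≤ wiener f :=
  Finset.sum_nonneg fun _ _ => norm_nonneg _

lemma norm_le_wiener (f : Lattice M → ℂ) : ‖f‖ ≤ wiener f := by
  refine (pi_norm_le_iff_of_nonempty _).2 fun x => ?_
  rw [eq_sum_hat f x]
  refine (norm_sum_le _ _).trans (le_of_eq ?_)
  simp only [norm_mul, norm_chr, mul_one, wiener]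

lemma wiener_mul_le (f g : Lattice M → ℂ) : wiener (f * g) ≤ wiener f * wiener g := by
  calc wiener (f * g) ≤ ∑ e, ∑ c, ‖hat f c‖ * ‖hat g (e - c)‖ := by
        refine Finset.sum_le_sum fun e _ => ?_
        rw [hat_mul]
        refine (norm_sum_le _ _).trans (le_of_eq ?_)
        simp only [norm_mul]
    _ = ∑ c, ‖hat f c‖ * wiener g := by
        rw [Finset.sum_comm]
        refine Finset.sum_congr rfl fun c _ => ?_
        rw [← Finset.mul_sum, wiener, ← (Equiv.subRight c).sum_comp fun d => ‖hat g d‖]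
        rfl
    _ = _ := by rw [← Finset.sum_mul, ← wiener]

lemma wiener_star (f : Lattice M → ℂ) : wiener (star f) = wiener f := by
  rw [wiener, wiener, ← Equiv.sum_comp (Equiv.neg (ZMod (2 * M)))]
  simp only [Equiv.neg_apply, hat_star, neg_neg, RCLike.norm_conj]

lemma wiener_prop (α t : ℝ) (f : Lattice M → ℂ) : wiener (prop α M t f) = wiener f := by
  simp only [wiener, hat, fourier_prop, norm_mul, norm_propSymbol, one_mul]

/-- **Young's inequality** `ℓ¹ * ℓ² ⊆ ℓ²` on a finite group. -/
lemma young_finite {G : Type*} [AddCommGroup G] [Fintype G] (a b : G → ℝ) (ha : ∀ c, 0 ≤ a c) :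
    ∑ e, (∑ c, a c * b (e - c)) ^ 2 ≤ (∑ c, a c) ^ 2 * ∑ c, b c ^ 2 := by
  have h1 : ∀ e, (∑ c, a c * b (e - c)) ^ 2 ≤ (∑ c, a c) * ∑ c, a c * b (e - c) ^ 2 := by
    intro e
    have := Finset.sum_mul_sq_le_sq_mul_sq Finset.univ (fun c => Real.sqrt (a c))
      fun c => Real.sqrt (a c) * b (e - c)
    have e1 : ∀ c, Real.sqrt (a c) * (Real.sqrt (a c) * b (e - c)) = a c * b (e - c) := fun c => by
      rw [← mul_assoc, Real.mul_self_sqrt (ha c)]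
    have e2 : ∀ c, (Real.sqrt (a c) * b (e - c)) ^ 2 = a c * b (e - c) ^ 2 := fun c => by
      rw [mul_pow, Real.sq_sqrt (ha c)]
    have e3 : ∀ c, Real.sqrt (a c) ^ 2 = a c := fun c => Real.sq_sqrt (ha c)
    simpa only [e1, e2, e3] using this
  calc _ ≤ ∑ e, (∑ c, a c) * ∑ c, a c * b (e - c) ^ 2 := Finset.sum_le_sum fun e _ => h1 e
    _ = (∑ c, a c) * ∑ c, a c * ∑ d, b d ^ 2 := by
        rw [← Finset.mul_sum, Finset.sum_comm]
        congr 1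
        refine Finset.sum_congr rfl fun c _ => ?_
        rw [← Finset.mul_sum, ← (Equiv.subRight c).sum_comp fun d => b d ^ 2]
        rfl
    _ = _ := by rw [← Finset.sum_mul]; ring

lemma bracket_rpow_add_le (hs : 0 ≤ s) (c d : ZMod (2 * M)) :
    bracket (absRes (c + d)) ^ s ≤
      2 ^ s * (bracket (absRes c) ^ s + bracket (absRes d) ^ s) := by
  have key : ∀ x y : ℝ, 0 ≤ y → y ≤ x → ∀ z : ℝ, 0 ≤ z → z ≤ x + y →
      bracket z ^ s ≤ 2 ^ s * bracket x ^ s := by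
    intro x y hy hyx z hz hzx
    have hb : bracket z ≤ 2 * bracket x := by
      rw [bracket, bracket, abs_of_nonneg hz, abs_of_nonneg (hy.trans hyx)]
      refine Real.sqrt_le_iff.2 ⟨by positivity, ?_⟩
      rw [mul_pow, Real.sq_sqrt (by positivity)]
      nlinarith
    calc _ ≤ (2 * bracket x) ^ s := Real.rpow_le_rpow (bracket_pos z).le hb hs
      _ = _ := Real.mul_rpow (by norm_num) (bracket_pos x).le
  have h0 := absRes_add_le c d
  have p1 := Real.rpow_pos_of_pos (bracket_pos (absRes c)) s
  have p2 := Real.rpow_pos_of_pos (bracket_pos (absRes d)) s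
  have p3 : (0 : ℝ) < 2 ^ s := by positivity
  rcases le_total (absRes c) (absRes d) with h | h
  · have := key _ _ (absRes_nonneg c) h (absRes (c + d)) (absRes_nonneg _) (by linarith)
    nlinarith
  · have := key _ _ (absRes_nonneg d) h _ (absRes_nonneg _) h0
    nlinarith

/-- The weight at e is dominated by the weights at c and e - c. Each of the two resulting
convolutions has one factor in ℓ¹ and the weighted one in ℓ², so Young's inequality applies. -/
lemma sobolevNorm_mul_le_wiener (hs : 0 ≤ s) (f g : Lattice M → ℂ) :
    sobolevNorm s M (f * g) ≤ 2 * 2 ^ s *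
      (sobolevNorm s M f * wiener g + wiener f * sobolevNorm s M g) := by
  have hpi := Real.pi_pos
  have hA := sobolevNorm_nonneg s f
  have hA' := sobolevNorm_nonneg s g
  have hW := wiener_nonneg f
  have hW' := wiener_nonneg g
  have p3 : (0 : ℝ) < 2 ^ s := by positivity
  refine le_of_sq_le_sq ?_ (by positivity)
  set w : ZMod (2 * M) → ℝ := fun c => bracket (absRes c) ^ s with hw
  have hw0 : ∀ c, 0 ≤ w c := fun c => Real.rpow_nonneg (bracket_pos _).le s
  have hw2 : ∀ c, bracket (absRes c) ^ (2 * s) = w c ^ 2 := fun c => by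
    rw [hw, ← Real.rpow_natCast, ← Real.rpow_mul (bracket_pos _).le, mul_comm]; norm_cast
  have hsq : ∀ u : Lattice M → ℂ, sobolevNorm s M u ^ 2 =
      2 * Real.pi * ∑ c, (w c * ‖hat u c‖) ^ 2 := fun u => by
    rw [sobolevNorm_sq_hat]; simp only [hw2, mul_pow]
  have hpt : ∀ e, (w e * ‖hat (f * g) e‖) ^ 2 ≤ (2 ^ s) ^ 2 * (2 *
      ((∑ c, ‖hat g c‖ * (w (e - c) * ‖hat f (e - c)‖)) ^ 2 +
       (∑ c, ‖hat f c‖ * (w (e - c) * ‖hat g (e - c)‖)) ^ 2)) := by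
    intro e
    have h1 : w e * ‖hat (f * g) e‖ ≤ 2 ^ s *
      ((∑ c, ‖hat g c‖ * (w (e - c) * ‖hat f (e - c)‖)) +
       (∑ c, ‖hat f c‖ * (w (e - c) * ‖hat g (e - c)‖))) := by
      have e1 : ∑ c, ‖hat g c‖ * (w (e - c) * ‖hat f (e - c)‖) =
          ∑ c, ‖hat g (e - c)‖ * (w c * ‖hat f c‖) := by
        rw [← (Equiv.subLeft e).sum_comp]
        simp only [Equiv.subLeft_apply, sub_sub_cancel]
      rw [hat_mul, e1, ← Finset.sum_add_distrib, Finset.mul_sum]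
      refine (mul_le_mul_of_nonneg_left (norm_sum_le _ _) (hw0 e)).trans ?_
      rw [Finset.mul_sum]
      refine Finset.sum_le_sum fun c _ => ?_
      have h2 := bracket_rpow_add_le hs c (e - c)
      rw [add_sub_cancel] at h2
      rw [norm_mul]
      calc _ ≤ 2 ^ s * (w c + w (e - c)) * (‖hat f c‖ * ‖hat g (e - c)‖) := by gcongr
        _ = _ := by ring
    have h0 : 0 ≤ w e * ‖hat (f * g) e‖ := mul_nonneg (hw0 e) (norm_nonneg _)
    refine (pow_le_pow_left₀ h0 h1 2).trans ?_
    rw [mul_pow]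
    gcongr
    exact add_sq_le
  have y1 := young_finite (fun c => ‖hat g c‖) (fun c => w c * ‖hat f c‖) fun c => norm_nonneg _
  have y2 := young_finite (fun c => ‖hat f c‖) (fun c => w c * ‖hat g c‖) fun c => norm_nonneg _
  have htot : ∑ e, (w e * ‖hat (f * g) e‖) ^ 2 ≤ (2 ^ s) ^ 2 * (2 *
      (wiener g ^ 2 * ∑ c, (w c * ‖hat f c‖) ^ 2 + wiener f ^ 2 * ∑ c, (w c * ‖hat g c‖) ^ 2)) := by
    refine (Finset.sum_le_sum fun e _ => hpt e).trans ?_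
    rw [← Finset.mul_sum, ← Finset.mul_sum, Finset.sum_add_distrib]
    gcongr
    · exact y1
    · exact y2
  calc sobolevNorm s M (f * g) ^ 2 ≤ 2 * Real.pi * ((2 ^ s) ^ 2 * (2 *
      (wiener g ^ 2 * ∑ c, (w c * ‖hat f c‖) ^ 2 +
        wiener f ^ 2 * ∑ c, (w c * ‖hat g c‖) ^ 2))) := by rw [hsq]; gcongr
    _ = (2 ^ s) ^ 2 * 2 * ((sobolevNorm s M f * wiener g) ^ 2 +
        (wiener f * sobolevNorm s M g) ^ 2) := by
        rw [mul_pow, mul_pow, hsq f, hsq g]; ring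
    _ ≤ (2 ^ s) ^ 2 * 4 *
        (sobolevNorm s M f * wiener g + wiener f * sobolevNorm s M g) ^ 2 := by
        rw [mul_assoc, mul_assoc]
        refine mul_le_mul_of_nonneg_left ?_ (by positivity)
        have : 0 ≤ sobolevNorm s M f * wiener g := by positivity
        have : 0 ≤ wiener f * sobolevNorm s M g := by positivity
        nlinarith
    _ = _ := by ring

/-- Cauchy–Schwarz: ⟨k⟩^{-s} is square summable over ℤ for s > 1/2, so the constant does not see M.
-/
lemma wiener_le_sobolevNorm (hs : 1 / 2 < s) :
    ∃ C : ℝ, 0 < C ∧ ∀ (M : ℕ) [NeZero M] (f : Lattice M → ℂ),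
      wiener f ≤ C * sobolevNorm s M f := by
  have hsum : Summable fun n : ℤ => |(n : ℝ)| ^ (-(2 * s)) :=
    Real.summable_abs_int_rpow (by linarith)
  set Z := ∑' n : ℤ, |(n : ℝ)| ^ (-(2 * s)) with hZ
  have hZ0 : 0 ≤ Z := tsum_nonneg fun n => Real.rpow_nonneg (abs_nonneg _) _
  have hpi := Real.pi_pos
  refine ⟨Real.sqrt (1 + Z), by positivity, fun M _ f => ?_⟩
  have hA := sobolevNorm_nonneg s f
  refine le_of_sq_le_sq ?_ (by positivity)
  rw [mul_pow, Real.sq_sqrt (by linarith)]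
  have hb : ∑ c : ZMod (2 * M), bracket (absRes c) ^ (-(2 * s)) ≤ 1 + Z := by
    rw [← sum_lattice_eq]
    simp only [absRes_res, bracket_abs]
    have h1 : ∀ k : ℤ, bracket (k : ℝ) ^ (-(2 * s)) ≤
        (if k = 0 then 1 else 0) + |(k : ℝ)| ^ (-(2 * s)) := by
      intro k
      by_cases h : k = 0
      · have : bracket ((0 : ℤ) : ℝ) = 1 := by simp [bracket]
        rw [h, this, Real.one_rpow, if_pos rfl]
        have := Real.rpow_nonneg (abs_nonneg ((0 : ℤ) : ℝ)) (-(2 * s))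
        linarith
      · rw [if_neg h, zero_add]
        have : 0 < |(k : ℝ)| := abs_pos.2 (by exact_mod_cast h)
        exact Real.rpow_le_rpow_of_nonpos this (le_bracket _) (by linarith)
    rw [Finset.sum_coe_sort (Finset.Ico (-(M : ℤ)) M) fun k : ℤ => bracket (k : ℝ) ^ (-(2 * s))]
    refine (Finset.sum_le_sum fun k _ => h1 k).trans ?_
    rw [Finset.sum_add_distrib]
    refine add_le_add ?_ (hsum.sum_le_tsum _ fun k _ => Real.rpow_nonneg (abs_nonneg _) _)
    rw [Finset.sum_ite_eq']
    split_ifs <;> norm_num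
  have hcs := Finset.sum_mul_sq_le_sq_mul_sq Finset.univ
    (fun c : ZMod (2 * M) => bracket (absRes c) ^ (-s))
    fun c => bracket (absRes c) ^ s * ‖hat f c‖
  have e1 : ∀ c : ZMod (2 * M), bracket (absRes c) ^ (-s) * (bracket (absRes c) ^ s * ‖hat f c‖) =
      ‖hat f c‖ := fun c => by
    rw [← mul_assoc, ← Real.rpow_add (bracket_pos _)]; simp
  have e2 : ∀ c : ZMod (2 * M), (bracket (absRes c) ^ (-s)) ^ 2 =
      bracket (absRes c) ^ (-(2 * s)) := fun c => by
    rw [← Real.rpow_natCast, ← Real.rpow_mul (bracket_pos _).le]; congr 1; push_cast; ring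
  have e3 : ∀ c : ZMod (2 * M), (bracket (absRes c) ^ s * ‖hat f c‖) ^ 2 =
      bracket (absRes c) ^ (2 * s) * ‖hat f c‖ ^ 2 := fun c => by
    rw [mul_pow, ← Real.rpow_natCast, ← Real.rpow_mul (bracket_pos _).le]
    congr 2; push_cast; ring
  simp only [e1, e2, e3] at hcs
  have hS : 0 ≤ ∑ c : ZMod (2 * M), bracket (absRes c) ^ (2 * s) * ‖hat f c‖ ^ 2 :=
    Finset.sum_nonneg fun c _ => mul_nonneg (Real.rpow_nonneg (bracket_pos _).le _) (by positivity)
  calc wiener f ^ 2 ≤ _ := hcs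
    _ ≤ (1 + Z) * ∑ c : ZMod (2 * M), bracket (absRes c) ^ (2 * s) * ‖hat f c‖ ^ 2 := by gcongr
    _ ≤ (1 + Z) * (2 * Real.pi *
        ∑ c : ZMod (2 * M), bracket (absRes c) ^ (2 * s) * ‖hat f c‖ ^ 2) := by
        gcongr
        exact le_mul_of_one_le_left hS (by linarith [Real.pi_gt_three])
    _ = _ := by rw [sobolevNorm_sq_hat]

end FDNLS
end

/-! ### Fractional Leibniz rule through dyadic differences -/

noncomputable section
set_option linter.unusedSectionVars false
namespace FDNLS
open Set MeasureTheory

variable {M : ℕ} [NeZero M] {s : ℝ}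

/-- Translation of a lattice function. -/
def shift (d : ZMod (2 * M)) (f : Lattice M → ℂ) : Lattice M → ℂ :=
  fun x => f ((resEquiv M).symm (res x + d))

lemma hat_shift (d : ZMod (2 * M)) (f : Lattice M → ℂ) (c : ZMod (2 * M)) :
    hat (shift d f) c = hat f c * chr (c * d) := by
  revert c
  rw [← funext_iff]
  refine hat_unique fun x => ?_
  rw [shift, eq_sum_hat f]
  refine Finset.sum_congr rfl fun c _ => ?_
  rw [← resEquiv_apply ((resEquiv M).symm _), Equiv.apply_symm_apply, mul_add, chr_add]
  ring

/-- The square of the `L²_h` norm. -/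
def normSq (f : Lattice M → ℂ) : ℝ := mesh M * ∑ x, ‖f x‖ ^ 2

lemma normSq_nonneg (f : Lattice M → ℂ) : 0 ≤ normSq f :=
  mul_nonneg (mesh_pos M).le (Finset.sum_nonneg fun _ _ => by positivity)

lemma normSq_eq (f : Lattice M → ℂ) : normSq f = 2 * Real.pi * ∑ c, ‖hat f c‖ ^ 2 := by
  have hpi := Real.pi_pos
  rw [normSq, norm_sq_eq_fourier, ← sum_lattice_eq, Finset.mul_sum, Finset.mul_sum]
  refine Finset.sum_congr rfl fun k _ => ?_
  rw [hat_res, norm_mul, norm_inv, Complex.norm_real, Real.norm_eq_abs,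
    abs_of_pos (by linarith : 0 < 2 * Real.pi)]
  field_simp

lemma normSq_mul_le (f g : Lattice M → ℂ) : normSq (f * g) ≤ ‖f‖ ^ 2 * normSq g := by
  rw [normSq, normSq, mul_left_comm, Finset.mul_sum (a := ‖f‖ ^ 2)]
  refine mul_le_mul_of_nonneg_left (Finset.sum_le_sum fun x _ => ?_) (mesh_pos M).le
  rw [Pi.mul_apply, norm_mul, mul_pow]
  gcongr
  exact norm_le_pi_norm f x

lemma normSq_add_le (f g : Lattice M → ℂ) : normSq (f + g) ≤ 2 * (normSq f + normSq g) := by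
  simp only [normSq]
  rw [← mul_add, mul_left_comm, ← Finset.sum_add_distrib, Finset.mul_sum (a := (2 : ℝ))]
  refine mul_le_mul_of_nonneg_left (Finset.sum_le_sum fun x _ => ?_) (mesh_pos M).le
  exact (pow_le_pow_left₀ (norm_nonneg _) (norm_add_le _ _) 2).trans add_sq_le

lemma norm_shift_le (d : ZMod (2 * M)) (f : Lattice M → ℂ) : ‖shift d f‖ ≤ ‖f‖ :=
  (pi_norm_le_iff_of_nonempty _).2 fun _ => norm_le_pi_norm f _

/-- The product rule for differences leaves the undifferenced factor in sup norm. This is the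
Leibniz rule; what remains is to compare H^s with a norm made of differences. -/
lemma normSq_shift_mul_sub_le (d : ZMod (2 * M)) (f g : Lattice M → ℂ) :
    normSq (shift d (f * g) - f * g) ≤
      2 * (‖f‖ ^ 2 * normSq (shift d g - g) + ‖g‖ ^ 2 * normSq (shift d f - f)) := by
  have e : shift d (f * g) - f * g = shift d f * (shift d g - g) + g * (shift d f - f) := by
    funext x
    simp only [shift, Pi.sub_apply, Pi.mul_apply, Pi.add_apply]
    ring
  rw [e]
  refine (normSq_add_le _ _).trans ?_
  have h1 := normSq_mul_le (shift d f) (shift d g - g)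
  have h2 := normSq_mul_le g (shift d f - f)
  have h3 : ‖shift d f‖ ^ 2 * normSq (shift d g - g) ≤ ‖f‖ ^ 2 * normSq (shift d g - g) :=
    mul_le_mul_of_nonneg_right (pow_le_pow_left₀ (norm_nonneg _) (norm_shift_le d f) 2)
      (normSq_nonneg _)
  linarith

lemma normSq_shift_sub (j : ℕ) (f : Lattice M → ℂ) :
    normSq (shift ((2 ^ j : ℕ) : ZMod (2 * M)) f - f) = 2 * Real.pi *
      ∑ c, (2 * |Real.sin (mesh M * 2 ^ j * absRes c / 2)|) ^ 2 * ‖hat f c‖ ^ 2 := by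
  rw [normSq_eq]
  congr 1
  refine Finset.sum_congr rfl fun c _ => ?_
  rw [hat_sub, Pi.sub_apply, hat_shift, ← mul_sub_one, norm_mul, mul_pow, mul_comm]
  congr 2
  have h := exp_eq_chr_int (M := M) c.valMinAbs (2 ^ j : ℕ)
  rw [ZMod.coe_valMinAbs, show (((2 ^ j : ℕ) : ℤ) : ZMod (2 * M)) = ((2 ^ j : ℕ) : ZMod (2 * M)) from
    Int.cast_natCast _] at h
  rw [← h, Complex.norm_exp_I_mul_ofReal_sub_one, norm_mul, Real.norm_two, Real.norm_eq_abs]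
  congr 1
  rw [absRes, Nat.cast_natAbs, Int.cast_abs]
  rcases abs_choice ((c.valMinAbs : ℤ) : ℝ) with h | h
  · rw [h]; congr 2; push_cast; ring
  · rw [h, mul_neg, neg_div, Real.sin_neg, abs_neg]; congr 2; push_cast; ring

/-- A telescoping bound for two-sided geometric sums. -/
lemma sum_min_geometric_le {l y : ℝ} (hl : 1 < l) (hy : 0 < y) (J : ℕ) :
    ∑ j ∈ Finset.range J, min (y * l ^ j) (1 / (y * l ^ j)) ≤ 2 * (1 + l) / (l - 1) := by
  have hl0 : 0 < l - 1 := by linarith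
  -- Each term is dominated by the increment of z/(1+z) from z to lz. Along a geometric sequence
  -- these increments telescope and total at most 1.
  have key : ∀ z : ℝ, 0 < z → min z (1 / z) ≤
      2 * (1 + l) / (l - 1) * (l * z / (1 + l * z) - z / (1 + z)) := by
    intro z hz
    have e : l * z / (1 + l * z) - z / (1 + z) = z * (l - 1) / ((1 + l * z) * (1 + z)) := by
      field_simp; ring
    rw [e, div_mul_div_comm, le_div_iff₀ (by positivity)]
    rcases le_total z 1 with h | h
    · have h1 : (1 + l * z) * (1 + z) ≤ (1 + l) * 2 := by
        refine mul_le_mul ?_ (by linarith) (by linarith) (by linarith)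
        nlinarith
      calc _ ≤ z * ((l - 1) * ((1 + l) * 2)) := by
            refine mul_le_mul (min_le_left _ _) ?_ (by positivity) hz.le
            gcongr
        _ = _ := by ring
    · have h1 : (1 + l * z) * (1 + z) ≤ ((1 + l) * z) * (2 * z) := by
        refine mul_le_mul ?_ (by linarith) (by linarith) (by positivity)
        nlinarith
      calc _ ≤ 1 / z * ((l - 1) * (((1 + l) * z) * (2 * z))) := by
            refine mul_le_mul (min_le_right _ _) ?_ (by positivity) (by positivity)
            gcongr
        _ = _ := by field_simp
  have hpos : ∀ j : ℕ, 0 < y * l ^ j := fun j => by positivity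
  calc _ ≤ ∑ j ∈ Finset.range J, 2 * (1 + l) / (l - 1) *
        (y * l ^ (j + 1) / (1 + y * l ^ (j + 1)) - y * l ^ j / (1 + y * l ^ j)) := by
        refine Finset.sum_le_sum fun j _ => ?_
        have := key _ (hpos j)
        rwa [show l * (y * l ^ j) = y * l ^ (j + 1) by ring] at this
    _ = 2 * (1 + l) / (l - 1) * (y * l ^ J / (1 + y * l ^ J) - y * l ^ 0 / (1 + y * l ^ 0)) := by
        rw [← Finset.mul_sum, Finset.sum_range_sub (fun j => y * l ^ j / (1 + y * l ^ j))]
    _ ≤ 2 * (1 + l) / (l - 1) * 1 := by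
        refine mul_le_mul_of_nonneg_left ?_ (by positivity)
        have h1 : y * l ^ J / (1 + y * l ^ J) ≤ 1 := by
          rw [div_le_one (by have := hpos J; linarith)]; linarith
        have h2 : 0 ≤ y * l ^ 0 / (1 + y * l ^ 0) := by positivity
        linarith
    _ = _ := mul_one _

/-- The squared sine factor is at most 4 and at most x². For x ≤ 1 the condition s ≤ 1/2 gives x² ≤
x^{4s}, which yields decay at both ends. -/
lemma rpow_mul_sin_sq_le {x : ℝ} (hs0 : 0 < s) (hs : s ≤ 1 / 2) (hx : 0 < x) :
    x ^ (-(2 * s)) * (2 * |Real.sin (x / 2)|) ^ 2 ≤ 4 * min (x ^ (2 * s)) (1 / x ^ (2 * s)) := by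
  have hp : 0 < x ^ (2 * s) := by positivity
  have hm : x ^ (-(2 * s)) = 1 / x ^ (2 * s) := by rw [Real.rpow_neg hx.le, one_div]
  have h1 : (2 * |Real.sin (x / 2)|) ^ 2 ≤ 4 := by
    have := Real.abs_sin_le_one (x / 2)
    nlinarith [abs_nonneg (Real.sin (x / 2))]
  have h2 : (2 * |Real.sin (x / 2)|) ^ 2 ≤ x ^ 2 := by
    refine pow_le_pow_left₀ (by positivity) ?_ 2
    have := Real.abs_sin_le_abs (x := x / 2)
    rw [abs_of_pos (by positivity : 0 < x / 2)] at this
    linarith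
  have hsq : 0 ≤ (2 * |Real.sin (x / 2)|) ^ 2 := by positivity
  rw [hm]
  rcases le_total x 1 with h | h
  · have hx1 : x ^ (2 : ℕ) ≤ x ^ (2 * s) * x ^ (2 * s) := by
      rw [← Real.rpow_add hx, ← Real.rpow_natCast]
      exact Real.rpow_le_rpow_of_exponent_ge hx h (by push_cast; linarith)
    have hle1 : x ^ (2 * s) ≤ 1 := Real.rpow_le_one hx.le h (by linarith)
    rw [min_eq_left (hle1.trans (by rw [le_div_iff₀ hp]; linarith)), one_div_mul_eq_div,
      div_le_iff₀ hp]
    nlinarith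
  · have hge1 : 1 ≤ x ^ (2 * s) := Real.one_le_rpow h (by linarith)
    rw [min_eq_right (le_trans (by rw [div_le_iff₀ hp]; linarith) hge1), mul_comm]
    gcongr

/-- The dyadic difference seminorm, squared. -/
def diffSq (s : ℝ) (f : Lattice M → ℂ) : ℝ :=
  -- The needed scales satisfy 2^j ≤ M. Larger ones do no harm, because the symbol is bounded by a
  -- two-sided geometric series.
  ∑ j ∈ Finset.range (M + 1), (mesh M * 2 ^ j) ^ (-(2 * s)) *
    normSq (shift ((2 ^ j : ℕ) : ZMod (2 * M)) f - f)

/-- The Fourier symbol of the dyadic difference seminorm. -/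
def diffSymbol (s : ℝ) (M : ℕ) (r : ℝ) : ℝ :=
  ∑ j ∈ Finset.range (M + 1), (mesh M * 2 ^ j) ^ (-(2 * s)) *
    (2 * |Real.sin (mesh M * 2 ^ j * r / 2)|) ^ 2

lemma diffSq_eq (s : ℝ) (f : Lattice M → ℂ) :
    diffSq s f = 2 * Real.pi * ∑ c, diffSymbol s M (absRes c) * ‖hat f c‖ ^ 2 := by
  simp only [diffSq, normSq_shift_sub, diffSymbol, Finset.sum_mul, Finset.mul_sum]
  rw [Finset.sum_comm]
  exact Finset.sum_congr rfl fun c _ => Finset.sum_congr rfl fun j _ => by ring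

/-- In terms of x = h2^j r the summands are bounded along a geometric sequence, so
`sum_min_geometric_le` gives a bound independent of the number of scales. -/
lemma diffSymbol_le (hs0 : 0 < s) (hs : s ≤ 1 / 2) {r : ℝ} (hr : 0 ≤ r) :
    diffSymbol s M r ≤
      4 * (2 * (1 + 2 ^ (2 * s)) / ((2 : ℝ) ^ (2 * s) - 1)) * bracket r ^ (2 * s) := by
  have hh := mesh_pos M
  have hl : (1 : ℝ) < 2 ^ (2 * s) := Real.one_lt_rpow (by norm_num) (by linarith)
  have hl0 : (0 : ℝ) < 2 ^ (2 * s) - 1 := by linarith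
  have hb0 := bracket_pos r
  rcases hr.eq_or_lt with rfl | hr
  · simp only [diffSymbol, mul_zero, zero_div, Real.sin_zero, abs_zero]
    norm_num
    positivity
  have hterm : ∀ j : ℕ, (mesh M * 2 ^ j) ^ (-(2 * s)) *
      (2 * |Real.sin (mesh M * 2 ^ j * r / 2)|) ^ 2 ≤ r ^ (2 * s) *
      (4 * min ((mesh M * r) ^ (2 * s) * ((2 : ℝ) ^ (2 * s)) ^ j)
        (1 / ((mesh M * r) ^ (2 * s) * ((2 : ℝ) ^ (2 * s)) ^ j))) := by
    intro j
    have hx : 0 < mesh M * 2 ^ j * r := by positivity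
    have h1 := rpow_mul_sin_sq_le hs0 hs hx
    have e1 : (mesh M * 2 ^ j) ^ (-(2 * s)) =
        r ^ (2 * s) * (mesh M * 2 ^ j * r) ^ (-(2 * s)) := by
      rw [Real.mul_rpow (by positivity) hr.le, mul_left_comm, ← Real.rpow_add hr]
      simp
    have e2 : (mesh M * 2 ^ j * r) ^ (2 * s) =
        (mesh M * r) ^ (2 * s) * ((2 : ℝ) ^ (2 * s)) ^ j := by
      rw [show mesh M * 2 ^ j * r = mesh M * r * 2 ^ j by ring,
        Real.mul_rpow (by positivity) (by positivity), ← Real.rpow_natCast, ← Real.rpow_natCast,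
        ← Real.rpow_mul (by norm_num), ← Real.rpow_mul (by norm_num), mul_comm (j : ℝ)]
    rw [e1, mul_assoc, ← e2]
    gcongr
  have hsum := sum_min_geometric_le hl (by positivity : 0 < (mesh M * r) ^ (2 * s)) (M + 1)
  have hrb : r ^ (2 * s) ≤ bracket r ^ (2 * s) := by
    refine Real.rpow_le_rpow hr.le ?_ (by linarith)
    exact (le_abs_self r).trans (le_bracket r)
  calc diffSymbol s M r ≤ ∑ j ∈ Finset.range (M + 1), r ^ (2 * s) *
      (4 * min ((mesh M * r) ^ (2 * s) * ((2 : ℝ) ^ (2 * s)) ^ j)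
        (1 / ((mesh M * r) ^ (2 * s) * ((2 : ℝ) ^ (2 * s)) ^ j))) :=
        Finset.sum_le_sum fun j _ => hterm j
    _ ≤ r ^ (2 * s) * (4 * (2 * (1 + 2 ^ (2 * s)) / ((2 : ℝ) ^ (2 * s) - 1))) := by
        rw [← Finset.mul_sum, ← Finset.mul_sum]
        gcongr
    _ ≤ bracket r ^ (2 * s) * (4 * (2 * (1 + 2 ^ (2 * s)) / ((2 : ℝ) ^ (2 * s) - 1))) := by
        gcongr
    _ = _ := by ring

/-- A single scale suffices: if r2^j ≤ M < r2^{j+1}, then h2^j r lies in [π/2, π] and the sine of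
its half is bounded below. -/
lemma le_diffSymbol (hs0 : 0 < s) {r : ℕ} (hr : 0 < r) (hrM : r ≤ M) :
    (r : ℝ) ^ (2 * s) ≤ Real.pi ^ (2 * s) * diffSymbol s M r := by
  have hh := mesh_pos M
  have hpi := Real.pi_pos
  have hr' : (0 : ℝ) < r := by exact_mod_cast hr
  obtain ⟨j, hj1, hj2⟩ : ∃ j : ℕ, r * 2 ^ j ≤ M ∧ M < r * 2 ^ (j + 1) := by
    have h0 : ∃ j : ℕ, M < r * 2 ^ (j + 1) := ⟨M, by
      have : M + 1 < 2 ^ (M + 1) := Nat.lt_two_pow_self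
      nlinarith⟩
    classical
    refine ⟨Nat.find h0, ?_, Nat.find_spec h0⟩
    by_contra! h
    rcases Nat.eq_zero_or_pos (Nat.find h0) with h1 | h1
    · rw [h1] at h; omega
    · have := Nat.find_min h0 (m := Nat.find h0 - 1) (by omega)
      rw [Nat.sub_add_cancel h1] at this
      exact this h
  have hjM : j ∈ Finset.range (M + 1) := by
    rw [Finset.mem_range]
    have h1 : j < 2 ^ j := Nat.lt_two_pow_self
    have h2 : 2 ^ j ≤ r * 2 ^ j := Nat.le_mul_of_pos_left _ hr
    omega
  have hj1' : (r : ℝ) * 2 ^ j ≤ M := by exact_mod_cast hj1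
  have hj2' : (M : ℝ) < r * 2 ^ j * 2 := by
    have : (M : ℝ) < r * 2 ^ (j + 1) := by exact_mod_cast hj2
    rw [pow_succ] at this; linarith
  have hx1 : mesh M * 2 ^ j * r ≤ Real.pi := by
    have := mul_le_mul_of_nonneg_left hj1' hh.le
    rw [mesh_mul] at this; linarith
  have hx2 : Real.pi / 2 ≤ mesh M * 2 ^ j * r := by
    have := mul_lt_mul_of_pos_left hj2' hh
    rw [mesh_mul] at this; linarith
  have hsin : 1 ≤ (2 * |Real.sin (mesh M * 2 ^ j * r / 2)|) ^ 2 := by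
    have h1 := Real.mul_le_sin (x := mesh M * 2 ^ j * r / 2) (by positivity) (by linarith)
    have h2 : 1 / 2 ≤ 2 / Real.pi * (mesh M * 2 ^ j * r / 2) := by
      rw [div_mul_eq_mul_div, le_div_iff₀ hpi]; linarith
    have h3 : 1 ≤ 2 * |Real.sin (mesh M * 2 ^ j * r / 2)| := by
      have := le_abs_self (Real.sin (mesh M * 2 ^ j * r / 2))
      linarith
    exact one_le_pow₀ h3
  have hterm : (mesh M * 2 ^ j) ^ (-(2 * s)) * (2 * |Real.sin (mesh M * 2 ^ j * r / 2)|) ^ 2 ≤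
      diffSymbol s M r :=
    Finset.single_le_sum (f := fun j => (mesh M * 2 ^ j) ^ (-(2 * s)) *
      (2 * |Real.sin (mesh M * 2 ^ j * r / 2)|) ^ 2) (fun i _ => by positivity) hjM
  have hpow : (r : ℝ) ^ (2 * s) ≤ Real.pi ^ (2 * s) * (mesh M * 2 ^ j) ^ (-(2 * s)) := by
    rw [Real.rpow_neg (by positivity), ← div_eq_mul_inv, ← Real.div_rpow hpi.le (by positivity)]
    refine Real.rpow_le_rpow hr'.le ?_ (by linarith)
    rw [le_div_iff₀ (by positivity)]
    linarith
  calc _ ≤ Real.pi ^ (2 * s) * ((mesh M * 2 ^ j) ^ (-(2 * s)) * 1) := by rw [mul_one]; exact hpow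
    _ ≤ Real.pi ^ (2 * s) * ((mesh M * 2 ^ j) ^ (-(2 * s)) *
        (2 * |Real.sin (mesh M * 2 ^ j * r / 2)|) ^ 2) := by gcongr
    _ ≤ _ := by gcongr

lemma absRes_eq (c : ZMod (2 * M)) : ∃ r : ℕ, absRes c = r ∧ r ≤ M := by
  refine ⟨_, rfl, ?_⟩
  have := ZMod.natAbs_valMinAbs_le c
  omega

lemma bracket_rpow_le_diffSymbol (hs0 : 0 < s) (hs : s ≤ 1 / 2) (c : ZMod (2 * M)) :
    bracket (absRes c) ^ (2 * s) ≤
      2 * Real.pi ^ (2 * s) * (1 + diffSymbol s M (absRes c)) := by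
  have hpi := Real.pi_gt_three
  have hP : 1 ≤ Real.pi ^ (2 * s) := Real.one_le_rpow (by linarith) (by linarith)
  have hD0 : 0 ≤ diffSymbol s M (absRes c) :=
    Finset.sum_nonneg fun j _ => by have := mesh_pos M; positivity
  obtain ⟨r, hr, hrM⟩ := absRes_eq c
  rw [hr] at hD0 ⊢
  rcases Nat.eq_zero_or_pos r with rfl | hr0
  · have : bracket ((0 : ℕ) : ℝ) = 1 := by simp [bracket]
    rw [this, Real.one_rpow]
    nlinarith
  · have h1 := le_diffSymbol hs0 hr0 hrM
    have hr1 : (1 : ℝ) ≤ r := by exact_mod_cast hr0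
    have hb : bracket r ≤ 2 * r := by
      rw [bracket, abs_of_nonneg (by linarith)]
      refine Real.sqrt_le_iff.2 ⟨by positivity, ?_⟩
      nlinarith
    have h2 : bracket r ^ (2 * s) ≤ 2 * (r : ℝ) ^ (2 * s) := by
      calc _ ≤ (2 * (r : ℝ)) ^ (2 * s) := Real.rpow_le_rpow (bracket_pos _).le hb (by linarith)
        _ = (2 : ℝ) ^ (2 * s) * (r : ℝ) ^ (2 * s) := Real.mul_rpow (by norm_num) (by linarith)
        _ ≤ (2 : ℝ) ^ (1 : ℝ) * (r : ℝ) ^ (2 * s) := by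
          gcongr
          · norm_num
          · linarith
        _ = _ := by rw [Real.rpow_one]
    nlinarith

lemma sobolevNorm_sq_le_diffSq (hs0 : 0 < s) (hs : s ≤ 1 / 2) (f : Lattice M → ℂ) :
    sobolevNorm s M f ^ 2 ≤ 2 * Real.pi ^ (2 * s) * (normSq f + diffSq s f) := by
  have hpi := Real.pi_pos
  rw [sobolevNorm_sq_hat, normSq_eq, diffSq_eq, ← mul_add, ← Finset.sum_add_distrib, mul_left_comm,
    Finset.mul_sum (a := 2 * Real.pi ^ (2 * s))]
  refine mul_le_mul_of_nonneg_left (Finset.sum_le_sum fun c _ => ?_) (by positivity)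
  have := mul_le_mul_of_nonneg_right (bracket_rpow_le_diffSymbol hs0 hs c)
    (by positivity : 0 ≤ ‖hat f c‖ ^ 2)
  linarith

lemma diffSq_le_sobolevNorm_sq (hs0 : 0 < s) (hs : s ≤ 1 / 2) (f : Lattice M → ℂ) :
    diffSq s f ≤
      4 * (2 * (1 + 2 ^ (2 * s)) / ((2 : ℝ) ^ (2 * s) - 1)) * sobolevNorm s M f ^ 2 := by
  have hpi := Real.pi_pos
  rw [sobolevNorm_sq_hat, diffSq_eq, mul_left_comm, Finset.mul_sum (s := Finset.univ)
    (a := 4 * (2 * (1 + 2 ^ (2 * s)) / ((2 : ℝ) ^ (2 * s) - 1)))]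
  refine mul_le_mul_of_nonneg_left (Finset.sum_le_sum fun c _ => ?_) (by positivity)
  have := mul_le_mul_of_nonneg_right (diffSymbol_le (M := M) hs0 hs (absRes_nonneg c))
    (by positivity : 0 ≤ ‖hat f c‖ ^ 2)
  linarith

lemma normSq_le_sobolevNorm_sq (hs0 : 0 < s) (f : Lattice M → ℂ) :
    normSq f ≤ sobolevNorm s M f ^ 2 := by
  have hpi := Real.pi_pos
  rw [sobolevNorm_sq_hat, normSq_eq]
  refine mul_le_mul_of_nonneg_left (Finset.sum_le_sum fun c _ => ?_) (by positivity)
  exact le_mul_of_one_le_left (by positivity)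
    (Real.one_le_rpow (one_le_bracket _) (by linarith))

/-- The fractional **Leibniz rule** with sup norms, uniform in the mesh size. -/
lemma sobolevNorm_mul_le_sup (hs0 : 0 < s) (hs : s ≤ 1 / 2) :
    ∃ C : ℝ, 0 < C ∧ ∀ (M : ℕ) [NeZero M] (f g : Lattice M → ℂ), sobolevNorm s M (f * g) ≤
      C * (sobolevNorm s M f * ‖g‖ + ‖f‖ * sobolevNorm s M g) := by
  have hpi := Real.pi_pos
  have hl : (1 : ℝ) < 2 ^ (2 * s) := Real.one_lt_rpow (by norm_num) (by linarith)
  have hl0 : (0 : ℝ) < 2 ^ (2 * s) - 1 := by linarith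
  set D := 4 * (2 * (1 + 2 ^ (2 * s)) / ((2 : ℝ) ^ (2 * s) - 1)) with hD
  have hD0 : 0 < D := by positivity
  set K := 2 * Real.pi ^ (2 * s) * (1 + 2 * D) with hK
  have hK0 : 0 < K := by positivity
  refine ⟨Real.sqrt K, Real.sqrt_pos.2 hK0, fun M _ f g => ?_⟩
  have hA := sobolevNorm_nonneg s f
  have hA' := sobolevNorm_nonneg s g
  refine le_of_sq_le_sq ?_ (by positivity)
  have hdiff : diffSq s (f * g) ≤ 2 * (‖f‖ ^ 2 * diffSq s g + ‖g‖ ^ 2 * diffSq s f) := by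
    simp only [diffSq, Finset.mul_sum]
    rw [← Finset.sum_add_distrib, Finset.mul_sum]
    refine Finset.sum_le_sum fun j _ => ?_
    have h0 : 0 ≤ (mesh M * 2 ^ j) ^ (-(2 * s)) := by have := mesh_pos M; positivity
    have := mul_le_mul_of_nonneg_left
      (normSq_shift_mul_sub_le ((2 ^ j : ℕ) : ZMod (2 * M)) f g) h0
    linarith
  have h1 := sobolevNorm_sq_le_diffSq hs0 hs (f * g)
  have h2 := (normSq_mul_le f g).trans
    (mul_le_mul_of_nonneg_left (normSq_le_sobolevNorm_sq hs0 g) (by positivity))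
  have h3 := mul_le_mul_of_nonneg_left (diffSq_le_sobolevNorm_sq hs0 hs g)
    (by positivity : 0 ≤ ‖f‖ ^ 2)
  have h4 := mul_le_mul_of_nonneg_left (diffSq_le_sobolevNorm_sq hs0 hs f)
    (by positivity : 0 ≤ ‖g‖ ^ 2)
  calc sobolevNorm s M (f * g) ^ 2
      ≤ 2 * Real.pi ^ (2 * s) * (normSq (f * g) + diffSq s (f * g)) := h1
    _ ≤ 2 * Real.pi ^ (2 * s) * (‖f‖ ^ 2 * sobolevNorm s M g ^ 2 +
        2 * (‖f‖ ^ 2 * (D * sobolevNorm s M g ^ 2) + ‖g‖ ^ 2 * (D * sobolevNorm s M f ^ 2))) := by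
        gcongr
        linarith
    _ ≤ K * ((sobolevNorm s M f * ‖g‖) ^ 2 + (‖f‖ * sobolevNorm s M g) ^ 2) := by
        rw [hK, mul_assoc (2 * Real.pi ^ (2 * s))]
        refine mul_le_mul_of_nonneg_left ?_ (by positivity)
        have : 0 ≤ (sobolevNorm s M f * ‖g‖) ^ 2 := by positivity
        linarith
    _ ≤ K * (sobolevNorm s M f * ‖g‖ + ‖f‖ * sobolevNorm s M g) ^ 2 := by
        refine mul_le_mul_of_nonneg_left ?_ hK0.le
        have : 0 ≤ sobolevNorm s M f * ‖g‖ := by positivity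
        have : 0 ≤ ‖f‖ * sobolevNorm s M g := by positivity
        nlinarith
    _ = _ := by rw [mul_pow, Real.sq_sqrt hK0.le]

end FDNLS
end

/-! ### Integral inequalities in time -/

noncomputable section
set_option linter.unusedSectionVars false
namespace FDNLS
open Set MeasureTheory

/-! ### Seminorms and integrals -/

section Seminorm

variable {E : Type*} [NormedAddCommGroup E] [NormedSpace ℂ E] [FiniteDimensional ℂ E]

lemma continuous_seminorm (p : Seminorm ℂ E) : Continuous p := by
  have : FiniteDimensional ℝ E := FiniteDimensional.trans ℝ ℂ E
  exact p.convexOn.locallyLipschitz.continuous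

@[fun_prop]
lemma _root_.Continuous.seminorm_comp {X : Type*} [TopologicalSpace X] (p : Seminorm ℂ E) {f : X → E}
    (hf : Continuous f) : Continuous fun x => p (f x) :=
  (continuous_seminorm p).comp hf

/-- A seminorm is convex and, in finite dimension, continuous, so Jensen applies to the average over
the interval; homogeneity removes the normalisation. -/
lemma seminorm_integral_le (p : Seminorm ℂ E) {f : ℝ → E} (hf : Continuous f) {a b : ℝ}
    (hab : a ≤ b) : p (∫ t in a..b, f t) ≤ ∫ t in a..b, p (f t) := by
  rcases hab.eq_or_lt with rfl | hab
  · simp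
  have : CompleteSpace E := FiniteDimensional.complete ℂ E
  have hp := continuous_seminorm p
  have hμ : (volume (Ioc a b)).toReal = b - a := by
    rw [Real.volume_Ioc, ENNReal.toReal_ofReal (by linarith)]
  have : NeZero (volume.restrict (Ioc a b)) := ⟨by
    rw [Ne, Measure.restrict_eq_zero, Real.volume_Ioc]
    simpa using hab⟩
  have key := p.convexOn.map_average_le (μ := volume.restrict (Ioc a b)) (f := f)
    hp.continuousOn isClosed_univ (by simp)
    (hf.integrableOn_Ioc) ((hp.comp hf).integrableOn_Ioc)
  rw [setAverage_eq, setAverage_eq, measureReal_def, hμ, ← intervalIntegral.integral_of_le hab.le,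
    ← intervalIntegral.integral_of_le hab.le, smul_eq_mul] at key
  have h : (b - a)⁻¹ • (∫ t in a..b, f t) = (((b - a)⁻¹ : ℝ) : ℂ) • ∫ t in a..b, f t := by
    rw [Complex.coe_smul]
  rw [h, map_smul_eq_mul, Complex.norm_real, Real.norm_eq_abs,
    abs_of_pos (inv_pos.2 (by linarith))] at key
  exact le_of_mul_le_mul_left key (inv_pos.2 (by linarith))

end Seminorm

/-! ### Elementary integral inequalities -/

/-- The left side is the tangent line of x⁶ at r. -/
lemma sub_le_pow_six {x r : ℝ} (hx : 0 ≤ x) (hr : 0 ≤ r) : 6 * r ^ 5 * x - 5 * r ^ 6 ≤ x ^ 6 := by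
  have h : x ^ 6 - (6 * r ^ 5 * x - 5 * r ^ 6) =
      (x - r) ^ 2 * (x ^ 4 + 2 * x ^ 3 * r + 3 * x ^ 2 * r ^ 2 + 4 * x * r ^ 3 + 5 * r ^ 4) := by
    ring
  have : 0 ≤ (x - r) ^ 2 * (x ^ 4 + 2 * x ^ 3 * r + 3 * x ^ 2 * r ^ 2 + 4 * x * r ^ 3 + 5 * r ^ 4) :=
    by positivity
  linarith

/-- Jensen's inequality for the sixth power with respect to the weight `g`. -/
lemma integral_pow_six_le {β g : ℝ → ℝ} (hβ : Continuous β) (hg : Continuous g)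
    (hβ0 : ∀ τ, 0 ≤ β τ) (hg0 : ∀ τ, 0 < g τ) {t : ℝ} (ht : 0 ≤ t) :
    (∫ τ in (0 : ℝ)..t, β τ) ^ 6 ≤
      (∫ τ in (0 : ℝ)..t, g τ) ^ 5 * ∫ τ in (0 : ℝ)..t, β τ ^ 6 / g τ ^ 5 := by
  rcases ht.eq_or_lt with rfl | ht'
  · simp
  set I := ∫ τ in (0 : ℝ)..t, β τ with hI
  set G := ∫ τ in (0 : ℝ)..t, g τ with hG
  have hG0 : 0 < G := intervalIntegral.intervalIntegral_pos_of_pos (hg.intervalIntegrable _ _) hg0 ht'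
  have hI0 : 0 ≤ I := intervalIntegral.integral_nonneg ht fun τ _ => hβ0 τ
  have hq : Continuous fun τ => β τ ^ 6 / g τ ^ 5 :=
    (hβ.pow 6).div (hg.pow 5) fun τ => (pow_pos (hg0 τ) 5).ne'
  -- The tangent line inequality at the weighted mean I/G, integrated against g.
  have h := intervalIntegral.integral_mono_on (μ := volume) (f := fun τ => 6 * (I / G) ^ 5 * β τ - 5 * (I / G) ^ 6 * g τ)
    (g := fun τ => β τ ^ 6 / g τ ^ 5) ht
    (Continuous.intervalIntegrable (by fun_prop) _ _) (hq.intervalIntegrable _ _) fun τ _ => by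
      have h1 := sub_le_pow_six (div_nonneg (hβ0 τ) (hg0 τ).le) (div_nonneg hI0 hG0.le)
      have h2 := mul_le_mul_of_nonneg_right h1 (hg0 τ).le
      have := (hg0 τ).ne'
      calc _ = (6 * (I / G) ^ 5 * (β τ / g τ) - 5 * (I / G) ^ 6) * g τ := by field_simp
        _ ≤ (β τ / g τ) ^ 6 * g τ := h2
        _ = _ := by field_simp
  rw [intervalIntegral.integral_sub (Continuous.intervalIntegrable (by fun_prop) _ _)
    (Continuous.intervalIntegrable (by fun_prop) _ _), intervalIntegral.integral_const_mul,
    intervalIntegral.integral_const_mul, ← hI, ← hG] at h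
  calc I ^ 6 = G ^ 5 * (6 * (I / G) ^ 5 * I - 5 * (I / G) ^ 6 * G) := by field_simp; ring
    _ ≤ _ := by gcongr

/-- **Minkowski's integral inequality** in `L⁶`, for a positive majorant. -/
lemma integral_pow_six_integral_le_of_pos {b : ℝ → ℝ → ℝ} {g : ℝ → ℝ} {S t : ℝ}
    (hb : Continuous (Function.uncurry b)) (hb0 : ∀ r τ, 0 ≤ b r τ) (hg : Continuous g)
    (hg0 : ∀ τ, 0 < g τ) (ht : 0 ≤ t)
    (h : ∀ τ, ∫ r in (0 : ℝ)..t, b r τ ^ 6 ≤ (S * g τ) ^ 6) :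
    ∫ r in (0 : ℝ)..t, (∫ τ in (0 : ℝ)..t, b r τ) ^ 6 ≤ (S * ∫ τ in (0 : ℝ)..t, g τ) ^ 6 := by
  set G := ∫ τ in (0 : ℝ)..t, g τ with hG
  have hG0 : 0 ≤ G := intervalIntegral.integral_nonneg ht fun τ _ => (hg0 τ).le
  have hq : Continuous (Function.uncurry fun r τ : ℝ => b r τ ^ 6 / g τ ^ 5) :=
    (hb.pow 6).div ((hg.comp continuous_snd).pow 5) fun q => (pow_pos (hg0 q.2) 5).ne'
  have hbr : ∀ r, Continuous (b r) := fun r => hb.comp (Continuous.prodMk_right r)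
  have hinner : ∀ τ, ∫ r in (0 : ℝ)..t, b r τ ^ 6 / g τ ^ 5 ≤ S ^ 6 * g τ := by
    intro τ
    rw [intervalIntegral.integral_div, div_le_iff₀ (pow_pos (hg0 τ) 5)]
    exact (h τ).trans (le_of_eq (by ring))
  calc _ ≤ ∫ r in (0 : ℝ)..t, G ^ 5 * ∫ τ in (0 : ℝ)..t, b r τ ^ 6 / g τ ^ 5 := by
        refine intervalIntegral.integral_mono_on ht ?_ ?_ fun r _ =>
          integral_pow_six_le (hbr r) hg (hb0 r) hg0 ht
        · exact ((intervalIntegral.continuous_parametric_intervalIntegral_of_continuous'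
            hb 0 t).pow 6).intervalIntegrable _ _
        · exact ((intervalIntegral.continuous_parametric_intervalIntegral_of_continuous'
            hq 0 t).const_mul (G ^ 5)).intervalIntegrable _ _
    _ = G ^ 5 * ∫ τ in (0 : ℝ)..t, ∫ r in (0 : ℝ)..t, b r τ ^ 6 / g τ ^ 5 := by
        rw [intervalIntegral.integral_const_mul, intervalIntegral_swap hq ht]
    _ ≤ G ^ 5 * ∫ τ in (0 : ℝ)..t, S ^ 6 * g τ := by
        refine mul_le_mul_of_nonneg_left ?_ (by positivity)
        refine intervalIntegral.integral_mono_on ht ?_ ((hg.const_mul _).intervalIntegrable _ _)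
          fun τ _ => hinner τ
        exact (intervalIntegral.continuous_parametric_intervalIntegral_of_continuous'
          (f := fun τ r => b r τ ^ 6 / g τ ^ 5) (hq.comp continuous_swap) 0 t).intervalIntegrable
          _ _
    _ = _ := by rw [intervalIntegral.integral_const_mul, ← hG]; ring

/-- **Minkowski's integral inequality** in `L⁶`. -/
lemma integral_pow_six_integral_le {b : ℝ → ℝ → ℝ} {g : ℝ → ℝ} {S t : ℝ}
    (hb : Continuous (Function.uncurry b)) (hb0 : ∀ r τ, 0 ≤ b r τ) (hg : Continuous g)
    (hg0 : ∀ τ, 0 ≤ g τ) (hS : 0 ≤ S) (ht : 0 ≤ t)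
    (h : ∀ τ, ∫ r in (0 : ℝ)..t, b r τ ^ 6 ≤ (S * g τ) ^ 6) :
    ∫ r in (0 : ℝ)..t, (∫ τ in (0 : ℝ)..t, b r τ) ^ 6 ≤ (S * ∫ τ in (0 : ℝ)..t, g τ) ^ 6 := by
  -- A majorant with zeros is replaced by g + ε, which may be divided by, and ε tends to 0.
  have hlim : Filter.Tendsto (fun ε : ℝ => (S * ((∫ τ in (0 : ℝ)..t, g τ) + t * ε)) ^ 6)
      (nhdsWithin 0 (Ioi 0)) (nhds ((S * ((∫ τ in (0 : ℝ)..t, g τ) + t * 0)) ^ 6)) :=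
    (Continuous.tendsto (by fun_prop) 0).mono_left nhdsWithin_le_nhds
  rw [mul_zero, add_zero] at hlim
  refine ge_of_tendsto hlim (eventually_nhdsWithin_of_forall fun ε hε => ?_)
  have hε' : 0 < ε := hε
  have := integral_pow_six_integral_le_of_pos (g := fun τ => g τ + ε) (S := S) hb hb0
    (hg.add continuous_const) (fun τ => by have := hg0 τ; positivity) ht fun τ =>
      (h τ).trans (by have := hg0 τ; gcongr; linarith)
  rwa [intervalIntegral.integral_add (hg.intervalIntegrable _ _)
    intervalIntegrable_const, intervalIntegral.integral_const, sub_zero, smul_eq_mul] at this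

/-- Hölder's inequality in time for the product of two functions in `L⁶`. -/
lemma integral_mul_le_of_pow_six {f g : ℝ → ℝ} (hf : Continuous f) (hg : Continuous g)
    {t θ X Y : ℝ} (ht : 0 ≤ t) (hθ : 0 < θ) (htθ : t ≤ θ ^ 3)
    (hX : 0 < X) (hY : 0 < Y) (hfX : ∫ τ in (0 : ℝ)..t, f τ ^ 6 ≤ X ^ 6)
    (hgY : ∫ τ in (0 : ℝ)..t, g τ ^ 6 ≤ Y ^ 6) :
    ∫ τ in (0 : ℝ)..t, f τ * g τ ≤ X * Y * θ ^ 2 := by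
  -- AM–GM, sharp when θx² = 1. Integrated over t ≤ θ³ it yields θ², the Hölder factor, up to
  -- normalisation by X and Y.
  have key : ∀ x : ℝ, x ^ 2 ≤ θ ^ 2 / 3 * x ^ 6 + 2 / (3 * θ) := by
    intro x
    have h : θ ^ 2 / 3 * x ^ 6 + 2 / (3 * θ) - x ^ 2 =
        (θ * x ^ 2 - 1) ^ 2 * (θ * x ^ 2 + 2) / (3 * θ) := by field_simp; ring
    have : 0 ≤ (θ * x ^ 2 - 1) ^ 2 * (θ * x ^ 2 + 2) / (3 * θ) := by positivity
    linarith
  have h := intervalIntegral.integral_mono_on (μ := volume) (f := fun τ => f τ * g τ)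
    (g := fun τ => X * Y * θ ^ 2 / (6 * X ^ 6) * f τ ^ 6 + X * Y * θ ^ 2 / (6 * Y ^ 6) * g τ ^ 6 +
      2 * (X * Y) / (3 * θ)) ht (Continuous.intervalIntegrable (by fun_prop) _ _)
    (Continuous.intervalIntegrable (by fun_prop) _ _) fun τ _ => by
      have h1 := key (f τ / X)
      have h2 := key (g τ / Y)
      have h3 := two_mul_le_add_sq (f τ / X) (g τ / Y)
      have h4 : f τ / X * (g τ / Y) ≤ θ ^ 2 / 6 * (f τ / X) ^ 6 + θ ^ 2 / 6 * (g τ / Y) ^ 6 +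
        2 / (3 * θ) := by
        have : 2 / (3 * θ) = (2 / (3 * θ) + 2 / (3 * θ)) / 2 := by ring
        linarith
      calc f τ * g τ = X * Y * (f τ / X * (g τ / Y)) := by field_simp
        _ ≤ X * Y * (θ ^ 2 / 6 * (f τ / X) ^ 6 + θ ^ 2 / 6 * (g τ / Y) ^ 6 + 2 / (3 * θ)) := by
          gcongr
        _ = _ := by rw [div_pow, div_pow]; ring
  refine h.trans ?_
  rw [intervalIntegral.integral_add (Continuous.intervalIntegrable (by fun_prop) _ _)
      (Continuous.intervalIntegrable (by fun_prop) _ _),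
    intervalIntegral.integral_add (Continuous.intervalIntegrable (by fun_prop) _ _)
      (Continuous.intervalIntegrable (by fun_prop) _ _), intervalIntegral.integral_const_mul,
    intervalIntegral.integral_const_mul, intervalIntegral.integral_const, smul_eq_mul, sub_zero]
  calc _ ≤ X * Y * θ ^ 2 / (6 * X ^ 6) * X ^ 6 + X * Y * θ ^ 2 / (6 * Y ^ 6) * Y ^ 6 +
        θ ^ 3 * (2 * (X * Y) / (3 * θ)) := by gcongr
    _ = _ := by field_simp; ring

end FDNLS
end

/-! ### Linear and cubic estimates for an admissible pair -/

noncomputable section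
set_option linter.unusedSectionVars false
namespace FDNLS
open Set MeasureTheory

variable {M : ℕ} [NeZero M] {α S K : ℝ} {A B : Seminorm ℂ (Lattice M → ℂ)}

/-- A pair of seminorms for which the contraction argument closes: `A` is invariant under the flow,
`B` is controlled by `A` in `L⁶` of unit time, and both satisfy product estimates. -/
structure Admissible (α S K : ℝ) (A B : Seminorm ℂ (Lattice M → ℂ)) : Prop where
  pos : 0 < S
  one_le : 1 ≤ K
  map_prop : ∀ t f, A (prop α M t f) = A f
  strichartz : ∀ f, ∫ t in (0 : ℝ)..1, B (prop α M t f) ^ 6 ≤ (S * A f) ^ 6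
  mul_le : ∀ f g, A (f * g) ≤ K * (A f * B g + B f * A g)
  mul_le' : ∀ f g, B (f * g) ≤ B f * B g
  map_star : ∀ f, A (star f) = A f
  map_star' : ∀ f, B (star f) = B f

namespace Admissible

lemma continuous_prop_right (p : Seminorm ℂ (Lattice M → ℂ)) {X : Type*} [TopologicalSpace X]
    {φ : X → ℝ} {v : X → Lattice M → ℂ} (hφ : Continuous φ) (hv : Continuous v) :
    Continuous fun x => p (prop α M (φ x) (v x)) :=
  (continuous_seminorm p).comp (((continuous_prop α).comp hφ).clm_apply hv)

/-- The **inhomogeneous Strichartz estimate**. -/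
lemma integral_duhamel_le (h : Admissible α S K A B) {F : ℝ → Lattice M → ℂ} {g : ℝ → ℝ}
    (hF : Continuous F) (hg : Continuous g) (hFg : ∀ τ, A (F τ) ≤ g τ)
    {t : ℝ} (ht : 0 ≤ t) (ht1 : t ≤ 1) :
    ∫ r in (0 : ℝ)..t, (∫ τ in (0 : ℝ)..t, B (prop α M r (prop α M (-τ) (F τ)))) ^ 6 ≤
      (S * ∫ τ in (0 : ℝ)..t, g τ) ^ 6 := by
  have hS := h.pos
  have hv : Continuous fun τ => prop α M (-τ) (F τ) := continuous_prop_apply continuous_neg hF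
  refine integral_pow_six_integral_le (b := fun r τ => B (prop α M r (prop α M (-τ) (F τ))))
    (continuous_prop_right B continuous_fst (hv.comp continuous_snd)) (fun _ _ => apply_nonneg B _)
    hg (fun τ => (apply_nonneg A _).trans (hFg τ)) hS.le ht fun τ => ?_
  have hc : Continuous fun r => B (prop α M r (prop α M (-τ) (F τ))) ^ 6 :=
    (continuous_prop_right B continuous_id continuous_const).pow 6
  calc _ ≤ ∫ r in (0 : ℝ)..1, B (prop α M r (prop α M (-τ) (F τ))) ^ 6 :=
        intervalIntegral.integral_mono_interval le_rfl ht ht1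
          (Filter.Eventually.of_forall fun r => by positivity) (hc.intervalIntegrable _ _)
    _ ≤ (S * A (F τ)) ^ 6 := by
        have := h.strichartz (prop α M (-τ) (F τ))
        rwa [h.map_prop] at this
    _ ≤ (S * g τ) ^ 6 := by
        have := apply_nonneg A (F τ)
        have := hFg τ
        gcongr

/-- The estimates for the linear equation with a forcing term. -/
lemma linear_estimates (h : Admissible α S K A B) {μ : ℝ} (hμ : |μ| = 1) {T : ℝ} (hT1 : T ≤ 1)
    {u₀ : Lattice M → ℂ} {u F : ℝ → Lattice M → ℂ} {g : ℝ → ℝ} (hu : Continuous u)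
    (hF : Continuous F) (hg : Continuous g) (hFg : ∀ τ, A (F τ) ≤ g τ)
    (hD : ∀ t ∈ Icc 0 T, u t = prop α M t
      (u₀ - (Complex.I * (μ : ℂ)) • ∫ τ in (0 : ℝ)..t, prop α M (-τ) (F τ)))
    {a : ℝ} (ha : A u₀ ≤ a) {t : ℝ} (ht : t ∈ Icc 0 T) :
    A (u t) ≤ a + ∫ τ in (0 : ℝ)..t, g τ ∧
      ∫ τ in (0 : ℝ)..t, B (u τ) ^ 6 ≤ (2 * S * (a + ∫ τ in (0 : ℝ)..t, g τ)) ^ 6 := by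
  have hc : ‖Complex.I * (μ : ℂ)‖ = 1 := by simp [hμ]
  have hS := h.pos
  have hv : Continuous fun τ => prop α M (-τ) (F τ) := continuous_prop_apply continuous_neg hF
  have ha0 : 0 ≤ a := (apply_nonneg A u₀).trans ha
  have hG0 : 0 ≤ ∫ τ in (0 : ℝ)..t, g τ :=
    intervalIntegral.integral_nonneg ht.1 fun τ _ => (apply_nonneg A _).trans (hFg τ)
  constructor
  · rw [hD t ht, h.map_prop]
    refine (map_sub_le_add A _ _).trans (add_le_add ha ?_)
    rw [map_smul_eq_mul, hc, one_mul]
    refine (seminorm_integral_le A hv ht.1).trans ?_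
    refine intervalIntegral.integral_mono_on ht.1
      (((continuous_seminorm A).comp hv).intervalIntegrable _ _) (hg.intervalIntegrable _ _)
      fun τ _ => ?_
    rw [h.map_prop]
    exact hFg τ
  · have hβ : Continuous fun q : ℝ × ℝ => B (prop α M q.1 (prop α M (-q.2) (F q.2))) :=
      continuous_prop_right B continuous_fst (hv.comp continuous_snd)
    have hβr : ∀ r, Continuous fun τ => B (prop α M r (prop α M (-τ) (F τ))) := fun r =>
      continuous_prop_right B continuous_const hv
    have h1c : Continuous fun r => B (prop α M r u₀) ^ 6 :=
      (continuous_prop_right B continuous_id continuous_const).pow 6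
    have h2c : Continuous fun r =>
        (∫ τ in (0 : ℝ)..t, B (prop α M r (prop α M (-τ) (F τ)))) ^ 6 :=
      (intervalIntegral.continuous_parametric_intervalIntegral_of_continuous'
        (f := fun r τ => B (prop α M r (prop α M (-τ) (F τ)))) hβ 0 t).pow 6
    -- The upper limit r of the Duhamel integral is enlarged to t after the seminorm has entered.
    -- The integrand then factors through the free flow, and Minkowski applies.
    have hpt : ∀ r ∈ Icc 0 t, B (u r) ^ 6 ≤ 32 * (B (prop α M r u₀) ^ 6 +
        (∫ τ in (0 : ℝ)..t, B (prop α M r (prop α M (-τ) (F τ)))) ^ 6) := by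
      intro r hr
      have h0 : 0 ≤ ∫ τ in (0 : ℝ)..t, B (prop α M r (prop α M (-τ) (F τ))) :=
        intervalIntegral.integral_nonneg ht.1 fun τ _ => apply_nonneg B _
      have h1 : B (u r) ≤ B (prop α M r u₀) +
          ∫ τ in (0 : ℝ)..t, B (prop α M r (prop α M (-τ) (F τ))) := by
        rw [hD r ⟨hr.1, hr.2.trans ht.2⟩, map_sub, map_smul]
        refine (map_sub_le_add B _ _).trans (add_le_add le_rfl ?_)
        rw [map_smul_eq_mul, hc, one_mul, ← ContinuousLinearMap.intervalIntegral_comp_comm _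
          (hv.intervalIntegrable _ _)]
        refine (seminorm_integral_le B ((prop α M r).continuous.comp hv) hr.1).trans ?_
        exact intervalIntegral.integral_mono_interval le_rfl hr.1 hr.2
          (Filter.Eventually.of_forall fun τ => apply_nonneg B _) ((hβr r).intervalIntegrable _ _)
      refine (pow_le_pow_left₀ (apply_nonneg B _) h1 6).trans ?_
      exact (add_pow_le (apply_nonneg B _) h0 6).trans (by norm_num)
    refine (intervalIntegral.integral_mono_on ht.1
      ((((continuous_seminorm B).comp hu).pow 6).intervalIntegrable _ _)
      (Continuous.intervalIntegrable ((h1c.add h2c).const_mul 32) _ _) hpt).trans ?_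
    simp only [Pi.add_apply]
    rw [intervalIntegral.integral_const_mul, intervalIntegral.integral_add
      (h1c.intervalIntegrable _ _) (h2c.intervalIntegrable _ _)]
    have e1 : ∫ r in (0 : ℝ)..t, B (prop α M r u₀) ^ 6 ≤ (S * a) ^ 6 := by
      refine (intervalIntegral.integral_mono_interval le_rfl ht.1 (ht.2.trans hT1)
        (Filter.Eventually.of_forall fun r => by positivity) (h1c.intervalIntegrable _ _)).trans ?_
      refine (h.strichartz u₀).trans ?_
      have := apply_nonneg A u₀
      gcongr
    have e2 := h.integral_duhamel_le hF hg hFg ht.1 (ht.2.trans hT1)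
    set G := ∫ τ in (0 : ℝ)..t, g τ
    have e3 : a ^ 6 + G ^ 6 ≤ (a + G) ^ 6 := pow_add_pow_le ha0 hG0 (by norm_num)
    calc _ ≤ 32 * ((S * a) ^ 6 + (S * G) ^ 6) := by gcongr
      _ = 32 * S ^ 6 * (a ^ 6 + G ^ 6) := by ring
      _ ≤ 32 * S ^ 6 * (a + G) ^ 6 := by gcongr
      -- Passing to 64 = 2⁶ makes the constant the sixth power of 2S.
      _ ≤ 64 * S ^ 6 * (a + G) ^ 6 := by gcongr; norm_num
      _ = _ := by ring

lemma mul_mul_le (h : Admissible α S K A B) (f g k : Lattice M → ℂ) :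
    A (f * g * k) ≤ K ^ 2 * (A f * B g * B k + B f * A g * B k + B f * B g * A k) := by
  have hK := h.one_le
  have := apply_nonneg A f
  have := apply_nonneg A g
  have := apply_nonneg A k
  have := apply_nonneg B f
  have := apply_nonneg B g
  have := apply_nonneg B k
  calc _ ≤ K * (A (f * g) * B k + B (f * g) * A k) := h.mul_le _ _
    _ ≤ K * (K * (A f * B g + B f * A g) * B k + B f * B g * A k) := by
        gcongr
        · exact h.mul_le f g
        · exact h.mul_le' f g
    _ ≤ K * (K * (A f * B g + B f * A g) * B k + K * (B f * B g * A k)) := by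
        have : B f * B g * A k ≤ K * (B f * B g * A k) :=
          le_mul_of_one_le_left (by positivity) hK
        gcongr
    _ = _ := by ring

end Admissible

lemma cubic_eq (f : Lattice M → ℂ) : cubic M f = f * star f * f := by
  funext x
  simp only [cubic, Pi.mul_apply, Pi.star_apply, RCLike.star_def, Complex.mul_conj,
    Complex.normSq_eq_norm_sq]

namespace Admissible

lemma cubic_le (h : Admissible α S K A B) (f : Lattice M → ℂ) :
    A (cubic M f) ≤ 3 * K ^ 2 * (B f * B f * A f) := by
  rw [cubic_eq]
  refine (h.mul_mul_le _ _ _).trans (le_of_eq ?_)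
  rw [h.map_star, h.map_star']
  ring

/-- The difference of the cubic terms telescopes into three products, each with one factor f - g or
its conjugate. The mixed product B(f)B(g) is then replaced by half the sum of squares. -/
lemma cubic_sub_le (h : Admissible α S K A B) (f g : Lattice M → ℂ) :
    A (cubic M f - cubic M g) ≤ 2 * K ^ 2 * ((B f * B f + B g * B g) * A (f - g) +
      (A f + A g) * ((B f + B g) * B (f - g))) := by
  have e : cubic M f - cubic M g =
      f * star f * (f - g) + f * star (f - g) * g + (f - g) * star g * g := by
    rw [cubic_eq, cubic_eq, star_sub]
    ring
  have h1 := h.mul_mul_le f (star f) (f - g)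
  have h2 := h.mul_mul_le f (star (f - g)) g
  have h3 := h.mul_mul_le (f - g) (star g) g
  rw [h.map_star, h.map_star'] at h1 h2 h3
  rw [e]
  refine ((map_add_le_add A _ _).trans (add_le_add_left (map_add_le_add A _ _) _)).trans ?_
  have hK : 0 ≤ K ^ 2 := sq_nonneg K
  have p1 := apply_nonneg A f
  have p2 := apply_nonneg A g
  have p3 := apply_nonneg A (f - g)
  have p4 := apply_nonneg B f
  have p5 := apply_nonneg B g
  have p6 := apply_nonneg B (f - g)
  have h4 : 0 ≤ (B f - B g) ^ 2 * A (f - g) := by positivity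
  have h5 : 0 ≤ (B f * B f + B g * B g) * A (f - g) := by positivity
  have h6 : 0 ≤ (A f * B g + A g * B f) * B (f - g) := by positivity
  refine (add_le_add (add_le_add h1 h2) h3).trans ?_
  rw [← mul_add, ← mul_add, mul_comm 2, mul_assoc (K ^ 2)]
  refine mul_le_mul_of_nonneg_left ?_ hK
  nlinarith

end Admissible

end FDNLS
end

/-! ### A priori and difference bounds -/

noncomputable section
set_option linter.unusedSectionVars false
namespace FDNLS
open Set MeasureTheory

variable {M : ℕ} [NeZero M] {α S K : ℝ} {A B : Seminorm ℂ (Lattice M → ℂ)}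

namespace Admissible

/-- The a priori bound, by continuity in time. -/
lemma a_priori (h : Admissible α S K A B) {μ : ℝ} (hμ : |μ| = 1) {T θ : ℝ} (hT1 : T ≤ 1)
    (hθ : 0 < θ) (hTθ : T ≤ θ ^ 3) {u₀ : Lattice M → ℂ} {u : ℝ → Lattice M → ℂ} (hu : Continuous u)
    (hD : Duhamel α μ T u₀ u) {a : ℝ} (ha0 : 0 < a) (ha : A u₀ ≤ a)
    (hsmall : 20 * K * S * (θ * a) ≤ 1) {t : ℝ} (ht : t ∈ Icc 0 T) :
    A (u t) ≤ 2 * a ∧ ∫ τ in (0 : ℝ)..t, B (u τ) ^ 6 ≤ (4 * S * a) ^ 6 := by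
  have hS := h.pos
  have hK : 0 < K := by linarith [h.one_le]
  have hAc : Continuous fun τ => A (u τ) := (continuous_seminorm A).comp hu
  have hBc : Continuous fun τ => B (u τ) := (continuous_seminorm B).comp hu
  set g : ℝ → ℝ := fun τ => 3 * K ^ 2 * (B (u τ) * B (u τ) * A (u τ)) with hgdef
  have hg : Continuous g := by rw [hgdef]; fun_prop
  have hgi : ∀ a b : ℝ, IntervalIntegrable g volume a b := fun a b => hg.intervalIntegrable a b
  have hg0 : ∀ τ, 0 ≤ g τ := fun τ => by
    have := apply_nonneg A (u τ)
    have := apply_nonneg B (u τ)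
    positivity
  have hlin : ∀ t ∈ Icc 0 T, _ := fun t ht => h.linear_estimates hμ hT1 hu
    (continuous_cubic.comp hu) hg (fun τ => h.cubic_le (u τ)) hD ha ht
  have hXc : Continuous fun t => a + ∫ τ in (0 : ℝ)..t, g τ :=
    continuous_const.add (intervalIntegral.continuous_primitive hgi 0)
  -- Continuity argument: X = a + ∫g starts at a, so to exceed 2a it must equal 2a at some r. There
  -- the linear estimates bound A by 2a and the L⁶ norm of B by 4Sa, and Hölder gives ∫g ≤
  -- 96(KSθa)²a ≤ (96/400)a < a, a contradiction.
  have hX : ∀ t ∈ Icc 0 T, a + ∫ τ in (0 : ℝ)..t, g τ ≤ 2 * a := by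
    intro t ht
    by_contra! hlt
    obtain ⟨r, hr, hrX⟩ := intermediate_value_Icc ht.1 hXc.continuousOn
      (show 2 * a ∈ Icc _ _ from ⟨by simp; linarith, hlt.le⟩)
    simp only at hrX
    have hrT : r ∈ Icc 0 T := ⟨hr.1, hr.2.trans ht.2⟩
    have hB := (hlin r hrT).2
    rw [hrX] at hB
    have h2 := integral_mul_le_of_pow_six hBc hBc hr.1 hθ (hrT.2.trans hTθ)
      (by positivity) (by positivity) hB hB
    have h1 : ∫ τ in (0 : ℝ)..r, g τ ≤ ∫ τ in (0 : ℝ)..r, 6 * K ^ 2 * a * (B (u τ) * B (u τ)) := by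
      refine intervalIntegral.integral_mono_on hr.1 (hgi _ _)
        (Continuous.intervalIntegrable (by fun_prop) _ _) fun τ hτ => ?_
      have h3 := (hlin τ ⟨hτ.1, hτ.2.trans hrT.2⟩).1
      have h4 : ∫ τ in (0 : ℝ)..τ, g τ ≤ ∫ τ in (0 : ℝ)..r, g τ :=
        intervalIntegral.integral_mono_interval le_rfl hτ.1 hτ.2
          (Filter.Eventually.of_forall hg0) (hgi _ _)
      have h5 : A (u τ) ≤ 2 * a := by linarith
      have p1 : 0 ≤ B (u τ) := apply_nonneg B _
      calc g τ ≤ 3 * K ^ 2 * (B (u τ) * B (u τ) * (2 * a)) := by simp only [hgdef]; gcongr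
        _ = _ := by ring
    replace h1 := h1.trans_eq (intervalIntegral.integral_const_mul _ _)
    have h6 : ∫ τ in (0 : ℝ)..r, g τ ≤ 96 * (K * S * (θ * a)) ^ 2 * a := by
      have p2 : 0 ≤ 6 * K ^ 2 * a := by positivity
      refine h1.trans ((mul_le_mul_of_nonneg_left h2 p2).trans (le_of_eq ?_))
      ring
    have h7 : (K * S * (θ * a)) ^ 2 ≤ (1 / 20) ^ 2 :=
      pow_le_pow_left₀ (by positivity) (by linarith) 2
    have h8 : 96 * (K * S * (θ * a)) ^ 2 * a ≤ 96 * (1 / 20) ^ 2 * a := by gcongr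
    linarith
  have h0 : 0 ≤ ∫ τ in (0 : ℝ)..t, g τ := intervalIntegral.integral_nonneg ht.1 fun τ _ => hg0 τ
  refine ⟨(hlin t ht).1.trans (hX t ht), (hlin t ht).2.trans ?_⟩
  refine pow_le_pow_left₀ (by positivity) ?_ 6
  have := mul_le_mul_of_nonneg_left (hX t ht) hS.le
  linarith

/-- The bound for the difference of two solutions. -/
lemma difference (h : Admissible α S K A B) {μ : ℝ} (hμ : |μ| = 1) {T θ : ℝ} (hT0 : 0 ≤ T)
    (hT1 : T ≤ 1) (hθ : 0 < θ) (hTθ : T ≤ θ ^ 3) {u₀ v₀ : Lattice M → ℂ} {u v : ℝ → Lattice M → ℂ}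
    (hu : Continuous u) (hv : Continuous v)
    (hDu : Duhamel α μ T u₀ u) (hDv : Duhamel α μ T v₀ v) {a b : ℝ} (ha0 : 0 < a) (hb0 : 0 < b)
    (hau : A u₀ ≤ a) (hav : A v₀ ≤ a) (hb : A (u₀ - v₀) ≤ b)
    (hsmall : 20 * K * S * (θ * a) ≤ 1) :
    (∀ t ∈ Icc 0 T, A (u t - v t) ≤ 2 * b) ∧
      ∫ τ in (0 : ℝ)..T, B (u τ - v τ) ^ 6 ≤ (4 * S * b) ^ 6 := by
  have hS := h.pos
  have hK : 0 < K := by linarith [h.one_le]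
  have hTT : T ∈ Icc 0 T := right_mem_Icc.2 hT0
  have hAu : Continuous fun τ => A (u τ) := (continuous_seminorm A).comp hu
  have hBu : Continuous fun τ => B (u τ) := (continuous_seminorm B).comp hu
  have hAv : Continuous fun τ => A (v τ) := (continuous_seminorm A).comp hv
  have hBv : Continuous fun τ => B (v τ) := (continuous_seminorm B).comp hv
  have hAw : Continuous fun τ => A (u τ - v τ) := (continuous_seminorm A).comp (hu.sub hv)
  have hBw : Continuous fun τ => B (u τ - v τ) := (continuous_seminorm B).comp (hu.sub hv)
  have hu' := fun t ht => h.a_priori hμ hT1 hθ hTθ hu hDu ha0 hau hsmall (t := t) ht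
  have hv' := fun t ht => h.a_priori hμ hT1 hθ hTθ hv hDv ha0 hav hsmall (t := t) ht
  set g : ℝ → ℝ := fun τ => 2 * K ^ 2 * ((B (u τ) * B (u τ) + B (v τ) * B (v τ)) * A (u τ - v τ) +
      (A (u τ) + A (v τ)) * ((B (u τ) + B (v τ)) * B (u τ - v τ))) with hgdef
  have hg : Continuous g := by rw [hgdef]; fun_prop
  have hgi : ∀ a b : ℝ, IntervalIntegrable g volume a b := fun a b => hg.intervalIntegrable a b
  have hF : ∀ τ, A (cubic M (u τ) - cubic M (v τ)) ≤ g τ := fun τ => h.cubic_sub_le _ _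
  have hg0 : ∀ τ, 0 ≤ g τ := fun τ => (apply_nonneg A _).trans (hF τ)
  have hD : ∀ t ∈ Icc 0 T, u t - v t = prop α M t ((u₀ - v₀) - (Complex.I * (μ : ℂ)) •
      ∫ τ in (0 : ℝ)..t, prop α M (-τ) (cubic M (u τ) - cubic M (v τ))) := by
    intro t ht
    have hcu := continuous_prop_apply (α := α) continuous_neg (continuous_cubic.comp hu)
    have hcv := continuous_prop_apply (α := α) continuous_neg (continuous_cubic.comp hv)
    have e : ∫ τ in (0 : ℝ)..t, prop α M (-τ) (cubic M (u τ) - cubic M (v τ)) =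
        (∫ τ in (0 : ℝ)..t, prop α M (-τ) (cubic M (u τ))) -
          ∫ τ in (0 : ℝ)..t, prop α M (-τ) (cubic M (v τ)) := by
      simp only [map_sub]
      exact intervalIntegral.integral_sub (hcu.intervalIntegrable _ _) (hcv.intervalIntegrable _ _)
    rw [hDu t ht, hDv t ht, ← map_sub, e, smul_sub]
    congr 1
    abel
  have hlin : ∀ t ∈ Icc 0 T, _ := fun t ht => h.linear_estimates hμ hT1 (hu.sub hv)
    ((continuous_cubic.comp hu).sub (continuous_cubic.comp hv)) hg hF hD hb ht
  -- The forcing is linear in the difference, so no continuity argument is needed: the estimates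
  -- give Y ≤ b + (192/400)Y, which is absorbed into Y ≤ 2b.
  set Y := b + ∫ τ in (0 : ℝ)..T, g τ with hY
  have hY0 : 0 < Y := add_pos_of_pos_of_nonneg hb0
    (intervalIntegral.integral_nonneg hT0 fun τ _ => hg0 τ)
  have hAY : ∀ t ∈ Icc 0 T, A (u t - v t) ≤ Y := by
    intro t ht
    refine (hlin t ht).1.trans ?_
    have : ∫ τ in (0 : ℝ)..t, g τ ≤ ∫ τ in (0 : ℝ)..T, g τ :=
      intervalIntegral.integral_mono_interval le_rfl ht.1 ht.2
        (Filter.Eventually.of_forall hg0) (hgi _ _)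
    linarith
  have hBY : ∫ τ in (0 : ℝ)..T, B (u τ - v τ) ^ 6 ≤ (2 * S * Y) ^ 6 := (hlin T hTT).2
  have hpa : 0 < 4 * S * a := by positivity
  have hpY : 0 < 2 * S * Y := by positivity
  have i1 := integral_mul_le_of_pow_six hBu hBu hT0 hθ hTθ hpa hpa (hu' T hTT).2 (hu' T hTT).2
  have i2 := integral_mul_le_of_pow_six hBv hBv hT0 hθ hTθ hpa hpa (hv' T hTT).2 (hv' T hTT).2
  have i3 := integral_mul_le_of_pow_six hBu hBw hT0 hθ hTθ hpa hpY (hu' T hTT).2 hBY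
  have i4 := integral_mul_le_of_pow_six hBv hBw hT0 hθ hTθ hpa hpY (hv' T hTT).2 hBY
  have h1 : ∫ τ in (0 : ℝ)..T, g τ ≤ ∫ τ in (0 : ℝ)..T,
      2 * K ^ 2 * (Y * (B (u τ) * B (u τ) + B (v τ) * B (v τ)) +
        4 * a * (B (u τ) * B (u τ - v τ) + B (v τ) * B (u τ - v τ))) := by
    refine intervalIntegral.integral_mono_on hT0 (hgi _ _)
      (Continuous.intervalIntegrable (by fun_prop) _ _) fun τ hτ => ?_
    have h3 := hAY τ hτ
    have h4 : A (u τ) + A (v τ) ≤ 4 * a := by linarith [(hu' τ hτ).1, (hv' τ hτ).1]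
    have p1 := apply_nonneg B (u τ)
    have p2 := apply_nonneg B (v τ)
    have p3 := apply_nonneg B (u τ - v τ)
    calc g τ ≤ 2 * K ^ 2 * ((B (u τ) * B (u τ) + B (v τ) * B (v τ)) * Y +
          4 * a * ((B (u τ) + B (v τ)) * B (u τ - v τ))) := by simp only [hgdef]; gcongr
      _ = _ := by ring
  have ci : ∀ {f : ℝ → ℝ}, Continuous f → IntervalIntegrable f volume 0 T :=
    fun hf => hf.intervalIntegrable _ _
  have h2 : ∫ τ in (0 : ℝ)..T, 2 * K ^ 2 * (Y * (B (u τ) * B (u τ) + B (v τ) * B (v τ)) +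
        4 * a * (B (u τ) * B (u τ - v τ) + B (v τ) * B (u τ - v τ))) =
      2 * K ^ 2 * (Y * ((∫ τ in (0 : ℝ)..T, B (u τ) * B (u τ)) +
        ∫ τ in (0 : ℝ)..T, B (v τ) * B (v τ)) +
        4 * a * ((∫ τ in (0 : ℝ)..T, B (u τ) * B (u τ - v τ)) +
          ∫ τ in (0 : ℝ)..T, B (v τ) * B (u τ - v τ))) := by
    rw [intervalIntegral.integral_const_mul, intervalIntegral.integral_add (ci (by fun_prop))
      (ci (by fun_prop)), intervalIntegral.integral_const_mul, intervalIntegral.integral_const_mul,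
      intervalIntegral.integral_add (ci (by fun_prop)) (ci (by fun_prop)),
      intervalIntegral.integral_add (ci (by fun_prop)) (ci (by fun_prop))]
  rw [h2] at h1
  have h6 : ∫ τ in (0 : ℝ)..T, g τ ≤ 192 * (K * S * (θ * a)) ^ 2 * Y := by
    refine h1.trans ?_
    calc _ ≤ 2 * K ^ 2 * (Y * (4 * S * a * (4 * S * a) * θ ^ 2 + 4 * S * a * (4 * S * a) * θ ^ 2) +
          4 * a * (4 * S * a * (2 * S * Y) * θ ^ 2 + 4 * S * a * (2 * S * Y) * θ ^ 2)) := by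
          gcongr
      _ = _ := by ring
  have h7 : (K * S * (θ * a)) ^ 2 ≤ (1 / 20) ^ 2 :=
    pow_le_pow_left₀ (by positivity) (by linarith) 2
  have h8 : 192 * (K * S * (θ * a)) ^ 2 * Y ≤ 192 * (1 / 20) ^ 2 * Y := by gcongr
  have hY2 : Y ≤ 2 * b := by linarith
  refine ⟨fun t ht => (hAY t ht).trans hY2, hBY.trans ?_⟩
  refine pow_le_pow_left₀ hpY.le ?_ 6
  have := mul_le_mul_of_nonneg_left hY2 hS.le
  linarith

/-- The a priori and difference bounds in terms of the size of the data. -/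
theorem wellPosed (h : Admissible α S K A B) {μ : ℝ} (hμ : |μ| = 1) {T : ℝ} (hT0 : 0 < T)
    (hT1 : T ≤ 1) {u₀ v₀ : Lattice M → ℂ} {u v : ℝ → Lattice M → ℂ}
    (hu : Continuous u) (hv : Continuous v)
    (hDu : Duhamel α μ T u₀ u) (hDv : Duhamel α μ T v₀ v)
    (hu₀ : T * A u₀ ^ 3 ≤ (1 / (40 * K * S)) ^ 3) (hv₀ : T * A v₀ ^ 3 ≤ (1 / (40 * K * S)) ^ 3) :
    (∀ t ∈ Icc 0 T, A (u t) ≤ 2 * A u₀) ∧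
    ∫ τ in (0 : ℝ)..T, B (u τ) ^ 6 ≤ (4 * S * A u₀) ^ 6 ∧
    (∀ t ∈ Icc 0 T, A (u t - v t) ≤ 2 * A (u₀ - v₀)) ∧
    ∫ τ in (0 : ℝ)..T, B (u τ - v τ) ^ 6 ≤ (4 * S * A (u₀ - v₀)) ^ 6 := by
  have hS := h.pos
  have hK : 0 < K := by linarith [h.one_le]
  -- With θ = T^{1/3} the smallness of T A(u₀)³ is that of θ A(u₀), and θ² is the Hölder factor
  -- T^{2/3}.
  obtain ⟨θ, hθ, hθ3⟩ : ∃ θ : ℝ, 0 < θ ∧ θ ^ 3 = T :=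
    ⟨T ^ (1 / 3 : ℝ), by positivity, by
      rw [← Real.rpow_natCast, ← Real.rpow_mul hT0.le]; norm_num⟩
  have hθ1 : θ ≤ 1 := by
    by_contra! hlt
    have := one_lt_pow₀ hlt (n := 3) (by norm_num)
    linarith
  have hc : 0 < 1 / (40 * K * S) := by positivity
  have hsm : ∀ {w : Lattice M → ℂ}, T * A w ^ 3 ≤ (1 / (40 * K * S)) ^ 3 →
      θ * A w ≤ 1 / (40 * K * S) := by
    intro w hw
    rw [← hθ3, ← mul_pow] at hw
    exact le_of_pow_le_pow_left₀ (by norm_num) hc.le hw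
  have hsmall : ∀ {a ε : ℝ}, θ * a ≤ 1 / (40 * K * S) → 0 < ε → ε < 1 / (40 * K * S) →
      20 * K * S * (θ * (a + ε)) ≤ 1 := by
    intro a ε h1 h2 h3
    have h4 : θ * ε ≤ 1 / (40 * K * S) := by nlinarith
    calc _ ≤ 20 * K * S * (1 / (40 * K * S) + 1 / (40 * K * S)) := by
          rw [mul_add θ]; gcongr
      _ = 1 := by field_simp; norm_num
  -- `a_priori` and `difference` need strictly positive bounds of the data. The norms are enlarged
  -- by ε, for which the 40 in place of 20 leaves room, and ε tends to 0.
  have hev : ∀ᶠ ε in nhdsWithin (0 : ℝ) (Ioi 0), 0 < ε ∧ ε < 1 / (40 * K * S) :=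
    Ioo_mem_nhdsGT hc
  have hlim : ∀ {φ : ℝ → ℝ} {x : ℝ}, Continuous φ → (∀ ε, 0 < ε → ε < 1 / (40 * K * S) → x ≤ φ ε) →
      x ≤ φ 0 := fun hφ hx => ge_of_tendsto ((hφ.tendsto 0).mono_left nhdsWithin_le_nhds)
        (hev.mono fun ε hε => hx ε hε.1 hε.2)
  have hA0 := apply_nonneg A u₀
  have hap := fun t ht ε (hε : 0 < ε) (hε' : ε < 1 / (40 * K * S)) =>
    h.a_priori hμ hT1 hθ hθ3.ge hu hDu (a := A u₀ + ε) (by positivity) (by linarith)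
      (hsmall (hsm hu₀) hε hε') (t := t) ht
  have hm : θ * max (A u₀) (A v₀) ≤ 1 / (40 * K * S) := by
    rcases max_choice (A u₀) (A v₀) with h | h <;> rw [h]
    · exact hsm hu₀
    · exact hsm hv₀
  have hm0 : 0 ≤ max (A u₀) (A v₀) := le_max_of_le_left hA0
  have hd := fun ε (hε : 0 < ε) (hε' : ε < 1 / (40 * K * S)) =>
    h.difference hμ hT0.le hT1 hθ hθ3.ge hu hv hDu hDv (a := max (A u₀) (A v₀) + ε)
      (b := A (u₀ - v₀) + ε) (by positivity) (add_pos_of_nonneg_of_pos (apply_nonneg A _) hε)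
      ((le_max_left _ _).trans (by linarith)) ((le_max_right _ _).trans (by linarith))
      (by linarith) (hsmall hm hε hε')
  refine ⟨fun t ht => ?_, ?_, fun t ht => ?_, ?_⟩
  · have := hlim (φ := fun ε => 2 * (A u₀ + ε)) (by fun_prop) fun ε h1 h2 => (hap t ht ε h1 h2).1
    simpa using this
  · have := hlim (φ := fun ε => (4 * S * (A u₀ + ε)) ^ 6) (by fun_prop)
      fun ε h1 h2 => (hap T (right_mem_Icc.2 hT0.le) ε h1 h2).2
    simpa using this
  · have := hlim (φ := fun ε => 2 * (A (u₀ - v₀) + ε)) (by fun_prop)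
      fun ε h1 h2 => (hd ε h1 h2).1 t ht
    simpa using this
  · have := hlim (φ := fun ε => (4 * S * (A (u₀ - v₀) + ε)) ^ 6) (by fun_prop)
      fun ε h1 h2 => (hd ε h1 h2).2
    simpa using this

end Admissible

end FDNLS
end

/-! ### Admissible pairs for all s > 1/3 and conclusion -/

noncomputable section
set_option linter.unusedSectionVars false
namespace FDNLS
open Set MeasureTheory

variable {M : ℕ} [NeZero M] {α s : ℝ}

/-- The Sobolev norm as a seminorm. -/
def sobolevSeminorm (s : ℝ) (M : ℕ) [NeZero M] : Seminorm ℂ (Lattice M → ℂ) :=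
  (normSeminorm ℂ (EuclideanSpace ℂ (Lattice M))).comp
    ((WithLp.linearEquiv 2 ℂ (Lattice M → ℂ)).symm.toLinearMap ∘ₗ
      LinearMap.mulLeft ℂ (fun k : Lattice M =>
        ((Real.sqrt ((2 * Real.pi)⁻¹ * bracket ((k : ℤ) : ℝ) ^ (2 * s)) : ℝ) : ℂ)) ∘ₗ fourierL M)

lemma sobolevSeminorm_apply (s : ℝ) (f : Lattice M → ℂ) :
    sobolevSeminorm s M f = sobolevNorm s M f := by
  have hpi := Real.pi_pos
  have h : sobolevSeminorm s M f = ‖WithLp.toLp 2 (fun k : Lattice M =>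
      ((Real.sqrt ((2 * Real.pi)⁻¹ * bracket ((k : ℤ) : ℝ) ^ (2 * s)) : ℝ) : ℂ) * fourier M f k)‖ :=
    rfl
  rw [h, EuclideanSpace.norm_eq, sobolevNorm, Finset.mul_sum]
  congr 1
  refine Finset.sum_congr rfl fun k _ => ?_
  have hb := bracket_pos ((k : ℤ) : ℝ)
  rw [norm_mul, mul_pow, Complex.norm_real, Real.norm_eq_abs, sq_abs,
    Real.sq_sqrt (by positivity), mul_assoc]

/-- The norm of the Wiener algebra as a seminorm. -/
def wienerSeminorm (M : ℕ) [NeZero M] : Seminorm ℂ (Lattice M → ℂ) :=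
  Seminorm.of wiener
    (fun f g => by
      simp only [wiener, hat_add, Pi.add_apply, ← Finset.sum_add_distrib]
      exact Finset.sum_le_sum fun _ _ => norm_add_le _ _)
    (fun a f => by
      simp only [wiener, hat, fourier_smul, Pi.smul_apply, smul_eq_mul, norm_mul, Finset.mul_sum]
      exact Finset.sum_congr rfl fun _ _ => by ring)

lemma wienerSeminorm_apply (f : Lattice M → ℂ) : wienerSeminorm M f = wiener f := rfl

/-- A pair of seminorms, with uniform constants, that dominates the maximum norm. -/
theorem exists_admissible (hα₁ : 1 < α) (hα₂ : α ≤ 2) (hs : 1 / 3 < s) :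
    ∃ S K : ℝ, 0 < S ∧ 1 ≤ K ∧ ∀ (M : ℕ) [NeZero M], ∃ B : Seminorm ℂ (Lattice M → ℂ),
      Admissible α S K (sobolevSeminorm s M) B ∧ ∀ f, ‖f‖ ≤ B f := by
  -- For s ≤ 1/2, B is the sup norm and the Strichartz estimate is essential. For s > 1/2, B is the
  -- Wiener norm; the flow preserves it, so its L⁶ bound on unit time is just
  -- `wiener_le_sobolevNorm`.
  rcases le_or_gt s (1 / 2) with h2 | h2
  · obtain ⟨C, hC, hstr⟩ := strichartz hα₁ hα₂ hs
    obtain ⟨K, hK, hmul⟩ := sobolevNorm_mul_le_sup (by linarith : 0 < s) h2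
    refine ⟨C ^ (1 / 6 : ℝ), max K 1, by positivity, le_max_right _ _, fun M _ =>
      ⟨normSeminorm ℂ _, ⟨by positivity, le_max_right _ _, fun t f => ?_, fun f => ?_,
        fun f g => ?_, fun f g => norm_mul_le f g, fun f => ?_, fun f => norm_star f⟩,
        fun f => le_rfl⟩⟩
    · simp only [sobolevSeminorm_apply, sobolevNorm_prop]
    · have e : (C ^ (1 / 6 : ℝ)) ^ 6 = C := by
        rw [← Real.rpow_natCast, ← Real.rpow_mul hC.le]; norm_num
      rw [sobolevSeminorm_apply, mul_pow, e]
      exact hstr M f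
    · simp only [sobolevSeminorm_apply, coe_normSeminorm]
      refine (hmul M f g).trans ?_
      have := sobolevNorm_nonneg s f
      have := sobolevNorm_nonneg s g
      gcongr
      exact le_max_left _ _
    · simp only [sobolevSeminorm_apply, sobolevNorm_star]
  · obtain ⟨C, hC, hle⟩ := wiener_le_sobolevNorm h2
    have h1 : (1 : ℝ) ≤ 2 ^ s := Real.one_le_rpow (by norm_num) (by linarith)
    refine ⟨C, 2 * 2 ^ s, hC, by linarith, fun M _ =>
      ⟨wienerSeminorm M, ⟨hC, by linarith, fun t f => ?_, fun f => ?_, fun f g => ?_,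
        wiener_mul_le, fun f => ?_, wiener_star⟩, norm_le_wiener⟩⟩
    · simp only [sobolevSeminorm_apply, sobolevNorm_prop]
    · simp only [wienerSeminorm_apply, wiener_prop, sobolevSeminorm_apply,
        intervalIntegral.integral_const, sub_zero, one_smul]
      exact pow_le_pow_left₀ (wiener_nonneg f) (hle M f) 6
    · simp only [wienerSeminorm_apply, sobolevSeminorm_apply]
      exact sobolevNorm_mul_le_wiener (by linarith) f g
    · simp only [sobolevSeminorm_apply, sobolevNorm_star]

lemma l6LinftyNorm_le {B : Seminorm ℂ (Lattice M → ℂ)} (hB : ∀ f, ‖f‖ ≤ B f) {T Z : ℝ}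
    (hT : 0 ≤ T) {u w : ℝ → Lattice M → ℂ} (hw : Continuous w) (huw : EqOn u w (Icc 0 T))
    (hZ : 0 ≤ Z) (h : ∫ τ in (0 : ℝ)..T, B (w τ) ^ 6 ≤ Z ^ 6) :
    l6LinftyNorm M T u ≤ ENNReal.ofReal Z := by
  have hc : Continuous fun τ => B (w τ) := hw.seminorm_comp B
  have h1 : l6LinftyNorm M T u ≤ eLpNorm (fun t => B (w t)) 6 (volume.restrict (Icc 0 T)) := by
    refine eLpNorm_mono_ae_real ((ae_restrict_iff' measurableSet_Icc).2
      (Filter.Eventually.of_forall fun t ht => ?_))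
    rw [linftyNorm_eq, norm_norm, huw ht]
    exact hB _
  refine h1.trans ?_
  rw [eLpNorm_eq_lintegral_rpow_enorm_toReal (by norm_num) (by norm_num)]
  rw [show (6 : ENNReal).toReal = (6 : ℕ) from rfl]
  have hc6 : Continuous fun τ => B (w τ) ^ 6 := hc.pow 6
  have h2 : ∫⁻ t in Icc 0 T, ‖B (w t)‖ₑ ^ ((6 : ℕ) : ℝ) =
      ENNReal.ofReal (∫ τ in (0 : ℝ)..T, B (w τ) ^ 6) := by
    rw [intervalIntegral.integral_of_le hT, ← integral_Icc_eq_integral_Ioc,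
      ofReal_integral_eq_lintegral_ofReal hc6.integrableOn_Icc
        (Filter.Eventually.of_forall fun τ => pow_nonneg (apply_nonneg B _) 6)]
    refine lintegral_congr fun τ => ?_
    rw [ENNReal.rpow_natCast, ENNReal.ofReal_pow (apply_nonneg B _),
      Real.enorm_of_nonneg (apply_nonneg B _)]
  rw [h2]
  calc _ ≤ (ENNReal.ofReal (Z ^ 6)) ^ (1 / ((6 : ℕ) : ℝ)) := by gcongr
    _ = ENNReal.ofReal Z := by
      rw [ENNReal.ofReal_pow hZ, ← ENNReal.rpow_natCast, ← ENNReal.rpow_mul]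
      norm_num

/-- The uniform bounds, with constants depending only on `α` and `s`. -/
theorem uniform_bounds (hα₁ : 1 < α) (hα₂ : α ≤ 2) (hs : 1 / 3 < s) :
    ∃ c C : ℝ, 0 < c ∧ c ≤ 1 ∧ 0 < C ∧ ∀ μ : ℝ, |μ| = 1 → ∀ (M : ℕ) [NeZero M]
      (u₀ v₀ : Lattice M → ℂ) (T : ℝ), 0 < T → T ≤ 1 →
      T * sobolevNorm s M u₀ ^ 3 ≤ c → T * sobolevNorm s M v₀ ^ 3 ≤ c →
      ∀ u v : ℝ → Lattice M → ℂ, IsSolution α μ M T u₀ u → IsSolution α μ M T v₀ v →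
        (∀ t ∈ Icc 0 T, sobolevNorm s M (u t) ≤ C * sobolevNorm s M u₀) ∧
        l6LinftyNorm M T u ≤ ENNReal.ofReal (C * sobolevNorm s M u₀) ∧
        (∀ t ∈ Icc 0 T, sobolevNorm s M (u t - v t) ≤ C * sobolevNorm s M (u₀ - v₀)) ∧
        l6LinftyNorm M T (u - v) ≤ ENNReal.ofReal (C * sobolevNorm s M (u₀ - v₀)) := by
  obtain ⟨S, K, hS, hK, h⟩ := exists_admissible hα₁ hα₂ hs
  -- The minimum with 1 keeps c below κ; the sum 2 + 4S serves both the Sobolev bounds (2) and the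
  -- Strichartz bounds (4S).
  refine ⟨min 1 ((1 / (40 * K * S)) ^ 3), 2 + 4 * S, by positivity, min_le_left _ _, by positivity,
    fun μ hμ M _ u₀ v₀ T hT0 hT1 hu₀ hv₀ u v hu hv => ?_⟩
  obtain ⟨B, hadm, hB⟩ := h M
  obtain ⟨huc, huD⟩ := hu.duhamel hT0.le
  obtain ⟨hvc, hvD⟩ := hv.duhamel hT0.le
  have key := hadm.wellPosed hμ hT0 hT1 huc hvc huD hvD
    (by rw [sobolevSeminorm_apply]; exact hu₀.trans (min_le_right _ _))
    (by rw [sobolevSeminorm_apply]; exact hv₀.trans (min_le_right _ _))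
  simp only [sobolevSeminorm_apply] at key
  obtain ⟨k1, k2, k3, k4⟩ := key
  have n1 := sobolevNorm_nonneg s u₀
  have n2 := sobolevNorm_nonneg s (u₀ - v₀)
  refine ⟨fun t ht => ?_, ?_, fun t ht => ?_, ?_⟩
  · rw [← extend_apply (u := u) hT0.le ht]
    refine (k1 t ht).trans ?_
    gcongr
    linarith
  · refine (l6LinftyNorm_le hB hT0.le huc (fun t ht => (extend_apply hT0.le ht).symm)
      (by positivity) k2).trans (ENNReal.ofReal_le_ofReal ?_)
    gcongr
    linarith
  · rw [← extend_apply (u := u) hT0.le ht, ← extend_apply (u := v) hT0.le ht]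
    refine (k3 t ht).trans ?_
    gcongr
    linarith
  · refine (l6LinftyNorm_le hB hT0.le (huc.sub hvc) (fun t ht => ?_)
      (by positivity) k4).trans (ENNReal.ofReal_le_ofReal ?_)
    · rw [Pi.sub_apply, Pi.sub_apply, extend_apply hT0.le ht, extend_apply hT0.le ht]
    · gcongr
      linarith

end FDNLS
end

theorem mainTheorem8 (α : ℝ) (hα₁ : 1 < α) (hα₂ : α ≤ 2) :
    ∃ κ : ℝ, 0 < κ ∧ ∀ s : ℝ, 1 / 3 < s →
      -- existence, uniqueness and conservation laws on `[0,T]`, up to `T = κ ‖u₀‖_{H^s_h}^{-3}`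
      (∀ μ : ℝ, (μ = 1 ∨ μ = -1) → ∀ M : ℕ, 1 ≤ M → ∀ (u₀ : FDNLS.Lattice M → ℂ) (T : ℝ),
        0 < T → T * FDNLS.sobolevNorm s M u₀ ^ 3 ≤ κ →
        ∃ u : ℝ → FDNLS.Lattice M → ℂ,
          FDNLS.IsSolution α μ M T u₀ u ∧
          (∀ v : ℝ → FDNLS.Lattice M → ℂ,
            FDNLS.IsSolution α μ M T u₀ v → Set.EqOn v u (Set.Icc 0 T)) ∧
          (∀ t ∈ Set.Icc 0 T, FDNLS.mass M (u t) = FDNLS.mass M u₀) ∧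
          (∀ t ∈ Set.Icc 0 T, FDNLS.energy α μ M (u t) = FDNLS.energy α μ M u₀)) ∧
      -- bounds in the Strichartz space and Lipschitz dependence on the datum, uniformly in `h`
      (∃ c C : ℝ, 0 < c ∧ c ≤ κ ∧ 0 < C ∧
        ∀ μ : ℝ, (μ = 1 ∨ μ = -1) → ∀ M : ℕ, 1 ≤ M →
        ∀ (u₀ v₀ : FDNLS.Lattice M → ℂ) (T : ℝ), 0 < T → T ≤ 1 →
        T * FDNLS.sobolevNorm s M u₀ ^ 3 ≤ c → T * FDNLS.sobolevNorm s M v₀ ^ 3 ≤ c →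
        ∀ u v : ℝ → FDNLS.Lattice M → ℂ,
          FDNLS.IsSolution α μ M T u₀ u → FDNLS.IsSolution α μ M T v₀ v →
          (∀ t ∈ Set.Icc 0 T,
            FDNLS.sobolevNorm s M (u t) ≤ C * FDNLS.sobolevNorm s M u₀) ∧
          FDNLS.l6LinftyNorm M T u ≤ ENNReal.ofReal (C * FDNLS.sobolevNorm s M u₀) ∧
          (∀ t ∈ Set.Icc 0 T,
            FDNLS.sobolevNorm s M (u t - v t) ≤ C * FDNLS.sobolevNorm s M (u₀ - v₀)) ∧
          FDNLS.l6LinftyNorm M T (u - v) ≤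
            ENNReal.ofReal (C * FDNLS.sobolevNorm s M (u₀ - v₀))) := by
  -- Solutions on a fixed lattice are global, so any positive κ would do; 1 is the bound that
  -- `uniform_bounds` provides for c.
  refine ⟨1, one_pos, fun s hs => ⟨fun μ _ M hM u₀ T hT _ => ?_, ?_⟩⟩
  · have : NeZero M := ⟨by omega⟩
    exact FDNLS.exists_solution α μ u₀ T hT
  · obtain ⟨c, C, hc, hc1, hC, h⟩ := FDNLS.uniform_bounds hα₁ hα₂ hs
    refine ⟨c, C, hc, hc1, hC, fun μ hμ M hM => ?_⟩
    have : NeZero M := ⟨by omega⟩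
    have hμ' : |μ| = 1 := by rcases hμ with rfl | rfl <;> simp
    exact h μ hμ' M
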